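/- Let $N\ge 10$, let $B\subset\mathbb{R}^N$ be the open unit ball, and let $f(u)=e^{g(u)}$ for $u\ge 0$, where $g\in C^3[0,\infty)$ satisfies $$g'>0,\qquad g''>0,\qquad g'^2-g''\ge 0,\qquad 2g''^2-g'g'''>0\qquad\text{on }[0,\infty).$$ Consider the problem $$\Delta u+\lambda f(u)=0\ \text{ in }B,\qquad u=0\ \text{ on }\partial B,\qquad u>0\ \text{ in }B,\qquad \lambda>0. \tag{P}$$ A classical solution of (P) is a pair $(\lambda,u)$ with $u\in C^2(B)\cap C(\overline B)$. A radial singular solution of (P) is a pair $(\lambda,u)$, where $u\in C^2(B\setminus\{0\})\cap C(\overline B\setminus\{0\})$ is radial, satisfies the equation and positivity in $B\setminus\{0\}$ and the boundary condition on $\partial B$, and $u(x)\to\infty$ as $x\to 0$. Then there exists $\lambda^*>0$ such that the bifurcation diagram of (P) is of Type II with limit value $\lambda^*$, that is: 1. the classical solutions of (P) form a curve parametrized by $\alpha=\|u\|_{L^\infty(B)}\in(0,\infty)$: for every $\alpha>0$ there is exactly one classical solution $(\lambda(\alpha),u_\alpha)$ with $\|u_\alpha\|_{L^\infty(B)}=\alpha$,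 and $\lambda(\alpha)$ is continuous with $\lambda(\alpha)\to 0$ as $\alpha\to 0^+$; 2. $\lambda(\alpha)$ is strictly increasing in $\alpha$, and $\lambda(\alpha)\to\lambda^*$ as $\alpha\to\infty$; 3. for every $0<\lambda<\lambda^*$ problem (P) has exactly one classical solution; 4. a radial singular solution exists for $\lambda=\lambda^*$. Moreover, the radial singular solution $(\lambda^*,u^*)$ is unique among all pairs $(\lambda,u)$, and it is stable: $$\int_B\left(|\nabla\varphi|^2-\lambda^*f'(u^*)\varphi^2\right)dx\ge 0\qquad\text{for all }\varphi\in C^1_0(B),$$ where $C^1_0(B)$ is the set of $C^1$ functions with compact support in $B$, and the integrand is integrable for each such $\varphi$. -/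

import Mathlib

/-- A positive classical solution, of class `C²(B) ∩ C(closure B)`, of the Dirichlet problem
`Δu + lam f(u) = 0` in `B`, `u = 0` on `∂B`, `u > 0` in `B`, where `B` is the open unit ball of
`ℝ^N` and `lam > 0`. Only the values of `f` on `[0, ∞)` matter. -/
structure IsClassicalSolution (N : ℕ) (f : ℝ → ℝ) (lam : ℝ)
    (u : EuclideanSpace ℝ (Fin N) → ℝ) : Prop where
  lam_pos : 0 < lam
  contDiffOn : ContDiffOn ℝ 2 u (Metric.ball 0 1)
  continuousOn : ContinuousOn u (Metric.closedBall 0 1)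
  equation : ∀ x ∈ Metric.ball (0 : EuclideanSpace ℝ (Fin N)) 1,
    Laplacian.laplacian u x + lam * f (u x) = 0
  boundary : ∀ x ∈ Metric.sphere (0 : EuclideanSpace ℝ (Fin N)) 1, u x = 0
  pos : ∀ x ∈ Metric.ball (0 : EuclideanSpace ℝ (Fin N)) 1, 0 < u x

/-- A positive radial singular solution of the same Dirichlet problem: it solves the problem in the
punctured ball and tends to `∞` at the origin. The value at the origin itself is irrelevant. -/
structure IsRadialSingularSolution (N : ℕ) (f : ℝ → ℝ) (lam : ℝ)
    (u : EuclideanSpace ℝ (Fin N) → ℝ) : Prop where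
  lam_pos : 0 < lam
  radial : ∀ x ∈ Metric.closedBall (0 : EuclideanSpace ℝ (Fin N)) 1 \ {0},
    ∀ y ∈ Metric.closedBall (0 : EuclideanSpace ℝ (Fin N)) 1 \ {0}, ‖x‖ = ‖y‖ → u x = u y
  contDiffOn : ContDiffOn ℝ 2 u (Metric.ball 0 1 \ {0})
  continuousOn : ContinuousOn u (Metric.closedBall 0 1 \ {0})
  equation : ∀ x ∈ Metric.ball (0 : EuclideanSpace ℝ (Fin N)) 1 \ {0},
    Laplacian.laplacian u x + lam * f (u x) = 0
  boundary : ∀ x ∈ Metric.sphere (0 : EuclideanSpace ℝ (Fin N)) 1, u x = 0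
  pos : ∀ x ∈ Metric.ball (0 : EuclideanSpace ℝ (Fin N)) 1 \ {0}, 0 < u x
  singular : Filter.Tendsto u (nhdsWithin 0 {0}ᶜ) Filter.atTop

/-- `a` is the supremum norm of `u` on the open unit ball. -/
def HasSupNorm {N : ℕ} (u : EuclideanSpace ℝ (Fin N) → ℝ) (a : ℝ) : Prop :=
  IsLUB ((fun x => |u x|) '' Metric.ball (0 : EuclideanSpace ℝ (Fin N)) 1) a

/-- The set of all positive classical solutions is a curve parametrized by the supremum norm
`a > 0` of the solution, with parameter `lam = L a`, and this curve starts from `L = 0` at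
`a = 0`. -/
structure IsBifurcationCurve (N : ℕ) (f : ℝ → ℝ) (L : ℝ → ℝ) : Prop where
  exists_solution : ∀ a : ℝ, 0 < a → ∃ u, IsClassicalSolution N f (L a) u ∧ HasSupNorm u a
  eq_param : ∀ a lam u, IsClassicalSolution N f lam u → HasSupNorm u a → lam = L a
  unique_solution : ∀ a lam u lam' u', IsClassicalSolution N f lam u → HasSupNorm u a →
    IsClassicalSolution N f lam' u' → HasSupNorm u' a → Set.EqOn u u' (Metric.closedBall 0 1)
  continuousOn : ContinuousOn L (Set.Ioi 0)
  tendsto_zero : Filter.Tendsto L (nhdsWithin 0 (Set.Ioi 0)) (nhds 0)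

/-- The bifurcation diagram is of Type II with limit value `lamStar`. -/
def IsTypeII (N : ℕ) (f : ℝ → ℝ) (lamStar : ℝ) : Prop :=
  (∃ L : ℝ → ℝ, IsBifurcationCurve N f L ∧ StrictMonoOn L (Set.Ioi 0) ∧
    Filter.Tendsto L Filter.atTop (nhds lamStar)) ∧
  (∀ lam ∈ Set.Ioo 0 lamStar, ∃ u, IsClassicalSolution N f lam u ∧
    ∀ w, IsClassicalSolution N f lam w → Set.EqOn w u (Metric.closedBall 0 1)) ∧
  ∃ u, IsRadialSingularSolution N f lamStar u

/-- Stability of a (possibly singular) solution `u`: the quadratic form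
`∫_B (|∇φ|² - lam f'(u) φ²)` is well defined and nonnegative for every `C¹` function `φ` with
compact support in the open unit ball `B`. Here `f'` is the derivative of `f` on `[0, ∞)`. -/
def IsStableSolution (N : ℕ) (f : ℝ → ℝ) (lam : ℝ)
    (u : EuclideanSpace ℝ (Fin N) → ℝ) : Prop :=
  ∀ φ : EuclideanSpace ℝ (Fin N) → ℝ, ContDiff ℝ 1 φ → HasCompactSupport φ →
    tsupport φ ⊆ Metric.ball 0 1 →
    MeasureTheory.IntegrableOn
      (fun x => ‖gradient φ x‖ ^ 2 - lam * derivWithin f (Set.Ici 0) (u x) * φ x ^ 2)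
      (Metric.ball 0 1) ∧
    0 ≤ ∫ x in Metric.ball (0 : EuclideanSpace ℝ (Fin N)) 1,
      (‖gradient φ x‖ ^ 2 - lam * derivWithin f (Set.Ici 0) (u x) * φ x ^ 2)

/-! Write f = exp ∘ g. A radial solution is u(x) = F(λ|x|²), and in the variable s = λ|x|² the
equation becomes 4sF'' + 2NF' + f(F) = 0, with λ no longer present: λ is the first zero of F. The
problem is thus to compare positive profiles, regular or singular, and their first zeros.

The heart of the proof is a pointwise bound valid for every positive profile,
`IsProfile.potential_le`: s f'(F(s)) ≤ (N-2)²/4. Two monotone quantities, built from -F' and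
1/f'(F), give s f'(F) ≤ ((N+6)/4)², and (N+6)/4 ≤ (N-2)/2 exactly when N ≥ 10. Back in the ball this
reads λ f'(u) ≤ (N-2)²/(4|x|²), the Hardy potential, so stability of the singular solution is
Hardy's inequality (`hardy_inequality`).

The same bound prevents crossing. If A ≥ B are profiles, convexity of f makes A - B a subsolution of
the linear equation with Hardy potential, so s^((N-2)/4)(A - B) is nondecreasing: profiles ordered
near the origin stay strictly ordered, and the larger one vanishes later
(`IsProfile.lt_of_eventually_lt`, `IsProfile.end_lt`). Hence the first zero S(α) of the regular
profile of height α is strictly increasing. It is Lipschitz, tends to 0 with α, and is bounded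
because S f'(0) ≤ (N-2)²/4. Its limit is λ*, and the profiles increase to a singular profile V with
first zero λ*.

For uniqueness, comparison with the regular profiles puts any singular profile W above V. The gap W
- V decreases in s, so if it is positive somewhere it is bounded below near the origin. It then
dominates a multiple of V and tends to infinity, so s f'(V) is exponentially small compared with the
Hardy constant. Through g'' ≤ g'², a small potential forces V to stay bounded at the origin, a
contradiction (`IsProfile.not_tendsto_atTop_of_gap`).

Classical solutions are not assumed radial. Their symmetry is the moving plane theorem
`IsDirichletSolution.radial`, with an explicit barrier serving as the maximum principle in narrow
regions. -/

open Set Filter Topology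

/-- The exponent `g` of a nonlinearity `exp ∘ g` on `[0, ∞)`, with its first two derivatives
`g₁` and `g₂`: it is increasing and convex, and `g₂ ≤ g₁²`. -/
structure IsConvexExponent (g g₁ g₂ : ℝ → ℝ) : Prop where
  cont : ContinuousOn g (Ici 0)
  cont₁ : ContinuousOn g₁ (Ici 0)
  deriv : ∀ t, 0 < t → HasDerivAt g (g₁ t) t
  deriv₁ : ∀ t, 0 < t → HasDerivAt g₁ (g₂ t) t
  pos₁ : ∀ t, 0 ≤ t → 0 < g₁ t
  nonneg₂ : ∀ t, 0 < t → 0 ≤ g₂ t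
  le₂ : ∀ t, 0 < t → g₂ t ≤ g₁ t ^ 2

/-- `F`, with derivative `F₁`, is a positive solution on `(0, S)` of the equation
`4 s F'' + 2 ν F' + exp (g F) = 0`, which is the radial equation in dimension `ν` written in the
variable `s = r²`. -/
structure IsProfile (ν : ℝ) (g F F₁ : ℝ → ℝ) (S : ℝ) : Prop where
  pos : ∀ s ∈ Ioo 0 S, 0 < F s
  deriv : ∀ s ∈ Ioo 0 S, HasDerivAt F (F₁ s) s
  deriv₁ : ∀ s ∈ Ioo 0 S, HasDerivAt F₁ (-(2 * ν * F₁ s + Real.exp (g (F s))) / (4 * s)) s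

/-! ### Radial superharmonicity and Sturm comparison at a singular endpoint -/

section Monotonicity

lemma monotoneOn_Ioo_of_hasDerivAt {F F' : ℝ → ℝ} {a b : ℝ}
    (h : ∀ s ∈ Ioo a b, HasDerivAt F (F' s) s) (h0 : ∀ s ∈ Ioo a b, 0 ≤ F' s) :
    MonotoneOn F (Ioo a b) := by
  refine monotoneOn_of_deriv_nonneg (convex_Ioo a b)
    (fun s hs => (h s hs).continuousAt.continuousWithinAt)
    (fun s hs => (h s (interior_subset hs)).differentiableAt.differentiableWithinAt) ?_
  intro s hs
  rw [(h s (interior_subset hs)).deriv]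
  exact h0 s (interior_subset hs)

lemma antitoneOn_Ioo_of_hasDerivAt {F F' : ℝ → ℝ} {a b : ℝ}
    (h : ∀ s ∈ Ioo a b, HasDerivAt F (F' s) s) (h0 : ∀ s ∈ Ioo a b, F' s ≤ 0) :
    AntitoneOn F (Ioo a b) := by
  have := monotoneOn_Ioo_of_hasDerivAt (F := fun s => -F s) (F' := fun s => -F' s)
    (fun s hs => (h s hs).neg) (fun s hs => by linarith [h0 s hs])
  intro x hx y hy hxy
  have := this hx hy hxy
  simp only at this
  linarith

/-- Plays the role of an initial condition at 0 for quantities whose limit there is unknown: a lower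
bound tending to 0 suffices. -/
lemma MonotoneOn.nonneg_of_tendsto_lower {Y η : ℝ → ℝ} {S : ℝ} (hY : MonotoneOn Y (Ioo 0 S))
    (hη : Tendsto η (𝓝[>] 0) (𝓝 0)) (hle : ∀ s ∈ Ioo 0 S, η s ≤ Y s) :
    ∀ s ∈ Ioo 0 S, 0 ≤ Y s := by
  intro s hs
  refine le_of_tendsto hη ?_
  filter_upwards [Ioo_mem_nhdsGT hs.1] with x hx
  have hx' : x ∈ Ioo 0 S := ⟨hx.1, hx.2.trans hs.2⟩
  exact (hle x hx').trans (hY hx' hs hx.2.le)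

lemma hasDerivAt_rpow_div {s : ℝ} (hs : 0 < s) (p : ℝ) :
    HasDerivAt (fun x : ℝ => x ^ p) (p * s ^ p / s) s := by
  have := Real.hasDerivAt_rpow_const (x := s) (p := p) (Or.inl hs.ne')
  rwa [Real.rpow_sub_one hs.ne', ← mul_div_assoc] at this

lemma tendsto_rpow_zero_nhdsGT {p : ℝ} (hp : 0 < p) :
    Tendsto (fun s : ℝ => s ^ p) (𝓝[>] 0) (𝓝 0) := by
  have := (Real.continuousAt_rpow_const 0 p (Or.inr hp.le)).tendsto
  rw [Real.zero_rpow hp.ne'] at this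
  exact this.mono_left nhdsWithin_le_nhds

/-- A radially superharmonic function with at most a weak negative singularity at the origin is
nonincreasing. -/
lemma deriv_nonpos_of_radial_superharmonic {ν S C : ℝ} (hν : 10 ≤ ν) {Ψ Ψ₁ Ψ₂ : ℝ → ℝ}
    (h : ∀ s ∈ Ioo 0 S, HasDerivAt Ψ (Ψ₁ s) s) (h₁ : ∀ s ∈ Ioo 0 S, HasDerivAt Ψ₁ (Ψ₂ s) s)
    (hsup : ∀ s ∈ Ioo 0 S, 4 * s * Ψ₂ s + 2 * ν * Ψ₁ s ≤ 0)
    (hlow : ∀ s ∈ Ioo 0 S, -C / s ≤ Ψ s) : ∀ s ∈ Ioo 0 S, Ψ₁ s ≤ 0 := by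
  intro s₁ hs₁
  by_contra! hpos
  set n := ν / 2 with hn
  have hn5 : 5 ≤ n := by rw [hn]; linarith
  -- Divergence form of the operator: 4sΨ'' + 2νΨ' = 4 s^(1-n) (s^n Ψ')' with n = ν/2.
  have hP : AntitoneOn (fun s => s ^ n * Ψ₁ s) (Ioo 0 S) := by
    refine antitoneOn_Ioo_of_hasDerivAt
      (fun s hs => (hasDerivAt_rpow_div hs.1 n).mul (h₁ s hs)) ?_
    intro s hs
    have h1 := hsup s hs
    have h2 : 0 < s ^ n := Real.rpow_pos_of_pos hs.1 n
    have h3 : n * s ^ n / s * Ψ₁ s + s ^ n * Ψ₂ s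
        = s ^ n / (4 * s) * (4 * s * Ψ₂ s + 2 * ν * Ψ₁ s) := by
      have := hs.1.ne'
      rw [hn]; field_simp; ring
    rw [h3]
    exact mul_nonpos_of_nonneg_of_nonpos (by have := hs.1; positivity) h1
  set δ := s₁ ^ n * Ψ₁ s₁ with hδ
  have hδ0 : 0 < δ := mul_pos (Real.rpow_pos_of_pos hs₁.1 n) hpos
  -- On (0, s₁) one has Ψ' ≥ δ s^(-n). Integrating towards 0 drives Ψ below a negative multiple of
  -- s^(1-n), which beats -C/s because n > 2.
  have hmono : MonotoneOn (fun s => Ψ s + δ / (n - 1) * s ^ (1 - n)) (Ioo 0 s₁) := by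
    refine monotoneOn_Ioo_of_hasDerivAt
      (fun s hs => (h s ⟨hs.1, hs.2.trans hs₁.2⟩).add
        ((hasDerivAt_rpow_div hs.1 (1 - n)).const_mul _)) ?_
    intro s hs
    have h2 : 0 < s ^ n := Real.rpow_pos_of_pos hs.1 n
    have h1 : δ ≤ s ^ n * Ψ₁ s := hP ⟨hs.1, hs.2.trans hs₁.2⟩ hs₁ hs.2.le
    have h3 : Ψ₁ s + δ / (n - 1) * ((1 - n) * s ^ (1 - n) / s) = (s ^ n * Ψ₁ s - δ) / s ^ n := by
      have := hs.1.ne'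
      have hn1 : n - 1 ≠ 0 := by linarith
      rw [Real.rpow_sub hs.1, Real.rpow_one]
      field_simp
      ring
    rw [h3]
    exact div_nonneg (by linarith) h2.le
  set A := Ψ (s₁ / 2) + δ / (n - 1) * (s₁ / 2) ^ (1 - n) with hA
  have hs₁0 := hs₁.1
  have hbd : ∀ s ∈ Ioo 0 (s₁ / 2), δ / (n - 1) ≤ A * s ^ (n - 1) + C * s ^ (n - 2) := by
    intro s hs
    have h1 := hmono (a := s) ⟨hs.1, by linarith [hs.2]⟩ (b := s₁ / 2)
      ⟨by linarith, by linarith⟩ hs.2.le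
    simp only at h1
    rw [← hA] at h1
    have h2 := hlow s ⟨hs.1, by linarith [hs.2, hs₁.2]⟩
    have h3 : 0 < s ^ n := Real.rpow_pos_of_pos hs.1 n
    have h4 : δ / (n - 1) * s ^ (1 - n) ≤ A + C / s := by
      have : -C / s = -(C / s) := by ring
      linarith
    have h5 := mul_le_mul_of_nonneg_right h4 (Real.rpow_pos_of_pos hs.1 (n - 1)).le
    have h6 : s ^ (1 - n) * s ^ (n - 1) = 1 := by
      rw [← Real.rpow_add hs.1]; simp
    have h7 : s ^ (n - 1) / s = s ^ (n - 2) := by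
      rw [← Real.rpow_sub_one hs.1.ne']; congr 1; ring
    calc δ / (n - 1) = δ / (n - 1) * s ^ (1 - n) * s ^ (n - 1) := by rw [mul_assoc, h6, mul_one]
      _ ≤ _ := h5
      _ = A * s ^ (n - 1) + C * (s ^ (n - 1) / s) := by ring
      _ = _ := by rw [h7]
  have hlim : Tendsto (fun s : ℝ => A * s ^ (n - 1) + C * s ^ (n - 2)) (𝓝[>] 0) (𝓝 0) := by
    have h1 := (tendsto_rpow_zero_nhdsGT (p := n - 1) (by linarith)).const_mul A
    have h2 := (tendsto_rpow_zero_nhdsGT (p := n - 2) (by linarith)).const_mul C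
    simpa using h1.add h2
  have : δ / (n - 1) ≤ 0 := by
    refine ge_of_tendsto hlim ?_
    filter_upwards [Ioo_mem_nhdsGT (half_pos hs₁0)] with s hs using hbd s hs
  have : 0 < δ / (n - 1) := div_pos hδ0 (by linarith)
  linarith

/-- Sturm comparison with the Hardy potential: a nonnegative function `d` with
`4 s d'' + 2 ν d' + 4 κ² d / s ≥ 0`, `κ = (ν - 2) / 4`, which is `O(1 / s)` at the origin, has
`s ^ κ * d` nondecreasing. -/
lemma monotoneOn_rpow_mul_of_hardy_subsolution {ν S C : ℝ} (hν : 10 ≤ ν) {d d₁ d₂ : ℝ → ℝ}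
    (h : ∀ s ∈ Ioo 0 S, HasDerivAt d (d₁ s) s) (h₁ : ∀ s ∈ Ioo 0 S, HasDerivAt d₁ (d₂ s) s)
    (hsub : ∀ s ∈ Ioo 0 S, 0 ≤ 4 * s * d₂ s + 2 * ν * d₁ s + (ν - 2) ^ 2 / 4 / s * d s)
    (hup : ∀ s ∈ Ioo 0 S, d s ≤ C / s) :
    MonotoneOn (fun s => s ^ ((ν - 2) / 4) * d s) (Ioo 0 S) := by
  set κ := (ν - 2) / 4 with hκ
  have hκ2 : 2 ≤ κ := by rw [hκ]; linarith
  have hν' : ν = 4 * κ + 2 := by rw [hκ]; ring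
  -- With m = s^κ d, this function is s m', the derivative of m in log s. Its monotonicity says that
  -- m is convex in log s, since (s m')' is s^κ/4 times the left side of the Hardy inequation.
  have hq : MonotoneOn (fun s => s ^ κ * (κ * d s + s * d₁ s)) (Ioo 0 S) := by
    refine monotoneOn_Ioo_of_hasDerivAt (fun s hs => (hasDerivAt_rpow_div hs.1 κ).mul
      (((h s hs).const_mul κ).add ((hasDerivAt_id s).mul (h₁ s hs)))) ?_
    intro s hs
    have hs0 := hs.1
    have h3 : κ * s ^ κ / s * (κ * d s + s * d₁ s) + s ^ κ * (κ * d₁ s + (1 * d₁ s + id s * d₂ s))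
        = s ^ κ / 4 * (4 * s * d₂ s + 2 * ν * d₁ s + (ν - 2) ^ 2 / 4 / s * d s) := by
      rw [hν']; simp only [id]; field_simp; ring
    exact h3 ▸ mul_nonneg (by positivity) (hsub s hs)
  have hm : ∀ s ∈ Ioo 0 S, HasDerivAt (fun s => s ^ κ * d s)
      (s ^ κ * (κ * d s + s * d₁ s) / s) s := by
    intro s hs
    have hs0 := hs.1.ne'
    have h3 : s ^ κ * (κ * d s + s * d₁ s) / s = κ * s ^ κ / s * d s + s ^ κ * d₁ s := by
      field_simp
    exact h3 ▸ (hasDerivAt_rpow_div hs.1 κ).mul (h s hs)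
  refine monotoneOn_Ioo_of_hasDerivAt hm ?_
  intro s₁ hs₁
  refine div_nonneg ?_ hs₁.1.le
  by_contra! hneg
  set δ := -(s₁ ^ κ * (κ * d s₁ + s₁ * d₁ s₁)) with hδ
  have hδ0 : 0 < δ := by linarith
  -- A negative slope at s₁ would, by convexity in log s, make m grow at least like -δ log s at the
  -- origin, whereas m ≤ C s^(κ-1) → 0.
  have hanti : AntitoneOn (fun s => s ^ κ * d s + δ * Real.log s) (Ioo 0 s₁) := by
    refine antitoneOn_Ioo_of_hasDerivAt (fun s hs => (hm s ⟨hs.1, hs.2.trans hs₁.2⟩).add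
      ((Real.hasDerivAt_log hs.1.ne').const_mul δ)) ?_
    intro s hs
    have h1 := hq ⟨hs.1, hs.2.trans hs₁.2⟩ hs₁ hs.2.le
    simp only at h1
    rw [← div_eq_mul_inv, ← add_div]
    exact div_nonpos_of_nonpos_of_nonneg (by linarith) hs.1.le
  have hs₁0 := hs₁.1
  set A := (s₁ / 2) ^ κ * d (s₁ / 2) + δ * Real.log (s₁ / 2)
  have hbd : ∀ s ∈ Ioo 0 (s₁ / 2), A ≤ C * s ^ (κ - 1) + δ * Real.log s := by
    intro s hs
    have h1 := hanti (a := s) ⟨hs.1, by linarith [hs.2]⟩ (b := s₁ / 2)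
      ⟨by linarith, by linarith⟩ hs.2.le
    simp only at h1
    have h2 := hup s ⟨hs.1, by linarith [hs.2, hs₁.2]⟩
    have h3 := mul_le_mul_of_nonneg_left h2 (Real.rpow_pos_of_pos hs.1 κ).le
    have h4 : s ^ κ * (C / s) = C * s ^ (κ - 1) := by
      rw [Real.rpow_sub_one hs.1.ne']; ring
    linarith
  have hlim : Tendsto (fun s : ℝ => C * s ^ (κ - 1) + δ * Real.log s) (𝓝[>] 0) atBot := by
    have h1 := (tendsto_rpow_zero_nhdsGT (p := κ - 1) (by linarith)).const_mul C
    exact h1.add_atBot (Real.tendsto_log_nhdsGT_zero.const_mul_atBot hδ0)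
  obtain ⟨s, hs1, hs2⟩ := ((hlim.eventually (eventually_lt_atBot A)).and
    (Ioo_mem_nhdsGT (half_pos hs₁0))).exists
  exact absurd (hbd s hs2) (not_le.mpr hs1)

end Monotonicity

/-! ### Convexity and growth of exp ∘ g -/

namespace IsConvexExponent

variable {g g₁ g₂ : ℝ → ℝ} (hg : IsConvexExponent g g₁ g₂)
include hg

lemma monotoneOn₁ : MonotoneOn g₁ (Ici 0) := by
  refine monotoneOn_of_deriv_nonneg (convex_Ici 0) hg.cont₁ ?_ ?_
  · intro t ht
    rw [interior_Ici] at ht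
    exact (hg.deriv₁ t ht).differentiableAt.differentiableWithinAt
  · intro t ht
    rw [interior_Ici] at ht
    rw [(hg.deriv₁ t ht).deriv]
    exact hg.nonneg₂ t ht

lemma slope_bounds {a b : ℝ} (ha : 0 ≤ a) (hab : a ≤ b) :
    g₁ a * (b - a) ≤ g b - g a := by
  rcases hab.eq_or_lt with rfl | hlt
  · simp
  obtain ⟨c, hc, hceq⟩ := exists_hasDerivAt_eq_slope g g₁ hlt
    (hg.cont.mono fun x hx => ha.trans hx.1) fun x hx => hg.deriv x (ha.trans_lt hx.1)
  have h1 : g₁ a ≤ g₁ c := hg.monotoneOn₁ ha (ha.trans hc.1.le) hc.1.le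
  have h2 : 0 < b - a := sub_pos.mpr hlt
  rw [eq_div_iff h2.ne'] at hceq
  rw [← hceq]
  exact mul_le_mul_of_nonneg_right h1 h2.le

lemma slope_zero_le {a b : ℝ} (ha : 0 ≤ a) (hab : a ≤ b) : g₁ 0 * (b - a) ≤ g b - g a :=
  (mul_le_mul_of_nonneg_right (hg.monotoneOn₁ (le_refl (0 : ℝ)) ha ha) (sub_nonneg.mpr hab)).trans
    (hg.slope_bounds ha hab)

lemma monotoneOn : MonotoneOn g (Ici 0) := by
  intro a ha b hb hab
  have h1 := hg.slope_bounds ha hab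
  have h2 := mul_nonneg (hg.pos₁ a ha).le (sub_nonneg.mpr hab)
  linarith

lemma hasDerivAt_exp {t : ℝ} (ht : 0 < t) :
    HasDerivAt (fun t => Real.exp (g t)) (g₁ t * Real.exp (g t)) t := by
  rw [mul_comm]
  exact (hg.deriv t ht).exp

lemma monotoneOn_exp_deriv : MonotoneOn (fun t => g₁ t * Real.exp (g t)) (Ici 0) := by
  intro a ha b hb hab
  exact mul_le_mul (hg.monotoneOn₁ ha hb hab) (Real.exp_le_exp.mpr (hg.monotoneOn ha hb hab))
    (Real.exp_pos _).le (hg.pos₁ b hb).le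

lemma exp_sub_le {a b : ℝ} (ha : 0 ≤ a) (hab : a ≤ b) :
    Real.exp (g b) - Real.exp (g a) ≤ g₁ b * Real.exp (g b) * (b - a) := by
  rcases hab.eq_or_lt with rfl | hlt
  · simp
  obtain ⟨c, hc, hceq⟩ := exists_hasDerivAt_eq_slope (fun t => Real.exp (g t))
    (fun t => g₁ t * Real.exp (g t)) hlt
    (Real.continuous_exp.comp_continuousOn (hg.cont.mono fun x hx => ha.trans hx.1))
    fun x hx => hg.hasDerivAt_exp (ha.trans_lt hx.1)
  have h1 := hg.monotoneOn_exp_deriv (ha.trans hc.1.le) (ha.trans hab) hc.2.le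
  have h2 : 0 < b - a := sub_pos.mpr hlt
  rw [eq_div_iff h2.ne'] at hceq
  rw [← hceq]
  exact mul_le_mul_of_nonneg_right h1 h2.le

lemma le_exp_sub {a b : ℝ} (ha : 0 ≤ a) (hab : a ≤ b) :
    g₁ a * Real.exp (g a) * (b - a) ≤ Real.exp (g b) - Real.exp (g a) := by
  have h1 := hg.slope_bounds ha hab
  have h2 := Real.add_one_le_exp (g b - g a)
  have h3 : Real.exp (g b) = Real.exp (g a) * Real.exp (g b - g a) := by
    rw [← Real.exp_add]; ring_nf
  have h4 := Real.exp_pos (g a)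
  rw [h3]
  nlinarith

/-- Converts an upper bound for f'(F) into one for F itself, which gives the a priori O(1/s) bound
on profiles. -/
lemma linear_le_exp_deriv {t : ℝ} (ht : 0 ≤ t) :
    g₁ 0 ^ 2 * Real.exp (g 0) * t ≤ g₁ t * Real.exp (g t) := by
  have h1 := hg.le_exp_sub le_rfl ht
  have h2 := hg.monotoneOn₁ (le_refl (0 : ℝ)) ht ht
  have h3 := Real.exp_pos (g 0)
  have h4 := hg.pos₁ 0 le_rfl
  calc g₁ 0 ^ 2 * Real.exp (g 0) * t = g₁ 0 * (g₁ 0 * Real.exp (g 0) * (t - 0)) := by ring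
    _ ≤ g₁ 0 * Real.exp (g t) := by gcongr; linarith
    _ ≤ _ := by gcongr

end IsConvexExponent

/-! ### The Hardy bound for the linearized potential -/

namespace IsProfile

variable {g g₁ g₂ : ℝ → ℝ} {ν : ℝ} {F F₁ : ℝ → ℝ} {S : ℝ}

lemma mono_right (h : IsProfile ν g F F₁ S) {T : ℝ} (hT : T ≤ S) : IsProfile ν g F F₁ T where
  pos s hs := h.pos s ⟨hs.1, hs.2.trans_le hT⟩
  deriv s hs := h.deriv s ⟨hs.1, hs.2.trans_le hT⟩
  deriv₁ s hs := h.deriv₁ s ⟨hs.1, hs.2.trans_le hT⟩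

lemma equation (_h : IsProfile ν g F F₁ S) {s : ℝ} (hs : s ∈ Ioo 0 S) :
    4 * s * (-(2 * ν * F₁ s + Real.exp (g (F s))) / (4 * s)) + 2 * ν * F₁ s
      = -Real.exp (g (F s)) := by
  have := hs.1.ne'
  field_simp
  ring

lemma deriv_nonpos (h : IsProfile ν g F F₁ S) (hν : 10 ≤ ν) : ∀ s ∈ Ioo 0 S, F₁ s ≤ 0 := by
  refine deriv_nonpos_of_radial_superharmonic (C := 0) hν h.deriv h.deriv₁ ?_ ?_
  · intro s hs
    rw [h.equation hs]
    linarith [Real.exp_pos (g (F s))]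
  · intro s hs
    simpa using (h.pos s hs).le

lemma antitoneOn (h : IsProfile ν g F F₁ S) (hν : 10 ≤ ν) : AntitoneOn F (Ioo 0 S) :=
  antitoneOn_Ioo_of_hasDerivAt h.deriv (h.deriv_nonpos hν)

lemma hasDerivAt_exp_neg (h : IsProfile ν g F F₁ S) (hg : IsConvexExponent g g₁ g₂) {s : ℝ}
    (hs : s ∈ Ioo 0 S) :
    HasDerivAt (fun s => Real.exp (-g (F s)))
      (-(g₁ (F s) * F₁ s * Real.exp (-g (F s)))) s := by
  have h1 := ((hg.deriv _ (h.pos s hs)).comp s (h.deriv s hs)).neg.exp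
  have h2 : -(g₁ (F s) * F₁ s * Real.exp (-g (F s)))
      = Real.exp (-g (F s)) * -(g₁ (F s) * F₁ s) := by ring
  exact h2 ▸ h1

/-- The function differentiated is 1/f'(F), the reciprocal of the linearized potential. -/
lemma hasDerivAt_inv_deriv (h : IsProfile ν g F F₁ S) (hg : IsConvexExponent g g₁ g₂) {s : ℝ}
    (hs : s ∈ Ioo 0 S) :
    HasDerivAt (fun s => Real.exp (-g (F s)) / g₁ (F s))
      (-(F₁ s) * Real.exp (-g (F s)) * (1 + g₂ (F s) / g₁ (F s) ^ 2)) s := by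
  have hne := (hg.pos₁ _ (h.pos s hs).le).ne'
  have h1 := (h.hasDerivAt_exp_neg hg hs).div
    ((hg.deriv₁ _ (h.pos s hs)).comp s (h.deriv s hs)) hne
  have h2 : -(F₁ s) * Real.exp (-g (F s)) * (1 + g₂ (F s) / g₁ (F s) ^ 2)
      = (-(g₁ (F s) * F₁ s * Real.exp (-g (F s))) * g₁ (F s)
        - Real.exp (-g (F s)) * (g₂ (F s) * F₁ s)) / g₁ (F s) ^ 2 := by
    field_simp
    ring
  exact h2 ▸ h1

/-- The energy-type lower bound for the slope of a profile. -/
lemma slope_lower_bound (h : IsProfile ν g F F₁ S) (hg : IsConvexExponent g g₁ g₂)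
    (hν : 10 ≤ ν) {s : ℝ} (hs : s ∈ Ioo 0 S) :
    s / ((ν - 2) / 4 + 2) ≤ 2 * s * -F₁ s * Real.exp (-g (F s))
      + (ν - 2) / 4 * (Real.exp (-g (F s)) / g₁ (F s)) := by
  set κ := (ν - 2) / 4 with hκ
  have hκ2 : 2 ≤ κ := by rw [hκ]; linarith
  have hν' : ν = 4 * κ + 2 := by rw [hκ]; ring
  -- The weight s^(κ/2) turns the derivative into a perfect square plus a nonnegative multiple of
  -- g₂. The term s/(κ+2) absorbs the constant 1/2 produced by the nonlinearity, as (κ/2+1)/(κ+2) =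
  -- 1/2.
  set Y : ℝ → ℝ := fun s => s ^ (κ / 2) * (2 * s * -F₁ s * Real.exp (-g (F s))
      + κ * (Real.exp (-g (F s)) / g₁ (F s)) - s / (κ + 2)) with hY
  have hmono : MonotoneOn Y (Ioo 0 S) := by
    refine monotoneOn_Ioo_of_hasDerivAt (fun s hs => (hasDerivAt_rpow_div hs.1 (κ / 2)).mul
      ((((((hasDerivAt_id s).const_mul 2).mul (h.deriv₁ s hs).neg).mul
        (h.hasDerivAt_exp_neg hg hs)).add ((h.hasDerivAt_inv_deriv hg hs).const_mul κ)).sub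
        ((hasDerivAt_id s).div_const (κ + 2)))) ?_
    intro s hs
    have hs0 := hs.1
    have hF := h.pos s hs
    have hG := hg.pos₁ _ hF.le
    have hG2 := hg.nonneg₂ _ hF
    have hb := h.deriv_nonpos hν s hs
    have he := Real.exp_pos (-g (F s))
    have hE : Real.exp (g (F s)) = (Real.exp (-g (F s)))⁻¹ := by rw [Real.exp_neg, inv_inv]
    simp only [Pi.mul_apply, Pi.neg_apply, id]
    rw [hE, hν']
    generalize Real.exp (-g (F s)) = e at *
    generalize g₁ (F s) = G at *
    generalize g₂ (F s) = G2 at *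
    generalize F₁ s = b at *
    have hpw : 0 < s ^ (κ / 2) := Real.rpow_pos_of_pos hs0 _
    generalize s ^ (κ / 2) = p at *
    have hk : κ + 2 ≠ 0 := by linarith
    have key : 0 ≤ p / s * (e / (2 * G) * (κ + 2 * s * b * G) ^ 2
        + κ * (G2 / G ^ 2) * s * -b * e) := by
      have : 0 ≤ -b := by linarith
      positivity
    refine key.trans_eq ?_
    field_simp
    ring
  -- Dropping the nonnegative terms of Y leaves a lower bound that vanishes at 0, so nothing need be
  -- known about F at the origin, where it may be singular.
  have hnonneg := hmono.nonneg_of_tendsto_lower (η := fun s => -(s ^ (κ / 2 + 1) / (κ + 2)))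
    (by simpa using ((tendsto_rpow_zero_nhdsGT (p := κ / 2 + 1) (by linarith)).div_const
      (κ + 2)).neg) ?_ s hs
  · have hpw : 0 < s ^ (κ / 2) := Real.rpow_pos_of_pos hs.1 _
    have := nonneg_of_mul_nonneg_right hnonneg hpw
    linarith
  · intro s hs
    have hs0 := hs.1
    have hpw : 0 < s ^ (κ / 2) := Real.rpow_pos_of_pos hs.1 _
    have hG := hg.pos₁ _ (h.pos s hs).le
    have hb : 0 ≤ -F₁ s := by linarith [h.deriv_nonpos hν s hs]
    have h1 : 0 ≤ 2 * s * -F₁ s * Real.exp (-g (F s)) + κ * (Real.exp (-g (F s)) / g₁ (F s)) := by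
      positivity
    have h2 : s ^ (κ / 2 + 1) = s ^ (κ / 2) * s := Real.rpow_add_one hs0.ne' _
    simp only [hY, h2]
    have := mul_nonneg hpw.le h1
    have h3 : -(s ^ (κ / 2) * s / (κ + 2)) = s ^ (κ / 2) * -(s / (κ + 2)) := by ring
    rw [h3]
    gcongr
    linarith

/-- Along any profile the linearized potential lies below the Hardy potential. -/
lemma potential_le (h : IsProfile ν g F F₁ S) (hg : IsConvexExponent g g₁ g₂) (hν : 10 ≤ ν)
    {s : ℝ} (hs : s ∈ Ioo 0 S) :
    s * (g₁ (F s) * Real.exp (g (F s))) ≤ (ν - 2) ^ 2 / 4 := by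
  set κ := (ν - 2) / 4 with hκ
  have hκ2 : 2 ≤ κ := by rw [hκ]; linarith
  -- The derivative of s^(κ/2)/f'(F) contains s^(κ/2)/(2s) times the quantity bounded in
  -- `slope_lower_bound`, hence is at least s^(κ/2)/(2(κ+2)), the derivative of s^(κ/2+1)/(κ+2)².
  have hmono : MonotoneOn (fun s => s ^ (κ / 2) * (Real.exp (-g (F s)) / g₁ (F s))
      - s ^ (κ / 2 + 1) / (κ + 2) ^ 2) (Ioo 0 S) := by
    refine monotoneOn_Ioo_of_hasDerivAt (fun s hs => ((hasDerivAt_rpow_div hs.1 (κ / 2)).mul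
      (h.hasDerivAt_inv_deriv hg hs)).sub
        ((hasDerivAt_rpow_div hs.1 (κ / 2 + 1)).div_const _)) ?_
    intro s hs
    have hs0 := hs.1
    have hF := h.pos s hs
    have hG := hg.pos₁ _ hF.le
    have hG2 := hg.nonneg₂ _ hF
    have hb := h.deriv_nonpos hν s hs
    have he := Real.exp_pos (-g (F s))
    have hlow := h.slope_lower_bound hg hν hs
    rw [← hκ] at hlow
    have h2 : s ^ (κ / 2 + 1) = s ^ (κ / 2) * s := Real.rpow_add_one hs0.ne' _
    rw [h2]
    generalize Real.exp (-g (F s)) = e at *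
    generalize g₁ (F s) = G at *
    generalize g₂ (F s) = G2 at *
    generalize F₁ s = b at *
    have hpw : 0 < s ^ (κ / 2) := Real.rpow_pos_of_pos hs0 _
    generalize s ^ (κ / 2) = p at *
    have key : 0 ≤ p / (2 * s) * (2 * s * -b * e + κ * (e / G) - s / (κ + 2))
        + p * (-b) * e * (G2 / G ^ 2) := by
      have h1 : 0 ≤ -b := by linarith
      have h2 : 0 ≤ 2 * s * -b * e + κ * (e / G) - s / (κ + 2) := by linarith
      positivity
    refine key.trans_eq ?_
    have hk : κ + 2 ≠ 0 := by linarith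
    field_simp
    ring
  have hnonneg := hmono.nonneg_of_tendsto_lower (η := fun s => -(s ^ (κ / 2 + 1) / (κ + 2) ^ 2))
    (by simpa using ((tendsto_rpow_zero_nhdsGT (p := κ / 2 + 1) (by linarith)).div_const
      ((κ + 2) ^ 2)).neg) ?_ s hs
  · have hs0 := hs.1
    have hpw : 0 < s ^ (κ / 2) := Real.rpow_pos_of_pos hs.1 _
    have h2 : s ^ (κ / 2 + 1) = s ^ (κ / 2) * s := Real.rpow_add_one hs0.ne' _
    rw [h2, mul_div_assoc, ← mul_sub] at hnonneg
    have h3 := nonneg_of_mul_nonneg_right hnonneg hpw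
    have hG := hg.pos₁ _ (h.pos s hs).le
    have he := Real.exp_pos (g (F s))
    have hk : 0 < κ + 2 := by linarith
    rw [Real.exp_neg, sub_nonneg, div_le_div_iff₀ (by positivity) hG,
      inv_mul_eq_div, le_div_iff₀ he] at h3
    -- The right side is (2κ)², so the claim is κ ≥ 2, that is ν ≥ 10: this is where dimension ten
    -- is sharp.
    have h4 : (κ + 2) ^ 2 ≤ (ν - 2) ^ 2 / 4 := by
      have : ν - 2 = 4 * κ := by rw [hκ]; ring
      rw [this]
      nlinarith
    linarith
  · intro s hs
    have hs0 := hs.1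
    have hG := hg.pos₁ _ (h.pos s hs).le
    have : 0 ≤ s ^ (κ / 2) * (Real.exp (-g (F s)) / g₁ (F s)) := by positivity
    linarith

end IsProfile

/-! ### A priori bounds and comparison of profiles -/

namespace IsProfile

variable {g g₁ g₂ : ℝ → ℝ} {ν : ℝ} {F F₁ A A₁ B B₁ : ℝ → ℝ} {S : ℝ}

lemma le_const_div (h : IsProfile ν g F F₁ S) (hg : IsConvexExponent g g₁ g₂) (hν : 10 ≤ ν)
    {s : ℝ} (hs : s ∈ Ioo 0 S) :
    F s ≤ (ν - 2) ^ 2 / 4 / (g₁ 0 ^ 2 * Real.exp (g 0)) / s := by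
  have hs0 := hs.1
  have h1 := h.potential_le hg hν hs
  have h2 := hg.linear_le_exp_deriv (h.pos s hs).le
  have h3 : 0 < g₁ 0 ^ 2 * Real.exp (g 0) := mul_pos (pow_pos (hg.pos₁ 0 le_rfl) 2)
    (Real.exp_pos _)
  rw [le_div_iff₀ hs0, le_div_iff₀ h3]
  nlinarith

lemma mul_exp_le (h : IsProfile ν g F F₁ S) (hg : IsConvexExponent g g₁ g₂) (hν : 10 ≤ ν)
    {s : ℝ} (hs : s ∈ Ioo 0 S) : s * Real.exp (g (F s)) ≤ (ν - 2) ^ 2 / 4 / g₁ 0 := by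
  have hs0 := hs.1
  have h1 := h.potential_le hg hν hs
  have hF := (h.pos s hs).le
  have h2 := hg.monotoneOn₁ (le_refl (0 : ℝ)) hF hF
  rw [le_div_iff₀ (hg.pos₁ 0 le_rfl)]
  have h3 : 0 < s * Real.exp (g (F s)) := by positivity
  nlinarith

/-- Since f(F) ≥ f(0), the function F + f(0)s/(2ν) is still radially superharmonic, hence
nonincreasing. -/
lemma deriv_le (h : IsProfile ν g F F₁ S) (hg : IsConvexExponent g g₁ g₂) (hν : 10 ≤ ν) :
    ∀ s ∈ Ioo 0 S, F₁ s ≤ -(Real.exp (g 0) / (2 * ν)) := by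
  intro s hs
  have key := deriv_nonpos_of_radial_superharmonic (C := 0) hν
    (Ψ := fun s => F s + Real.exp (g 0) / (2 * ν) * s)
    (fun s hs => (h.deriv s hs).add ((hasDerivAt_id s).const_mul _))
    (fun s hs => (h.deriv₁ s hs).add_const _) ?_ ?_ s hs
  · linarith
  · intro s hs
    have h1 := h.equation hs
    have hF := (h.pos s hs).le
    have h2 := Real.exp_le_exp.mpr (hg.monotoneOn (le_refl (0 : ℝ)) hF hF)
    have h3 : 2 * ν * (Real.exp (g 0) / (2 * ν)) = Real.exp (g 0) := by
      field_simp
    rw [mul_one, mul_add, h3]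
    linarith
  · intro s hs
    have h1 := (h.pos s hs).le
    have h2 : 0 < Real.exp (g 0) / (2 * ν) * s := by
      have := hs.1
      positivity
    simpa using by linarith

/-- The radial operator maps log s to (2ν-4)/s, so -F - c log s with c = K/(2ν-4) is superharmonic;
the O(1/s) bound on F supplies the growth condition at the origin. -/
lemma neg_deriv_le (h : IsProfile ν g F F₁ S) (hg : IsConvexExponent g g₁ g₂) (hν : 10 ≤ ν)
    {K : ℝ} (hK : ∀ s ∈ Ioo 0 S, s * Real.exp (g (F s)) ≤ K) :
    ∀ s ∈ Ioo 0 S, s * -F₁ s ≤ K / (2 * ν - 4) := by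
  intro s hs
  set c := K / (2 * ν - 4) with hc
  have hc0 : 0 ≤ c := div_nonneg
    ((mul_pos hs.1 (Real.exp_pos _)).le.trans (hK s hs)) (by linarith)
  have hcK : c * (2 * ν - 4) = K := div_mul_cancel₀ _ (by linarith)
  set M := (ν - 2) ^ 2 / 4 / (g₁ 0 ^ 2 * Real.exp (g 0)) with hM
  have key := deriv_nonpos_of_radial_superharmonic (C := M + c * |Real.log S| * S) hν
    (Ψ := fun s => -F s - c * Real.log s) (Ψ₁ := fun s => -F₁ s - c * s⁻¹)
    (fun s hs => (h.deriv s hs).neg.sub ((Real.hasDerivAt_log hs.1.ne').const_mul c))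
    (fun s hs => (h.deriv₁ s hs).neg.sub ((hasDerivAt_inv hs.1.ne').const_mul c)) ?_ ?_ s hs
  · have h1 := mul_nonpos_of_nonneg_of_nonpos hs.1.le key
    have h2 : s * (-F₁ s - c * s⁻¹) = s * -F₁ s - c := by
      have := hs.1.ne'
      field_simp
    linarith
  · intro s hs
    have hs0 := hs.1
    have h1 := h.equation hs
    have h2 := hK s hs
    have h3 : 4 * s * (-(-(2 * ν * F₁ s + Real.exp (g (F s))) / (4 * s)) - c * -(s ^ 2)⁻¹)
        + 2 * ν * (-F₁ s - c * s⁻¹) = (s * Real.exp (g (F s)) - K) / s := by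
      rw [← hcK]
      field_simp
      ring
    rw [h3]
    exact div_nonpos_of_nonpos_of_nonneg (by linarith) hs0.le
  · intro s hs
    have hs0 := hs.1
    have h1 := h.le_const_div hg hν hs
    rw [← hM] at h1
    have h2 : Real.log s ≤ |Real.log S| :=
      (Real.log_le_log hs0 hs.2.le).trans (le_abs_self _)
    have h3 : c * Real.log s ≤ c * |Real.log S| := mul_le_mul_of_nonneg_left h2 hc0
    have h4 : c * |Real.log S| ≤ c * |Real.log S| * S / s := by
      rw [le_div_iff₀ hs0]
      exact mul_le_mul_of_nonneg_left hs.2.le (by positivity)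
    have h5 : -(M + c * |Real.log S| * S) / s = -(M / s) - c * |Real.log S| * S / s := by ring
    rw [h5]
    linarith

/-- As f is increasing, A - B is radially superharmonic wherever A ≥ B, and it is bounded below by
0. -/
lemma deriv_le_deriv (hA : IsProfile ν g A A₁ S) (hB : IsProfile ν g B B₁ S)
    (hg : IsConvexExponent g g₁ g₂) (hν : 10 ≤ ν) (hle : ∀ s ∈ Ioo 0 S, B s ≤ A s) :
    ∀ s ∈ Ioo 0 S, A₁ s ≤ B₁ s := by
  intro s hs
  have key := deriv_nonpos_of_radial_superharmonic (C := 0) hν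
    (Ψ := fun s => A s - B s) (fun s hs => (hA.deriv s hs).sub (hB.deriv s hs))
    (fun s hs => (hA.deriv₁ s hs).sub (hB.deriv₁ s hs)) ?_ ?_ s hs
  · linarith
  · intro s hs
    have h1 := hA.equation hs
    have h2 := hB.equation hs
    have h3 := Real.exp_le_exp.mpr
      (hg.monotoneOn (hB.pos s hs).le (hA.pos s hs).le (hle s hs))
    rw [mul_sub, mul_sub]
    linarith
  · intro s hs
    simpa using hle s hs

lemma sub_antitoneOn (hA : IsProfile ν g A A₁ S) (hB : IsProfile ν g B B₁ S)
    (hg : IsConvexExponent g g₁ g₂) (hν : 10 ≤ ν) (hle : ∀ s ∈ Ioo 0 S, B s ≤ A s) :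
    AntitoneOn (fun s => A s - B s) (Ioo 0 S) :=
  antitoneOn_Ioo_of_hasDerivAt (fun s hs => (hA.deriv s hs).sub (hB.deriv s hs))
    fun s hs => sub_nonpos.mpr (hA.deriv_le_deriv hB hg hν hle s hs)

/-- By convexity f(A) - f(B) ≤ f'(A)(A - B), and f'(A) lies below the Hardy potential, so A - B is a
Hardy subsolution. -/
lemma monotoneOn_rpow_mul_sub (hA : IsProfile ν g A A₁ S) (hB : IsProfile ν g B B₁ S)
    (hg : IsConvexExponent g g₁ g₂) (hν : 10 ≤ ν) (hle : ∀ s ∈ Ioo 0 S, B s ≤ A s) :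
    MonotoneOn (fun s => s ^ ((ν - 2) / 4) * (A s - B s)) (Ioo 0 S) := by
  refine monotoneOn_rpow_mul_of_hardy_subsolution hν (d := fun s => A s - B s)
    (C := (ν - 2) ^ 2 / 4 / (g₁ 0 ^ 2 * Real.exp (g 0)))
    (fun s hs => (hA.deriv s hs).sub (hB.deriv s hs))
    (fun s hs => (hA.deriv₁ s hs).sub (hB.deriv₁ s hs)) ?_ ?_
  · intro s hs
    have hs0 := hs.1
    have h1 := hA.equation hs
    have h2 := hB.equation hs
    have h3 := hg.exp_sub_le (hB.pos s hs).le (hle s hs)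
    have h4 := hA.potential_le hg hν hs
    have h5 : g₁ (A s) * Real.exp (g (A s)) ≤ (ν - 2) ^ 2 / 4 / s := by
      rw [le_div_iff₀ hs0]; linarith
    have h6 := mul_le_mul_of_nonneg_right h5 (sub_nonneg.mpr (hle s hs))
    rw [mul_sub, mul_sub]
    linarith
  · intro s hs
    have := hA.le_const_div hg hν hs
    linarith [hB.pos s hs]

/-- The weighted difference is nondecreasing and already positive at S/2, so strict order survives
in the limit at S. -/
lemma lt_of_tendsto_left (hA : IsProfile ν g A A₁ S) (hB : IsProfile ν g B B₁ S)
    (hg : IsConvexExponent g g₁ g₂) (hν : 10 ≤ ν) (hS : 0 < S)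
    (hlt : ∀ s ∈ Ioo 0 S, B s < A s) {a b : ℝ} (ha : Tendsto A (𝓝[<] S) (𝓝 a))
    (hb : Tendsto B (𝓝[<] S) (𝓝 b)) : b < a := by
  have hm := hA.monotoneOn_rpow_mul_sub hB hg hν (fun x hx => (hlt x hx).le)
  have hc2 : S / 2 ∈ Ioo 0 S := ⟨by linarith, by linarith⟩
  have hpos : 0 < (S / 2) ^ ((ν - 2) / 4) * (A (S / 2) - B (S / 2)) :=
    mul_pos (Real.rpow_pos_of_pos hc2.1 _) (sub_pos.mpr (hlt _ hc2))
  have hlim : Tendsto (fun s => s ^ ((ν - 2) / 4) * (A s - B s)) (𝓝[<] S)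
      (𝓝 (S ^ ((ν - 2) / 4) * (a - b))) :=
    ((Real.continuousAt_rpow_const S _ (Or.inl hS.ne')).tendsto.mono_left
      nhdsWithin_le_nhds).mul (ha.sub hb)
  have hge := ge_of_tendsto hlim
    (b := (S / 2) ^ ((ν - 2) / 4) * (A (S / 2) - B (S / 2))) (by
      filter_upwards [Ioo_mem_nhdsLT hc2.2] with x hx
      exact hm hc2 ⟨hc2.1.trans hx.1, hx.2⟩ hx.1.le)
  exact sub_pos.mp (pos_of_mul_pos_right (hpos.trans_le hge) (Real.rpow_pos_of_pos hS _).le)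

/-- Two profiles that are ordered near the origin are ordered everywhere. -/
lemma lt_of_eventually_lt (hA : IsProfile ν g A A₁ S) (hB : IsProfile ν g B B₁ S)
    (hg : IsConvexExponent g g₁ g₂) (hν : 10 ≤ ν) (hev : ∀ᶠ s in 𝓝[>] 0, B s < A s) :
    ∀ s ∈ Ioo 0 S, B s < A s := by
  intro s hs
  by_contra! hcon
  obtain ⟨r, hr0, hr⟩ := mem_nhdsGT_iff_exists_Ioo_subset.mp hev
  simp only [mem_Ioi] at hr0
  set Z := {x ∈ Ioo 0 S | A x ≤ B x} with hZ
  have hne : Z.Nonempty := ⟨s, hs, hcon⟩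
  have hlb : ∀ x ∈ Z, r ≤ x := by
    intro x hx
    by_contra! hxr
    exact absurd (hr ⟨hx.1.1, hxr⟩) (not_lt.mpr hx.2)
  have hbdd : BddBelow Z := ⟨r, hlb⟩
  -- The first contact point: the order is strict on (0, c), so `lt_of_tendsto_left` forbids contact
  -- at c.
  set c := sInf Z with hc
  have hrc : r ≤ c := le_csInf hne hlb
  have hcs : c ≤ s := csInf_le hbdd ⟨hs, hcon⟩
  have hcS : c ∈ Ioo 0 S := ⟨hr0.trans_le hrc, hcs.trans_lt hs.2⟩
  have hlt : ∀ x ∈ Ioo 0 c, B x < A x := by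
    intro x hx
    by_contra! hx'
    exact absurd (csInf_le hbdd (a := x) ⟨⟨hx.1, hx.2.trans hcS.2⟩, hx'⟩) (not_le.mpr hx.2)
  have hcA := (hA.deriv c hcS).continuousAt
  have hcB := (hB.deriv c hcS).continuousAt
  have hcle : A c ≤ B c := by
    have hcl : c ∈ closure Z := csInf_mem_closure hne hbdd
    have hfr := mem_closure_iff_frequently.mp hcl
    by_contra! hcon'
    have := hcB.eventually_lt hcA hcon'
    obtain ⟨x, hx1, hx2⟩ := (hfr.and_eventually this).exists
    exact absurd hx1.2 (not_le.mpr hx2)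
  exact absurd ((hA.mono_right hcS.2.le).lt_of_tendsto_left (hB.mono_right hcS.2.le) hg hν hcS.1
    hlt (hcA.tendsto.mono_left nhdsWithin_le_nhds) (hcB.tendsto.mono_left nhdsWithin_le_nhds))
    (not_lt.mpr hcle)

end IsProfile

/-! ### The singular initial value problem for regular profiles -/

section RadialInitialValue

open scoped BoundedContinuousFunction

/-- Integration gains a factor 1/L in the norm weighted by exp(L|s|); this yields a global
contraction. -/
lemma abs_integral_le_of_le_exp_abs {q : ℝ → ℝ} (hq : Continuous q) {M L : ℝ} (hM : 0 ≤ M)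
    (hL : 0 < L) (h : ∀ x, |q x| ≤ M * Real.exp (L * |x|)) (s : ℝ) :
    |∫ x in (0 : ℝ)..s, q x| ≤ M / L * Real.exp (L * |s|) := by
  have main : ∀ q : ℝ → ℝ, Continuous q → (∀ x, |q x| ≤ M * Real.exp (L * |x|)) → ∀ s, 0 ≤ s →
      |∫ x in (0 : ℝ)..s, q x| ≤ M / L * Real.exp (L * |s|) := by
    intro q hq h s hs
    have h2 : ∀ x ∈ uIcc 0 s, HasDerivAt (fun x => M / L * Real.exp (L * x))
        (M * Real.exp (L * x)) x := by
      intro x _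
      have := (((hasDerivAt_id x).const_mul L).exp).const_mul (M / L)
      have h3 : M * Real.exp (L * x) = M / L * (Real.exp (L * x) * (L * 1)) := by field_simp
      exact h3 ▸ this
    have h3 := intervalIntegral.integral_eq_sub_of_hasDerivAt h2
      (by apply Continuous.intervalIntegrable; fun_prop)
    have h4 : |∫ x in (0 : ℝ)..s, q x| ≤ ∫ x in (0 : ℝ)..s, M * Real.exp (L * x) := by
      refine intervalIntegral.abs_integral_le_integral_abs hs |>.trans ?_
      refine intervalIntegral.integral_mono_on hs (hq.abs.intervalIntegrable _ _)
        (by apply Continuous.intervalIntegrable; fun_prop) ?_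
      intro x hx
      have := h x
      rwa [abs_of_nonneg hx.1] at this
    rw [h3] at h4
    rw [abs_of_nonneg hs]
    have : 0 ≤ M / L * Real.exp (L * 0) := by positivity
    linarith
  rcases le_total 0 s with hs | hs
  · exact main q hq h s hs
  · have h1 := main (fun x => q (-x)) (by fun_prop) (fun x => by simpa using h (-x)) (-s)
      (by linarith)
    rw [intervalIntegral.integral_comp_neg, intervalIntegral.integral_symm] at h1
    simpa using h1

lemma abs_integral_unit_le {q : ℝ → ℝ} {M : ℝ} (h : ∀ t ∈ Icc (0 : ℝ) 1, |q t| ≤ M) :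
    |∫ t in (0 : ℝ)..1, q t| ≤ M := by
  have := intervalIntegral.norm_integral_le_of_norm_le_const (f := q) (a := 0) (b := 1) (C := M)
    (by
      intro x hx
      rw [uIoc_of_le zero_le_one] at hx
      exact h x ⟨hx.1.le, hx.2⟩)
  simpa using this

/-- Integrating (s^n F')' = -s^(n-1) f(F)/4, with n half the dimension, and substituting σ = s t²
removes the singularity at 0: F'(s) = -½ ∫₀¹ t^N f(F(s t²)) dt. Here `N` is the dimension minus one.
The unknown is sought as α + exp(L|s|) G with G bounded and continuous. -/
lemma exists_radial_fixedPoint (N : ℕ) {f : ℝ → ℝ} (hf : Continuous f) {K : ℝ} (hK : 0 ≤ K)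
    (hLip : ∀ x y, |f x - f y| ≤ K * |x - y|) (α : ℝ) :
    ∃ F : ℝ → ℝ, Continuous F ∧ ∀ s, F s = α - (∫ σ in (0 : ℝ)..s,
      ∫ t in (0 : ℝ)..1, t ^ N * f (F (σ * t ^ 2))) / 2 := by
  set L := K + 1 with hL
  have hL0 : 0 < L := by linarith
  let w : ℝ → ℝ := fun s => Real.exp (L * |s|)
  have hw0 : ∀ s, 0 < w s := fun s => Real.exp_pos _
  have hwc : Continuous w := by fun_prop
  have hwmono : ∀ σ t : ℝ, t ∈ Icc (0 : ℝ) 1 → w (σ * t ^ 2) ≤ w σ := by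
    intro σ t ht
    refine Real.exp_le_exp.mpr (mul_le_mul_of_nonneg_left ?_ hL0.le)
    rw [abs_mul, abs_of_nonneg (sq_nonneg t)]
    exact mul_le_of_le_one_right (abs_nonneg _) (pow_le_one₀ ht.1 ht.2)
  let Φ : (ℝ →ᵇ ℝ) → ℝ → ℝ := fun G s => α + w s * G s
  have hΦc : ∀ G, Continuous (Φ G) := fun G => continuous_const.add (hwc.mul G.continuous)
  let Q : (ℝ →ᵇ ℝ) → ℝ → ℝ := fun G σ => ∫ t in (0 : ℝ)..1, t ^ N * f (Φ G (σ * t ^ 2))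
  have hQi : ∀ G σ, Continuous fun t : ℝ => t ^ N * f (Φ G (σ * t ^ 2)) := by
    intro G σ
    have := hΦc G
    fun_prop
  have hQc : ∀ G, Continuous (Q G) := by
    intro G
    apply intervalIntegral.continuous_parametric_intervalIntegral_of_continuous'
    have := hΦc G
    simp only [Function.uncurry_def]
    fun_prop
  have hQdiff : ∀ G H : ℝ →ᵇ ℝ, ∀ σ, |Q G σ - Q H σ| ≤ K * dist G H * w σ := by
    intro G H σ
    rw [← intervalIntegral.integral_sub ((hQi G σ).intervalIntegrable _ _)
      ((hQi H σ).intervalIntegrable _ _)]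
    refine abs_integral_unit_le fun t ht => ?_
    rw [← mul_sub, abs_mul, abs_of_nonneg (pow_nonneg ht.1 N)]
    have h1 : |Φ G (σ * t ^ 2) - Φ H (σ * t ^ 2)| ≤ w σ * dist G H := by
      have : Φ G (σ * t ^ 2) - Φ H (σ * t ^ 2)
          = w (σ * t ^ 2) * (G (σ * t ^ 2) - H (σ * t ^ 2)) := by simp only [Φ]; ring
      have h0 : |G (σ * t ^ 2) - H (σ * t ^ 2)| ≤ dist G H :=
        BoundedContinuousFunction.dist_coe_le_dist (f := G) (g := H) (σ * t ^ 2)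
      rw [this, abs_mul, abs_of_pos (hw0 _)]
      exact mul_le_mul (hwmono σ t ht) h0
        (abs_nonneg _) (hw0 σ).le
    calc t ^ N * |f (Φ G (σ * t ^ 2)) - f (Φ H (σ * t ^ 2))|
        ≤ 1 * (K * (w σ * dist G H)) := mul_le_mul (pow_le_one₀ ht.1 ht.2)
          ((hLip _ _).trans (mul_le_mul_of_nonneg_left h1 hK)) (abs_nonneg _) zero_le_one
      _ = _ := by ring
  have hQ0 : ∀ σ, |Q 0 σ| ≤ |f α| * w σ := by
    intro σ
    refine abs_integral_unit_le fun t ht => ?_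
    have h1 : Φ 0 (σ * t ^ 2) = α := by simp [Φ]
    rw [h1, abs_mul, abs_of_nonneg (pow_nonneg ht.1 N)]
    have h2 : 1 ≤ w σ := Real.one_le_exp (by positivity)
    have h3 : t ^ N ≤ 1 := pow_le_one₀ ht.1 ht.2
    nlinarith [abs_nonneg (f α), pow_nonneg ht.1 N]
  let T₀ : (ℝ →ᵇ ℝ) → ℝ → ℝ := fun G s => (w s)⁻¹ * (-(∫ σ in (0 : ℝ)..s, Q G σ) / 2)
  have hT₀c : ∀ G, Continuous (T₀ G) := by
    intro G
    have h1 : Continuous fun s => ∫ σ in (0 : ℝ)..s, Q G σ :=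
      intervalIntegral.continuous_primitive (fun a b => (hQc G).intervalIntegrable a b) 0
    exact (hwc.inv₀ fun s => (hw0 s).ne').mul (h1.neg.div_const 2)
  have hT₀diff : ∀ G H : ℝ →ᵇ ℝ, ∀ s, |T₀ G s - T₀ H s| ≤ 1 / 2 * dist G H := by
    intro G H s
    have h1 : T₀ G s - T₀ H s = (w s)⁻¹ * (-(∫ σ in (0 : ℝ)..s, (Q G σ - Q H σ)) / 2) := by
      rw [intervalIntegral.integral_sub ((hQc G).intervalIntegrable _ _)
        ((hQc H).intervalIntegrable _ _)]
      simp only [T₀]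
      ring
    have h2 := abs_integral_le_of_le_exp_abs ((hQc G).sub (hQc H))
      (M := K * dist G H) (by positivity) hL0 (hQdiff G H) s
    rw [h1, abs_mul, abs_div, abs_neg, abs_inv, abs_of_pos (hw0 s), abs_two,
      inv_mul_le_iff₀ (hw0 s)]
    have h3 : K * dist G H / L ≤ dist G H := by
      rw [div_le_iff₀ hL0, hL]
      nlinarith [dist_nonneg (x := G) (y := H)]
    have h4 := mul_le_mul_of_nonneg_right h3 (hw0 s).le
    have h5 : |∫ σ in (0 : ℝ)..s, (Q G σ - Q H σ)| ≤ dist G H * w s := h2.trans h4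
    linarith
  have hT₀0 : ∀ s, |T₀ 0 s| ≤ |f α| / L / 2 := by
    intro s
    have h2 := abs_integral_le_of_le_exp_abs (hQc 0) (M := |f α|) (abs_nonneg _) hL0 hQ0 s
    simp only [T₀]
    rw [abs_mul, abs_div, abs_neg, abs_inv, abs_of_pos (hw0 s), abs_two,
      inv_mul_le_iff₀ (hw0 s)]
    have h5 : |∫ σ in (0 : ℝ)..s, Q 0 σ| ≤ |f α| / L * w s := h2
    linarith
  let T : (ℝ →ᵇ ℝ) → (ℝ →ᵇ ℝ) := fun G =>
    BoundedContinuousFunction.ofNormedAddCommGroup (T₀ G) (hT₀c G)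
      (1 / 2 * dist G 0 + |f α| / L / 2) (fun s => by
        have h1 := hT₀diff G 0 s
        have h2 := hT₀0 s
        have h3 : |T₀ G s| ≤ |T₀ G s - T₀ 0 s| + |T₀ 0 s| := by
          simpa using abs_add_le (T₀ G s - T₀ 0 s) (T₀ 0 s)
        rw [Real.norm_eq_abs]
        linarith)
  have hcontr : ContractingWith (1 / 2) T := by
    refine ⟨by norm_num, LipschitzWith.of_dist_le_mul fun G H => ?_⟩
    rw [BoundedContinuousFunction.dist_le (by positivity)]
    intro s
    have := hT₀diff G H s
    simpa [Real.dist_eq, T] using this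
  obtain ⟨G, hG⟩ : ∃ G, T G = G := ⟨_, hcontr.fixedPoint_isFixedPt⟩
  refine ⟨Φ G, hΦc G, fun s => ?_⟩
  have h1 : T₀ G s = G s := DFunLike.congr_fun hG s
  have h2 : Φ G s = α + w s * T₀ G s := by rw [h1]
  rw [h2]
  simp only [T₀]
  rw [mul_inv_cancel_left₀ (hw0 s).ne']
  ring

/-- The radial initial value problem `4 s F'' + 2 N F' + f(F) = 0`, `F(0) = α`, with a globally
Lipschitz `C¹` nonlinearity, has a global `C²` solution. -/
lemma exists_radial_solution (N : ℕ) (hN : 1 ≤ N) {f f' : ℝ → ℝ}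
    (hf : ∀ x, HasDerivAt f (f' x) x) (hf' : Continuous f') {K : ℝ} (hK : 0 ≤ K)
    (hLip : ∀ x y, |f x - f y| ≤ K * |x - y|) (α : ℝ) :
    ∃ F F₁ F₂ : ℝ → ℝ, F 0 = α ∧ (∀ s, HasDerivAt F (F₁ s) s) ∧
      (∀ s, HasDerivAt F₁ (F₂ s) s) ∧ Continuous F₂ ∧
      ∀ s, 4 * s * F₂ s + 2 * N * F₁ s + f (F s) = 0 := by
  obtain ⟨M, rfl⟩ : ∃ M, N = M + 1 := ⟨N - 1, by omega⟩
  have hfc : Continuous f := continuous_iff_continuousAt.mpr fun x => (hf x).continuousAt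
  obtain ⟨F, hFc, hF⟩ := exists_radial_fixedPoint M hfc hK hLip α
  set Q : ℝ → ℝ := fun σ => ∫ t in (0 : ℝ)..1, t ^ M * f (F (σ * t ^ 2)) with hQ
  have hQc : Continuous Q := by
    apply intervalIntegral.continuous_parametric_intervalIntegral_of_continuous'
    simp only [Function.uncurry_def]
    fun_prop
  have hF1 : ∀ s, HasDerivAt F (-(Q s) / 2) s := by
    intro s
    have h1 : HasDerivAt (fun s => α - (∫ σ in (0 : ℝ)..s, Q σ) / 2) (-(Q s / 2)) s :=
      (((hQc.integral_hasStrictDerivAt 0 s).hasDerivAt.div_const 2).const_sub α)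
    rw [neg_div]
    exact h1.congr_of_eventuallyEq (Eventually.of_forall hF)
  set p : ℝ → ℝ := fun x => f' (F x) * (-(Q x) / 2) with hp
  have hpc : Continuous p := by fun_prop
  have hφ : ∀ x, HasDerivAt (fun x => f (F x)) (p x) x := fun x => (hf _).comp x (hF1 x)
  set Q' : ℝ → ℝ := fun σ => ∫ t in (0 : ℝ)..1, t ^ M * (p (σ * t ^ 2) * t ^ 2) with hQ'
  have hQ'c : Continuous Q' := by
    apply intervalIntegral.continuous_parametric_intervalIntegral_of_continuous'
    simp only [Function.uncurry_def]
    fun_prop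
  have hQd : ∀ s, HasDerivAt Q (Q' s) s := by
    -- Differentiation under the integral sign; the bound is uniform for σ within distance 1 of s
    -- because t² ≤ 1 keeps σt² in the ball of radius |s| + 1.
    intro s
    obtain ⟨B, hB⟩ := (isCompact_closedBall (0 : ℝ) (|s| + 1)).exists_bound_of_continuousOn
      hpc.continuousOn
    have hB0 : 0 ≤ B := (norm_nonneg _).trans (hB 0 (by simp; positivity))
    refine (intervalIntegral.hasDerivAt_integral_of_dominated_loc_of_deriv_le
      (F := fun σ t => t ^ M * f (F (σ * t ^ 2)))
      (F' := fun σ t => t ^ M * (p (σ * t ^ 2) * t ^ 2)) (bound := fun _ => B)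
      (μ := MeasureTheory.volume) (a := 0) (b := 1)
      (Metric.ball_mem_nhds s one_pos) ?_ ?_ ?_ ?_ ?_ ?_).2
    · exact Eventually.of_forall fun σ => Continuous.aestronglyMeasurable (by fun_prop)
    · exact Continuous.intervalIntegrable (by fun_prop) _ _
    · exact Continuous.aestronglyMeasurable (by fun_prop)
    · refine Eventually.of_forall fun t ht σ hσ => ?_
      rw [uIoc_of_le zero_le_one] at ht
      have ht1 : t ^ 2 ≤ 1 := pow_le_one₀ ht.1.le ht.2
      have hσ1 : |σ| ≤ |s| + 1 := by
        rw [Metric.mem_ball, Real.dist_eq] at hσ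
        have := abs_add_le (σ - s) s
        rw [sub_add_cancel] at this
        linarith
      have h1 : ‖p (σ * t ^ 2)‖ ≤ B := by
        apply hB
        rw [mem_closedBall_zero_iff, Real.norm_eq_abs, abs_mul, abs_of_nonneg (sq_nonneg t)]
        exact (mul_le_of_le_one_right (abs_nonneg _) ht1).trans hσ1
      rw [norm_mul, norm_mul, Real.norm_of_nonneg (pow_nonneg ht.1.le M),
        Real.norm_of_nonneg (sq_nonneg t)]
      have h2 : t ^ M ≤ 1 := pow_le_one₀ ht.1.le ht.2
      calc t ^ M * (‖p (σ * t ^ 2)‖ * t ^ 2) ≤ 1 * (B * 1) := by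
            gcongr
        _ = B := by ring
    · exact intervalIntegrable_const
    · refine Eventually.of_forall fun t ht σ hσ => ?_
      have h1 := (hφ (σ * t ^ 2)).comp σ ((hasDerivAt_id σ).mul_const (t ^ 2))
      rw [one_mul] at h1
      exact h1.const_mul _
  refine ⟨F, fun s => -(Q s) / 2, fun s => -(Q' s) / 2, ?_, hF1,
    fun s => (hQd s).neg.div_const 2, by fun_prop, ?_⟩
  · rw [hF 0]; simp
  · intro s
    -- Integrating this derivative over [0, 1] gives (M+1)Q + 2sQ' = f(F(s)), which is the
    -- differential equation.
    have h1 : ∀ t ∈ uIcc (0 : ℝ) 1, HasDerivAt (fun t => t ^ (M + 1) * f (F (s * t ^ 2)))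
        ((M + 1) * (t ^ M * f (F (s * t ^ 2)))
          + 2 * s * (t ^ M * (p (s * t ^ 2) * t ^ 2))) t := by
      intro t _
      have h2 : HasDerivAt (fun t : ℝ => s * t ^ 2) (s * (2 * t)) t := by
        simpa using (hasDerivAt_pow 2 t).const_mul s
      have h3 := (hasDerivAt_pow (M + 1) t).mul ((hφ (s * t ^ 2)).comp t h2)
      have h4 : ((M + 1 : ℕ) : ℝ) * t ^ (M + 1 - 1) * f (F (s * t ^ 2))
          + t ^ (M + 1) * (p (s * t ^ 2) * (s * (2 * t))) = (M + 1) * (t ^ M * f (F (s * t ^ 2)))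
          + 2 * s * (t ^ M * (p (s * t ^ 2) * t ^ 2)) := by
        push_cast
        ring
      exact h4 ▸ h3
    have h5 := intervalIntegral.integral_eq_sub_of_hasDerivAt h1
      (Continuous.intervalIntegrable (by fun_prop) _ _)
    rw [intervalIntegral.integral_add (Continuous.intervalIntegrable (by fun_prop) _ _)
      (Continuous.intervalIntegrable (by fun_prop) _ _),
      intervalIntegral.integral_const_mul, intervalIntegral.integral_const_mul] at h5
    have h6 : (M + 1) * Q s + 2 * s * Q' s = f (F s) := by simpa using h5
    push_cast
    linarith

end RadialInitialValue

/-! ### Existence of regular profiles -/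

namespace IsConvexExponent

variable {g g₁ g₂ : ℝ → ℝ} (hg : IsConvexExponent g g₁ g₂)
include hg

/-- The nonlinearity `exp ∘ g` on `[0, α]` extends to a globally Lipschitz `C¹` function. -/
lemma exists_lipschitz_extension {α : ℝ} (hα : 0 < α) :
    ∃ (f f' : ℝ → ℝ) (K : ℝ), (∀ x, HasDerivAt f (f' x) x) ∧ Continuous f' ∧ 0 ≤ K ∧
      (∀ x y, |f x - f y| ≤ K * |x - y|) ∧ (∀ t ∈ Icc 0 α, f t = Real.exp (g t)) ∧
      ∀ t, 0 ≤ t → Real.exp (g 0) ≤ f t := by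
  -- The derivative is clamped to its values on [0, α] and then integrated; clamping the function
  -- itself would lose C¹ regularity.
  let c : ℝ → ℝ := fun t => max 0 (min t α)
  have hc : Continuous c := by fun_prop
  have hc0 : ∀ t, 0 ≤ c t := fun t => le_max_left _ _
  have hcα : ∀ t, c t ≤ α := fun t => max_le hα.le (min_le_right _ _)
  have hcid : ∀ t ∈ Icc 0 α, c t = t := by
    intro t ht
    simp only [c]
    rw [min_eq_left ht.2, max_eq_right ht.1]
  let h : ℝ → ℝ := fun t => g₁ (c t) * Real.exp (g (c t))
  have hh : Continuous h := (hg.cont₁.comp_continuous hc hc0).mul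
    (Real.continuous_exp.comp (hg.cont.comp_continuous hc hc0))
  have hpos : ∀ t, 0 < h t := fun t => mul_pos (hg.pos₁ _ (hc0 t)) (Real.exp_pos _)
  have hle : ∀ t, h t ≤ g₁ α * Real.exp (g α) :=
    fun t => hg.monotoneOn_exp_deriv (hc0 t) hα.le (hcα t)
  have hder : ∀ x, HasDerivAt (fun t => Real.exp (g 0) + ∫ τ in (0 : ℝ)..t, h τ) (h x) x :=
    fun x => (hh.integral_hasStrictDerivAt 0 x).hasDerivAt.const_add _
  refine ⟨_, h, g₁ α * Real.exp (g α), hder, hh, ((hpos 0).trans_le (hle 0)).le, ?_, ?_, ?_⟩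
  · intro x y
    exact convex_univ.norm_image_sub_le_of_norm_hasDerivWithin_le
      (fun z _ => (hder z).hasDerivWithinAt)
      (fun z _ => by rw [Real.norm_of_nonneg (hpos z).le]; exact hle z) (mem_univ y) (mem_univ x)
  · intro t ht
    have h1 := intervalIntegral.integral_eq_sub_of_hasDerivAt_of_le ht.1
      (Real.continuous_exp.comp_continuousOn (hg.cont.mono fun x (hx : x ∈ Icc 0 t) => hx.1))
      (f' := h) (fun x hx => by
        have := hg.hasDerivAt_exp hx.1
        simp only [h]
        rw [hcid x ⟨hx.1.le, hx.2.le.trans ht.2⟩]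
        exact this) (hh.intervalIntegrable _ _)
    rw [h1]
    simp
  · intro t ht
    have := intervalIntegral.integral_nonneg (μ := MeasureTheory.volume) ht
      (fun u _ => (hpos u).le)
    linarith

/-- The regular profile with value `α` at the origin, up to its first zero. -/
lemma exists_regular_profile {N : ℕ} (hN : 10 ≤ N) {α : ℝ} (hα : 0 < α) :
    ∃ (S : ℝ) (F F₁ : ℝ → ℝ), 0 < S ∧ IsProfile N g F F₁ S ∧ ContDiff ℝ 2 F ∧ F 0 = α ∧ F S = 0 := by
  have hν : (10 : ℝ) ≤ N := by exact_mod_cast hN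
  obtain ⟨f, f', K, hf, hf', hK, hLip, hfg, hflow⟩ := hg.exists_lipschitz_extension hα
  obtain ⟨F, F₁, F₂, hF0, hF, hF₁, hF₂, heq⟩ :=
    exists_radial_solution N (by omega) hf hf' hK hLip α
  have hFc : Continuous F := continuous_iff_continuousAt.mpr fun x => (hF x).continuousAt
  set c := Real.exp (g 0) / (2 * N) with hc
  have hc0 : 0 < c := by positivity
  have hFc1 : ∀ s, HasDerivAt (fun s => F s + c * s) (F₁ s + c) s := by
    intro s
    have h1 := (hF s).add ((hasDerivAt_id s).const_mul c)
    rw [mul_one] at h1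
    exact h1
  -- While F is positive the extended nonlinearity is at least f(0), so F + cs is superharmonic and
  -- F ≤ α - cs. Hence F reaches zero, and it never exceeds α before that.
  have hslope : ∀ T, (∀ s ∈ Ioo 0 T, 0 < F s) → ∀ s ∈ Ioo 0 T, F₁ s + c ≤ 0 := by
    intro T hT
    refine deriv_nonpos_of_radial_superharmonic (C := 0) hν (Ψ := fun s => F s + c * s)
      (Ψ₂ := F₂) (fun s _ => hFc1 s)
      (fun s hs => (hF₁ s).add_const c) ?_ ?_
    · intro s hs
      have h1 := heq s
      have h2 := hflow _ (hT s hs).le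
      have h3 : 2 * (N : ℝ) * c = Real.exp (g 0) := by rw [hc]; field_simp
      rw [mul_add, h3]
      linarith
    · intro s hs
      have h1 := hT s hs
      have h2 := mul_pos hc0 hs.1
      simpa using by linarith
  have hdec : ∀ T, (∀ s ∈ Ioo 0 T, 0 < F s) → ∀ s ∈ Ioo 0 T, F s ≤ α - c * s := by
    intro T hT s hs
    have h1 : AntitoneOn (fun s => F s + c * s) (Ioo 0 T) :=
      antitoneOn_Ioo_of_hasDerivAt (F' := fun s => F₁ s + c)
        (fun s _ => hFc1 s) (hslope T hT)
    have h2 : Tendsto (fun s => F s + c * s) (𝓝[>] 0) (𝓝 α) := by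
      have : Continuous fun s => F s + c * s := by fun_prop
      have := this.tendsto 0
      simp only [hF0, mul_zero, add_zero] at this
      exact this.mono_left nhdsWithin_le_nhds
    have h3 := ge_of_tendsto h2 (b := F s + c * s) (by
      filter_upwards [Ioo_mem_nhdsGT hs.1] with x hx
      exact h1 ⟨hx.1, hx.2.trans hs.2⟩ hs hx.2.le)
    linarith
  set Z := {s | 0 ≤ s ∧ F s ≤ 0} with hZ
  have hZc : IsClosed Z := isClosed_Ici.inter (isClosed_le hFc continuous_const)
  have hZne : Z.Nonempty := by
    by_contra hempty
    have hpos : ∀ s, 0 ≤ s → 0 < F s := by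
      intro s hs
      by_contra! h
      exact hempty ⟨s, hs, h⟩
    have hx : 0 < α / c := by positivity
    have h1 := hdec (α / c + 1) (fun s hs => hpos s hs.1.le) (α / c) ⟨hx, by linarith⟩
    have h2 := hpos (α / c) hx.le
    rw [mul_div_cancel₀ _ hc0.ne'] at h1
    linarith
  have hZb : BddBelow Z := ⟨0, fun s hs => hs.1⟩
  set S := sInf Z with hS
  have hSZ : S ∈ Z := hZc.csInf_mem hZne hZb
  have hS0 : 0 < S := by
    refine lt_of_le_of_ne hSZ.1 fun h => ?_
    have := hSZ.2
    rw [← h, hF0] at this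
    linarith
  have hpos : ∀ s ∈ Ioo 0 S, 0 < F s := by
    intro s hs
    by_contra! h
    exact absurd (csInf_le hZb (a := s) ⟨hs.1.le, h⟩) (not_le.mpr hs.2)
  have hFS : F S = 0 := by
    refine le_antisymm hSZ.2 ?_
    refine ge_of_tendsto ((hFc.tendsto S).mono_left nhdsWithin_le_nhds : Tendsto F (𝓝[<] S) _) ?_
    filter_upwards [Ioo_mem_nhdsLT hS0] with x hx using (hpos x hx).le
  refine ⟨S, F, F₁, hS0, ⟨hpos, fun s _ => hF s, fun s hs => ?_⟩, ?_, hF0, hFS⟩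
  · have h1 := heq s
    have h2 := hdec S hpos s hs
    have h3 := mul_pos hc0 hs.1
    -- Here F(s) lies in [0, α], where the extension agrees with exp ∘ g.
    rw [hfg _ ⟨(hpos s hs).le, by linarith⟩] at h1
    have h4 : F₂ s = -(2 * N * F₁ s + Real.exp (g (F s))) / (4 * s) := by
      have := hs.1.ne'
      rw [eq_div_iff (by positivity)]
      linarith
    exact h4 ▸ hF₁ s
  · have hd : _root_.deriv F = F₁ := funext fun s => (hF s).deriv
    have hd1 : _root_.deriv F₁ = F₂ := funext fun s => (hF₁ s).deriv
    have h1 : ContDiff ℝ 1 F₁ := contDiff_one_iff_deriv.mpr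
      ⟨fun s => (hF₁ s).differentiableAt, by rwa [hd1]⟩
    have h2 : ContDiff ℝ (1 + 1) F := contDiff_succ_iff_deriv.mpr
      ⟨fun s => (hF s).differentiableAt, by simp, by rwa [hd]⟩
    simpa [one_add_one_eq_two] using h2

end IsConvexExponent

/-! ### Comparison of first zeros -/

namespace IsProfile

variable {g g₁ g₂ : ℝ → ℝ} {ν : ℝ} {F F₁ A A₁ B B₁ : ℝ → ℝ} {S SA SB : ℝ}

/-- If SA ≤ SB, strict order would persist to SA, where A has limit 0 and B has a nonnegative one.
-/
lemma end_lt (hA : IsProfile ν g A A₁ SA) (hB : IsProfile ν g B B₁ SB)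
    (hg : IsConvexExponent g g₁ g₂) (hν : 10 ≤ ν) (hSA : 0 < SA)
    (hev : ∀ᶠ s in 𝓝[>] 0, B s < A s) (hA0 : Tendsto A (𝓝[<] SA) (𝓝 0))
    (hB0 : Tendsto B (𝓝[<] SB) (𝓝 0)) : SB < SA := by
  by_contra! hle
  have hlt := hA.lt_of_eventually_lt (hB.mono_right hle) hg hν hev
  rcases hle.eq_or_lt with rfl | hlt'
  · exact lt_irrefl _ (hA.lt_of_tendsto_left hB hg hν hSA hlt hA0 hB0)
  · have h1 := hA.lt_of_tendsto_left (hB.mono_right hle) hg hν hSA hlt hA0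
      ((hB.deriv SA ⟨hSA, hlt'⟩).continuousAt.tendsto.mono_left nhdsWithin_le_nhds)
    exact absurd h1 (not_lt.mpr (hB.pos SA ⟨hSA, hlt'⟩).le)

lemma sub_le_of_tendsto (hA : IsProfile ν g A A₁ S) (hB : IsProfile ν g B B₁ S)
    (hg : IsConvexExponent g g₁ g₂) (hν : 10 ≤ ν) (hle : ∀ s ∈ Ioo 0 S, B s ≤ A s) {a b : ℝ}
    (ha : Tendsto A (𝓝[>] 0) (𝓝 a)) (hb : Tendsto B (𝓝[>] 0) (𝓝 b)) :
    ∀ s ∈ Ioo 0 S, A s - B s ≤ a - b := by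
  intro s hs
  refine ge_of_tendsto (ha.sub hb) ?_
  filter_upwards [Ioo_mem_nhdsGT hs.1] with x hx
  exact hA.sub_antitoneOn hB hg hν hle ⟨hx.1, hx.2.trans hs.2⟩ hs hx.2.le

lemma mul_sub_le (h : IsProfile ν g F F₁ S) (hg : IsConvexExponent g g₁ g₂) (hν : 10 ≤ ν)
    (h0 : Tendsto F (𝓝[<] S) (𝓝 0)) :
    ∀ s ∈ Ioo 0 S, Real.exp (g 0) / (2 * ν) * (S - s) ≤ F s := by
  intro s hs
  set c := Real.exp (g 0) / (2 * ν)
  have h1 : AntitoneOn (fun s => F s + c * s) (Ioo 0 S) := by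
    refine antitoneOn_Ioo_of_hasDerivAt
      (fun s hs => (h.deriv s hs).add ((hasDerivAt_id s).const_mul c)) fun s hs => ?_
    linarith [h.deriv_le hg hν s hs]
  have h2 : Tendsto (fun s => F s + c * s) (𝓝[<] S) (𝓝 (0 + c * S)) :=
    h0.add ((tendsto_id.mono_left nhdsWithin_le_nhds).const_mul c)
  have h3 := le_of_tendsto h2 (b := F s + c * s) (by
    filter_upwards [Ioo_mem_nhdsLT hs.2] with x hx
    exact h1 hs ⟨hs.1.trans hx.1, hx.2⟩ hx.1.le)
  linarith

lemma end_le_of_tendsto (h : IsProfile ν g F F₁ S) (hg : IsConvexExponent g g₁ g₂) (hν : 10 ≤ ν)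
    (hS : 0 < S) (h0 : Tendsto F (𝓝[<] S) (𝓝 0)) {a : ℝ} (ha : Tendsto F (𝓝[>] 0) (𝓝 a)) :
    Real.exp (g 0) / (2 * ν) * S ≤ a := by
  have h1 : Tendsto (fun s => F s + Real.exp (g 0) / (2 * ν) * s) (𝓝[>] 0)
      (𝓝 (a + Real.exp (g 0) / (2 * ν) * 0)) :=
    ha.add ((tendsto_id.mono_left nhdsWithin_le_nhds).const_mul _)
  rw [mul_zero, add_zero] at h1
  refine ge_of_tendsto h1 ?_
  filter_upwards [Ioo_mem_nhdsGT hS] with x hx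
  linarith [h.mul_sub_le hg hν h0 x hx]

/-- The Hardy bound together with f'(F) ≥ f'(0). The bound does not depend on the profile, which
makes λ* finite. -/
lemma end_le (h : IsProfile ν g F F₁ S) (hg : IsConvexExponent g g₁ g₂) (hν : 10 ≤ ν) :
    S ≤ (ν - 2) ^ 2 / 4 / (g₁ 0 * Real.exp (g 0)) := by
  have hpos : 0 < g₁ 0 * Real.exp (g 0) := mul_pos (hg.pos₁ 0 le_rfl) (Real.exp_pos _)
  refine le_of_forall_lt_imp_le_of_dense fun x hx => ?_
  rcases le_or_gt x 0 with hx0 | hx0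
  · exact hx0.trans (by positivity)
  · have h1 := h.potential_le hg hν ⟨hx0, hx⟩
    have hF := (h.pos x ⟨hx0, hx⟩).le
    have h2 := hg.monotoneOn_exp_deriv (le_refl (0 : ℝ)) hF hF
    rw [le_div_iff₀ hpos]
    exact (mul_le_mul_of_nonneg_left h2 hx0.le).trans h1

end IsProfile

/-- The regular profiles `F α`, with `F α 0 = α`, and their first zeros `S α`. -/
structure IsRegularFamily (ν : ℝ) (g : ℝ → ℝ) (S : ℝ → ℝ) (F F₁ : ℝ → ℝ → ℝ) : Prop where
  end_pos : ∀ α, 0 < α → 0 < S α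
  profile : ∀ α, 0 < α → IsProfile ν g (F α) (F₁ α) (S α)
  contDiff : ∀ α, 0 < α → ContDiff ℝ 2 (F α)
  apply_zero : ∀ α, 0 < α → F α 0 = α
  apply_end : ∀ α, 0 < α → F α (S α) = 0

lemma IsConvexExponent.exists_regularFamily {g g₁ g₂ : ℝ → ℝ} (hg : IsConvexExponent g g₁ g₂)
    {N : ℕ} (hN : 10 ≤ N) : ∃ S F F₁, IsRegularFamily N g S F F₁ := by
  have h : ∀ α : ℝ, ∃ (S : ℝ) (F F₁ : ℝ → ℝ), 0 < α → (0 < S ∧ IsProfile N g F F₁ S ∧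
      ContDiff ℝ 2 F ∧ F 0 = α ∧ F S = 0) := by
    intro α
    by_cases hα : 0 < α
    · obtain ⟨S, F, F₁, h⟩ := hg.exists_regular_profile hN hα
      exact ⟨S, F, F₁, fun _ => h⟩
    · exact ⟨0, 0, 0, fun h => absurd h hα⟩
  choose S F F₁ h using h
  exact ⟨S, F, F₁, fun α hα => (h α hα).1, fun α hα => (h α hα).2.1,
    fun α hα => (h α hα).2.2.1, fun α hα => (h α hα).2.2.2.1, fun α hα => (h α hα).2.2.2.2⟩

/-! ### The first zero as a function of the height -/

namespace IsRegularFamily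

variable {g g₁ g₂ : ℝ → ℝ} {ν : ℝ} {S : ℝ → ℝ} {F F₁ : ℝ → ℝ → ℝ}

lemma tendsto_zero (h : IsRegularFamily ν g S F F₁) {α : ℝ} (hα : 0 < α) :
    Tendsto (F α) (𝓝[>] 0) (𝓝 α) := by
  have := (h.contDiff α hα).continuous.tendsto 0
  rw [h.apply_zero α hα] at this
  exact this.mono_left nhdsWithin_le_nhds

lemma tendsto_end (h : IsRegularFamily ν g S F F₁) {α : ℝ} (hα : 0 < α) :
    Tendsto (F α) (𝓝[<] (S α)) (𝓝 0) := by
  have := (h.contDiff α hα).continuous.tendsto (S α)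
  rw [h.apply_end α hα] at this
  exact this.mono_left nhdsWithin_le_nhds

lemma eventually_lt (h : IsRegularFamily ν g S F F₁) {α β : ℝ} (hα : 0 < α) (hαβ : α < β) :
    ∀ᶠ s in 𝓝[>] 0, F α s < F β s :=
  (h.tendsto_zero hα).eventually_lt (h.tendsto_zero (hα.trans hαβ)) hαβ

lemma end_lt_end (h : IsRegularFamily ν g S F F₁) (hg : IsConvexExponent g g₁ g₂) (hν : 10 ≤ ν)
    {α β : ℝ} (hα : 0 < α) (hαβ : α < β) : S α < S β :=
  have hβ := hα.trans hαβ
  (h.profile β hβ).end_lt (h.profile α hα) hg hν (h.end_pos β hβ) (h.eventually_lt hα hαβ)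
    (h.tendsto_end hβ) (h.tendsto_end hα)

lemma end_strictMonoOn (h : IsRegularFamily ν g S F F₁) (hg : IsConvexExponent g g₁ g₂)
    (hν : 10 ≤ ν) : StrictMonoOn S (Ioi 0) :=
  fun _ hα _ _ hαβ => h.end_lt_end hg hν hα hαβ

lemma lt (h : IsRegularFamily ν g S F F₁) (hg : IsConvexExponent g g₁ g₂) (hν : 10 ≤ ν)
    {α β : ℝ} (hα : 0 < α) (hαβ : α < β) : ∀ s ∈ Ioo 0 (S α), F α s < F β s :=
  ((h.profile β (hα.trans hαβ)).mono_right (h.end_lt_end hg hν hα hαβ).le).lt_of_eventually_lt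
    (h.profile α hα) hg hν (h.eventually_lt hα hαβ)

lemma sub_le (h : IsRegularFamily ν g S F F₁) (hg : IsConvexExponent g g₁ g₂) (hν : 10 ≤ ν)
    {α β : ℝ} (hα : 0 < α) (hαβ : α < β) : ∀ s ∈ Ioo 0 (S α), F β s - F α s ≤ β - α :=
  ((h.profile β (hα.trans hαβ)).mono_right (h.end_lt_end hg hν hα hαβ).le).sub_le_of_tendsto
    (h.profile α hα) hg hν (fun s hs => (h.lt hg hν hα hαβ s hs).le)
    (h.tendsto_zero (hα.trans hαβ)) (h.tendsto_zero hα)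

/-- At S α the higher profile has value at most β - α, the gap at the origin, and at least c(S β - S
α), by the slope bound. This makes S Lipschitz. -/
lemma end_sub_le (h : IsRegularFamily ν g S F F₁) (hg : IsConvexExponent g g₁ g₂) (hν : 10 ≤ ν)
    {α β : ℝ} (hα : 0 < α) (hαβ : α < β) :
    Real.exp (g 0) / (2 * ν) * (S β - S α) ≤ β - α := by
  have hβ := hα.trans hαβ
  have hS := h.end_lt_end hg hν hα hαβ
  have h1 := (h.profile β hβ).mul_sub_le hg hν (h.tendsto_end hβ) (S α) ⟨h.end_pos α hα, hS⟩
  have h2 : Tendsto (fun s => F β s - F α s) (𝓝[<] (S α)) (𝓝 (F β (S α) - 0)) :=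
    (((h.contDiff β hβ).continuous.tendsto (S α)).mono_left nhdsWithin_le_nhds).sub
      (h.tendsto_end hα)
  rw [sub_zero] at h2
  have h3 := le_of_tendsto h2 (b := β - α) (by
    filter_upwards [Ioo_mem_nhdsLT (h.end_pos α hα)] with x hx
    exact h.sub_le hg hν hα hαβ x hx)
  linarith

lemma end_continuousOn (h : IsRegularFamily ν g S F F₁) (hg : IsConvexExponent g g₁ g₂)
    (hν : 10 ≤ ν) : ContinuousOn S (Ioi 0) := by
  have hc : 0 < Real.exp (g 0) / (2 * ν) := by positivity
  set c := Real.exp (g 0) / (2 * ν) with hcdef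
  have key : ∀ α ∈ Ioi (0 : ℝ), ∀ β ∈ Ioi (0 : ℝ), α ≤ β → dist (S α) (S β) ≤ 1 / c * dist α β := by
    intro α hα β hβ hle
    rcases hle.eq_or_lt with rfl | hlt
    · simp
    have h1 := h.end_sub_le hg hν hα hlt
    have h2 := h.end_lt_end hg hν hα hlt
    rw [dist_comm, dist_comm α, Real.dist_eq, Real.dist_eq, abs_of_pos (sub_pos.mpr h2),
      abs_of_pos (sub_pos.mpr hlt), one_div, ← div_eq_inv_mul, le_div_iff₀ hc]
    linarith
  have : LipschitzOnWith ⟨1 / c, by positivity⟩ S (Ioi 0) := by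
    refine LipschitzOnWith.of_dist_le_mul fun α hα β hβ => ?_
    rcases le_total α β with hle | hle
    · exact key α hα β hβ hle
    · rw [dist_comm, dist_comm α]
      exact key β hβ α hα hle
  exact this.continuousOn

lemma end_tendsto_zero (h : IsRegularFamily ν g S F F₁) (hg : IsConvexExponent g g₁ g₂)
    (hν : 10 ≤ ν) : Tendsto S (𝓝[>] 0) (𝓝 0) := by
  have hc : 0 < Real.exp (g 0) / (2 * ν) := by positivity
  set c := Real.exp (g 0) / (2 * ν) with hcdef
  have h1 : Tendsto (fun α : ℝ => α / c) (𝓝[>] 0) (𝓝 0) := by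
    have : Tendsto (fun α : ℝ => α / c) (𝓝 0) (𝓝 (0 / c)) := tendsto_id.div_const c
    rw [zero_div] at this
    exact this.mono_left nhdsWithin_le_nhds
  refine tendsto_of_tendsto_of_tendsto_of_le_of_le' tendsto_const_nhds h1 ?_ ?_
  · filter_upwards [self_mem_nhdsWithin] with α hα using (h.end_pos α hα).le
  · filter_upwards [self_mem_nhdsWithin] with α hα
    rw [le_div_iff₀ hc, mul_comm]
    exact (h.profile α hα).end_le_of_tendsto hg hν (h.end_pos α hα) (h.tendsto_end hα)
      (h.tendsto_zero hα)

/-- A bounded profile is determined by its value at the origin. -/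
lemma eq_of_tendsto (h : IsRegularFamily ν g S F F₁) (hg : IsConvexExponent g g₁ g₂)
    (hν : 10 ≤ ν) {B B₁ : ℝ → ℝ} {T α : ℝ} (hα : 0 < α) (hT : 0 < T) (hB : IsProfile ν g B B₁ T)
    (hB0 : Tendsto B (𝓝[>] 0) (𝓝 α)) (hBT : Tendsto B (𝓝[<] T) (𝓝 0)) :
    T = S α ∧ ∀ s ∈ Ioo 0 T, B s = F α s := by
  -- The profile is squeezed between regular profiles of heights β > α and β < α as β → α; the
  -- comparison principle thus replaces uniqueness for the singular initial value problem.
  have hup : ∀ β, α < β → T < S β := fun β hβ =>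
    (h.profile β (hα.trans hβ)).end_lt hB hg hν (h.end_pos β (hα.trans hβ))
      (hB0.eventually_lt (h.tendsto_zero (hα.trans hβ)) hβ) (h.tendsto_end (hα.trans hβ)) hBT
  have hlow : ∀ β, 0 < β → β < α → S β < T := fun β hβ0 hβ =>
    hB.end_lt (h.profile β hβ0) hg hν hT
      ((h.tendsto_zero hβ0).eventually_lt hB0 hβ) hBT (h.tendsto_end hβ0)
  have hcont : ContinuousAt S α := (h.end_continuousOn hg hν).continuousAt (Ioi_mem_nhds hα)
  have hTS : T = S α := by
    refine le_antisymm ?_ ?_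
    · refine ge_of_tendsto (hcont.tendsto.mono_left nhdsWithin_le_nhds : Tendsto S (𝓝[>] α) _) ?_
      filter_upwards [self_mem_nhdsWithin] with β hβ using (hup β hβ).le
    · refine le_of_tendsto (hcont.tendsto.mono_left nhdsWithin_le_nhds : Tendsto S (𝓝[<] α) _) ?_
      filter_upwards [Ioo_mem_nhdsLT hα] with β hβ using (hlow β hβ.1 hβ.2).le
  refine ⟨hTS, fun s hs => le_antisymm ?_ ?_⟩
  · have hlim : Tendsto (fun β : ℝ => F α s + (β - α)) (𝓝[>] α) (𝓝 (F α s + (α - α))) :=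
      ((tendsto_id.mono_left nhdsWithin_le_nhds).sub_const α).const_add _
    rw [sub_self, add_zero] at hlim
    refine ge_of_tendsto hlim ?_
    filter_upwards [self_mem_nhdsWithin] with β hβ
    have hβ0 : 0 < β := hα.trans hβ
    have h1 := ((h.profile β hβ0).mono_right (hup β hβ).le).lt_of_eventually_lt hB hg hν
      (hB0.eventually_lt (h.tendsto_zero hβ0) hβ) s hs
    have h2 := h.sub_le hg hν hα hβ s (hTS ▸ hs)
    linarith
  · have hlim : Tendsto (fun β : ℝ => F α s - (α - β)) (𝓝[<] α) (𝓝 (F α s - (α - α))) :=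
      ((tendsto_id.mono_left nhdsWithin_le_nhds).const_sub α).const_sub _
    rw [sub_self, sub_zero] at hlim
    refine le_of_tendsto hlim ?_
    have hs' : ∀ᶠ β in 𝓝[<] α, s < S β :=
      (hcont.tendsto.mono_left nhdsWithin_le_nhds).eventually (lt_mem_nhds (hTS ▸ hs.2))
    filter_upwards [Ioo_mem_nhdsLT hα, hs'] with β hβ hsβ
    have h1 := (hB.mono_right (hlow β hβ.1 hβ.2).le).lt_of_eventually_lt (h.profile β hβ.1) hg hν
      ((h.tendsto_zero hβ.1).eventually_lt hB0 hβ.2) s ⟨hs.1, hsβ⟩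
    have h2 := h.sub_le hg hν hβ.1 hβ.2 s ⟨hs.1, hsβ⟩
    linarith

end IsRegularFamily

/-! ### Pointwise limits of functions with bounded derivatives -/

section LimitOfDerivatives

variable {y y' : ℕ → ℝ → ℝ} {Y Y' : ℝ → ℝ} {a b M : ℝ}

lemma continuousOn_of_tendsto_of_deriv_bounded
    (hy : ∀ᶠ n in atTop, ∀ x ∈ Ioo a b, HasDerivAt (y n) (y' n x) x ∧ |y' n x| ≤ M)
    (hY : ∀ x ∈ Ioo a b, Tendsto (fun n => y n x) atTop (𝓝 (Y x))) :
    ContinuousOn Y (Ioo a b) := by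
  have key : ∀ x ∈ Ioo a b, ∀ z ∈ Ioo a b, |Y z - Y x| ≤ M * |z - x| := by
    intro x hx z hz
    refine le_of_tendsto ((hY z hz).sub (hY x hx)).abs ?_
    filter_upwards [hy] with n hn
    exact (convex_Ioo a b).norm_image_sub_le_of_norm_hasDerivWithin_le
      (fun w hw => (hn w hw).1.hasDerivWithinAt) (fun w hw => (hn w hw).2) hx hz
  rcases (Ioo a b).eq_empty_or_nonempty with he | ⟨x, hx⟩
  · rw [he]; exact continuousOn_empty _
  intro x hx
  rw [ContinuousWithinAt, tendsto_iff_dist_tendsto_zero]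
  have hlim : Tendsto (fun z => M * |z - x|) (𝓝[Ioo a b] x) (𝓝 0) := by
    have : Continuous fun z : ℝ => M * |z - x| := by fun_prop
    have := this.tendsto x
    simp only [sub_self, abs_zero, mul_zero] at this
    exact this.mono_left nhdsWithin_le_nhds
  refine squeeze_zero' (Eventually.of_forall fun _ => dist_nonneg) ?_ hlim
  filter_upwards [self_mem_nhdsWithin] with z hz using key x hx z hz

/-- Passes to the limit in the integral formula by dominated convergence, so pointwise convergence
of the derivatives is enough. -/
lemma hasDerivAt_of_tendsto_of_deriv_bounded
    (hy : ∀ᶠ n in atTop, ∀ x ∈ Ioo a b, HasDerivAt (y n) (y' n x) x ∧ |y' n x| ≤ M)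
    (hyc : ∀ᶠ n in atTop, ContinuousOn (y' n) (Ioo a b))
    (hY : ∀ x ∈ Ioo a b, Tendsto (fun n => y n x) atTop (𝓝 (Y x)))
    (hY' : ∀ x ∈ Ioo a b, Tendsto (fun n => y' n x) atTop (𝓝 (Y' x)))
    (hYc : ContinuousOn Y' (Ioo a b)) : ∀ x ∈ Ioo a b, HasDerivAt Y (Y' x) x := by
  intro x hx
  obtain ⟨c, hc⟩ : ∃ c, c ∈ Ioo a x := ⟨(a + x) / 2, by linarith [hx.1], by linarith [hx.1]⟩
  have hcab : c ∈ Ioo a b := ⟨hc.1, hc.2.trans hx.2⟩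
  have hsub : ∀ z ∈ Ioo a b, uIcc c z ⊆ Ioo a b := fun z hz =>
    (ordConnected_Ioo).uIcc_subset hcab hz
  have hint : ∀ z ∈ Ioo a b, Y z = Y c + ∫ t in c..z, Y' t := by
    intro z hz
    have h1 : Tendsto (fun n => ∫ t in c..z, y' n t) atTop (𝓝 (∫ t in c..z, Y' t)) := by
      refine intervalIntegral.tendsto_integral_filter_of_dominated_convergence (fun _ => M)
        ?_ ?_ intervalIntegrable_const ?_
      · filter_upwards [hyc] with n hn
        exact (((hn.mono (hsub z hz)).intervalIntegrable).aestronglyMeasurable_restrict_uIoc)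
      · filter_upwards [hy] with n hn
        exact Eventually.of_forall fun t ht => (hn t (hsub z hz (uIoc_subset_uIcc ht))).2
      · exact Eventually.of_forall fun t ht => hY' t (hsub z hz (uIoc_subset_uIcc ht))
    have h2 : Tendsto (fun n => ∫ t in c..z, y' n t) atTop (𝓝 (Y z - Y c)) := by
      refine ((hY z hz).sub (hY c hcab)).congr' ?_
      filter_upwards [hy, hyc] with n hn hnc
      exact (intervalIntegral.integral_eq_sub_of_hasDerivAt
        (fun t ht => (hn t (hsub z hz ht)).1) (hnc.mono (hsub z hz)).intervalIntegrable).symm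
    have := tendsto_nhds_unique h1 h2
    linarith
  have h3 : HasDerivAt (fun z => Y c + ∫ t in c..z, Y' t) (Y' x) x :=
    (intervalIntegral.integral_hasDerivAt_right (hYc.mono (hsub x hx)).intervalIntegrable
      (hYc.stronglyMeasurableAtFilter isOpen_Ioo x hx)
      (hYc.continuousAt (Ioo_mem_nhds hx.1 hx.2))).const_add _
  refine h3.congr_of_eventuallyEq ?_
  filter_upwards [Ioo_mem_nhds hx.1 hx.2] with z hz using hint z hz

end LimitOfDerivatives

/-! ### The limit parameter and the singular profile -/

namespace IsRegularFamily

variable {g g₁ g₂ : ℝ → ℝ} {ν : ℝ} {S : ℝ → ℝ} {F F₁ : ℝ → ℝ → ℝ}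

lemma exists_limit_end (h : IsRegularFamily ν g S F F₁) (hg : IsConvexExponent g g₁ g₂)
    (hν : 10 ≤ ν) : ∃ T, 0 < T ∧ (∀ α, 0 < α → S α < T) ∧ Tendsto S atTop (𝓝 T) := by
  have hbdd : BddAbove (S '' Ioi 0) := by
    refine ⟨(ν - 2) ^ 2 / 4 / (g₁ 0 * Real.exp (g 0)), ?_⟩
    rintro _ ⟨α, hα, rfl⟩
    exact (h.profile α hα).end_le hg hν
  have hlt : ∀ α, 0 < α → S α < sSup (S '' Ioi 0) := fun α hα =>
    (h.end_lt_end hg hν hα (lt_add_one α)).trans_le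
      (le_csSup hbdd ⟨α + 1, by simp only [mem_Ioi]; linarith, rfl⟩)
  refine ⟨sSup (S '' Ioi 0), (h.end_pos 1 one_pos).trans (hlt 1 one_pos), hlt, ?_⟩
  rw [tendsto_order]
  constructor
  · intro x hx
    obtain ⟨_, ⟨α, hα, rfl⟩, hα'⟩ := exists_lt_of_lt_csSup (nonempty_Ioi.image S) hx
    filter_upwards [eventually_gt_atTop α] with β hβ
    exact hα'.trans (h.end_lt_end hg hν hα hβ)
  · intro x hx
    filter_upwards [eventually_gt_atTop 0] with β hβ using (hlt β hβ).trans hx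

/-- Both F(n+1) and F₁(n+1) are monotone in n at fixed s, and the bounds F ≤ C/s and -F₁ ≤ K₁/s do
not depend on n, so both converge pointwise and the equation passes to the limit. -/
lemma exists_singular_profile (h : IsRegularFamily ν g S F F₁) (hg : IsConvexExponent g g₁ g₂)
    (hν : 10 ≤ ν) {T : ℝ} (hT : 0 < T) (hST : ∀ α, 0 < α → S α < T)
    (hlimS : Tendsto S atTop (𝓝 T)) :
    ∃ V V₁, IsProfile ν g V V₁ T ∧ Tendsto V (𝓝[>] 0) atTop ∧ Tendsto V (𝓝[<] T) (𝓝 0) ∧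
      ∀ s ∈ Ioo 0 T, Tendsto (fun n : ℕ => F (n + 1) s) atTop (𝓝 (V s)) := by
  have ha0 : ∀ n : ℕ, (0 : ℝ) < n + 1 := fun n => by positivity
  have halim : Tendsto (fun n : ℕ => (n : ℝ) + 1) atTop atTop :=
    tendsto_atTop_add_const_right _ _ tendsto_natCast_atTop_atTop
  have hev : ∀ s, s < T → ∀ᶠ n : ℕ in atTop, s < S (n + 1) := fun s hs =>
    (hlimS.comp halim).eventually (lt_mem_nhds hs)
  have hmonoS : ∀ m n : ℕ, m ≤ n → S (m + 1) ≤ S (n + 1) := fun m n hmn =>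
    (h.end_strictMonoOn hg hν).monotoneOn (ha0 m) (ha0 n) (by gcongr)
  have hFle : ∀ m n : ℕ, m ≤ n → ∀ s ∈ Ioo 0 (S (m + 1)), F (m + 1) s ≤ F (n + 1) s := by
    intro m n hmn s hs
    rcases hmn.eq_or_lt with rfl | hlt
    · exact le_rfl
    · exact (h.lt hg hν (ha0 m) (by gcongr) s hs).le
  have hF₁le : ∀ m n : ℕ, m ≤ n → ∀ s ∈ Ioo 0 (S (m + 1)), F₁ (n + 1) s ≤ F₁ (m + 1) s := by
    intro m n hmn s hs
    exact ((h.profile _ (ha0 n)).mono_right (hmonoS m n hmn)).deriv_le_deriv (h.profile _ (ha0 m))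
      hg hν (hFle m n hmn) s hs
  set K := (ν - 2) ^ 2 / 4 / g₁ 0 with hK
  have hK0 : 0 ≤ K := div_nonneg (by positivity) (hg.pos₁ 0 le_rfl).le
  set K₁ := K / (2 * ν - 4) with hK₁
  have hK₁0 : 0 ≤ K₁ := div_nonneg hK0 (by linarith)
  have hF₁low : ∀ n : ℕ, ∀ s ∈ Ioo 0 (S (n + 1)), s * -F₁ (n + 1) s ≤ K₁ := fun n s hs =>
    (h.profile _ (ha0 n)).neg_deriv_le hg hν
      (fun s hs => (h.profile _ (ha0 n)).mul_exp_le hg hν hs) s hs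
  have hVex : ∀ s, ∃ l, s ∈ Ioo 0 T → Tendsto (fun n : ℕ => F (n + 1) s) atTop (𝓝 l) := by
    intro s
    by_cases hs : s ∈ Ioo 0 T
    · obtain ⟨n₀, hn₀⟩ := (hev s hs.2).exists
      have hmem : ∀ n : ℕ, s ∈ Ioo 0 (S ((n + n₀ : ℕ) + 1)) := fun n =>
        ⟨hs.1, hn₀.trans_le (hmonoS _ _ (by omega))⟩
      have hmono : Monotone fun n : ℕ => F ((n + n₀ : ℕ) + 1) s := fun m n hmn =>
        hFle _ _ (by omega) s (hmem m)
      have hb : BddAbove (range fun n : ℕ => F ((n + n₀ : ℕ) + 1) s) := by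
        refine ⟨(ν - 2) ^ 2 / 4 / (g₁ 0 ^ 2 * Real.exp (g 0)) / s, ?_⟩
        rintro _ ⟨n, rfl⟩
        exact (h.profile _ (ha0 _)).le_const_div hg hν (hmem n)
      exact ⟨_, fun _ => (tendsto_add_atTop_iff_nat (f := fun n : ℕ => F (n + 1) s) n₀).mp
        (tendsto_atTop_ciSup hmono hb)⟩
    · exact ⟨0, fun h => absurd h hs⟩
  have hV₁ex : ∀ s, ∃ l, s ∈ Ioo 0 T → Tendsto (fun n : ℕ => F₁ (n + 1) s) atTop (𝓝 l) := by
    intro s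
    by_cases hs : s ∈ Ioo 0 T
    · obtain ⟨n₀, hn₀⟩ := (hev s hs.2).exists
      have hmem : ∀ n : ℕ, s ∈ Ioo 0 (S ((n + n₀ : ℕ) + 1)) := fun n =>
        ⟨hs.1, hn₀.trans_le (hmonoS _ _ (by omega))⟩
      have hmono : Antitone fun n : ℕ => F₁ ((n + n₀ : ℕ) + 1) s := fun m n hmn =>
        hF₁le _ _ (by omega) s (hmem m)
      have hb : BddBelow (range fun n : ℕ => F₁ ((n + n₀ : ℕ) + 1) s) := by
        refine ⟨-(K₁ / s), ?_⟩
        rintro _ ⟨n, rfl⟩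
        have h1 := hF₁low _ s (hmem n)
        rw [mul_comm, ← le_div_iff₀ hs.1] at h1
        linarith
      exact ⟨_, fun _ => (tendsto_add_atTop_iff_nat (f := fun n : ℕ => F₁ (n + 1) s) n₀).mp
        (tendsto_atTop_ciInf hmono hb)⟩
    · exact ⟨0, fun h => absurd h hs⟩
  choose V hV using hVex
  choose V₁ hV₁ using hV₁ex
  have hVge : ∀ n : ℕ, ∀ s ∈ Ioo 0 (S (n + 1)), F (n + 1) s ≤ V s := by
    intro n s hs
    refine ge_of_tendsto (hV s ⟨hs.1, hs.2.trans (hST _ (ha0 n))⟩) ?_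
    filter_upwards [eventually_ge_atTop n] with m hm using hFle n m hm s hs
  have hVpos : ∀ s ∈ Ioo 0 T, 0 < V s := by
    intro s hs
    obtain ⟨n, hn⟩ := (hev s hs.2).exists
    exact ((h.profile _ (ha0 n)).pos s ⟨hs.1, hn⟩).trans_le (hVge n s ⟨hs.1, hn⟩)
  have hderiv : ∀ s ∈ Ioo 0 T, HasDerivAt V (V₁ s) s ∧
      HasDerivAt V₁ (-(2 * ν * V₁ s + Real.exp (g (V s))) / (4 * s)) s := by
    intro s hs
    obtain ⟨a, ha⟩ : ∃ a, a ∈ Ioo 0 s := ⟨s / 2, by linarith [hs.1], by linarith [hs.1]⟩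
    obtain ⟨b, hb⟩ : ∃ b, b ∈ Ioo s T := ⟨(s + T) / 2, by linarith [hs.2], by linarith [hs.2]⟩
    have ha0' := ha.1
    have hsub : ∀ x ∈ Ioo a b, x ∈ Ioo 0 T := fun x hx => ⟨ha.1.trans hx.1, hx.2.trans hb.2⟩
    have hsubn : ∀ᶠ n : ℕ in atTop, ∀ x ∈ Ioo a b, x ∈ Ioo 0 (S (n + 1)) := by
      filter_upwards [hev b hb.2] with n hn x hx using ⟨ha.1.trans hx.1, hx.2.trans hn⟩
    have hbd : ∀ n : ℕ, ∀ x ∈ Ioo a b, x ∈ Ioo 0 (S (n + 1)) → |F₁ (n + 1) x| ≤ K₁ / a := by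
      intro n x hx hx'
      have h1 := hF₁low n x hx'
      have h2 := (h.profile _ (ha0 n)).deriv_nonpos hν x hx'
      rw [abs_of_nonpos h2, le_div_iff₀ ha0']
      nlinarith [hx.1]
    have hd0 : ∀ᶠ n : ℕ in atTop, ∀ x ∈ Ioo a b,
        HasDerivAt (F (n + 1)) (F₁ (n + 1) x) x ∧ |F₁ (n + 1) x| ≤ K₁ / a := by
      filter_upwards [hsubn] with n hn x hx
      exact ⟨(h.profile _ (ha0 n)).deriv x (hn x hx), hbd n x hx (hn x hx)⟩
    have hd1 : ∀ᶠ n : ℕ in atTop, ∀ x ∈ Ioo a b,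
        HasDerivAt (F₁ (n + 1))
          (-(2 * ν * F₁ (n + 1) x + Real.exp (g (F (n + 1) x))) / (4 * x)) x ∧
        |-(2 * ν * F₁ (n + 1) x + Real.exp (g (F (n + 1) x))) / (4 * x)|
          ≤ (2 * ν * (K₁ / a) + K / a) / (4 * a) := by
      filter_upwards [hsubn] with n hn x hx
      refine ⟨(h.profile _ (ha0 n)).deriv₁ x (hn x hx), ?_⟩
      have hx0 : 0 < x := ha0'.trans hx.1
      have h1 := hbd n x hx (hn x hx)
      have h2 := (h.profile _ (ha0 n)).mul_exp_le hg hν (hn x hx)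
      have h3 : Real.exp (g (F (n + 1) x)) ≤ K / a := by
        rw [le_div_iff₀ ha0']
        nlinarith [hx.1, Real.exp_pos (g (F (n + 1) x))]
      rw [abs_div, abs_neg, abs_of_pos (by positivity : 0 < 4 * x)]
      have h4 : |2 * ν * F₁ (n + 1) x + Real.exp (g (F (n + 1) x))|
          ≤ 2 * ν * (K₁ / a) + K / a := by
        refine (abs_add_le _ _).trans ?_
        rw [abs_mul, abs_of_pos (by linarith : 0 < 2 * ν), abs_of_pos (Real.exp_pos _)]
        gcongr
      gcongr
      exact hx.1.le
    have hVc : ContinuousOn V (Ioo a b) :=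
      continuousOn_of_tendsto_of_deriv_bounded hd0 fun x hx => hV x (hsub x hx)
    have hV₁c : ContinuousOn V₁ (Ioo a b) :=
      continuousOn_of_tendsto_of_deriv_bounded hd1 fun x hx => hV₁ x (hsub x hx)
    have hexp : ContinuousOn (fun t => Real.exp (g t)) (Ici 0) :=
      Real.continuous_exp.comp_continuousOn hg.cont
    have hrhs : ContinuousOn (fun x => -(2 * ν * V₁ x + Real.exp (g (V x))) / (4 * x))
        (Ioo a b) := by
      refine (((hV₁c.const_smul (2 * ν)).add (hexp.comp hVc
        fun x hx => (hVpos x (hsub x hx)).le)).neg).div (by fun_prop) ?_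
      intro x hx
      have := (hsub x hx).1
      positivity
    refine ⟨?_, ?_⟩
    · refine hasDerivAt_of_tendsto_of_deriv_bounded hd0 ?_ (fun x hx => hV x (hsub x hx))
        (fun x hx => hV₁ x (hsub x hx)) hV₁c s ⟨ha.2, hb.1⟩
      filter_upwards [hd1] with n hn x hx using (hn x hx).1.continuousAt.continuousWithinAt
    · refine hasDerivAt_of_tendsto_of_deriv_bounded hd1 ?_ (fun x hx => hV₁ x (hsub x hx))
        ?_ hrhs s ⟨ha.2, hb.1⟩
      · filter_upwards [hd0, hd1, hsubn] with n hn hn1 hn2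
        have hc0 : ContinuousOn (F (n + 1)) (Ioo a b) :=
          fun x hx => (hn x hx).1.continuousAt.continuousWithinAt
        have hc1 : ContinuousOn (F₁ (n + 1)) (Ioo a b) :=
          fun x hx => (hn1 x hx).1.continuousAt.continuousWithinAt
        refine (((hc1.const_smul (2 * ν)).add (hexp.comp hc0
          fun x hx => ((h.profile _ (ha0 n)).pos x (hn2 x hx)).le)).neg).div (by fun_prop) ?_
        intro x hx
        have := (hsub x hx).1
        positivity
      · intro x hx
        have h1 := hV x (hsub x hx)
        have h2 := hexp.continuousAt (Ici_mem_nhds (hVpos x (hsub x hx)))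
        exact ((((hV₁ x (hsub x hx)).const_mul (2 * ν)).add (h2.tendsto.comp h1)).neg).div_const _
  refine ⟨V, V₁, ⟨hVpos, fun s hs => (hderiv s hs).1, fun s hs => (hderiv s hs).2⟩, ?_, ?_, hV⟩
  · refine tendsto_atTop.mpr fun b => ?_
    -- V dominates the regular profile of height n + 1 > b, which exceeds b near the origin.
    obtain ⟨n, hn⟩ := (halim.eventually (eventually_gt_atTop b)).exists
    have h1 := (h.tendsto_zero (ha0 n)).eventually (lt_mem_nhds hn)
    filter_upwards [h1, Ioo_mem_nhdsGT (h.end_pos _ (ha0 n))] with s hs hs'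
    exact hs.le.trans (hVge n s hs')
  · set c := K₁ / (T / 2) with hc
    -- On (T/2, T) the slopes of all regular profiles are at least -c; integrating back from their
    -- zeros gives an n-independent bound.
    have hbound : ∀ s ∈ Ioo (T / 2) T, V s ≤ c * (T - s) := by
      intro s hs
      have hs0 : 0 < s := by linarith [hs.1]
      refine le_of_tendsto (hV s ⟨hs0, hs.2⟩) ?_
      filter_upwards [hev s hs.2] with n hn
      have hmono : MonotoneOn (fun x => F (n + 1) x + c * x) (Ioo (T / 2) (S (n + 1))) := by
        refine monotoneOn_Ioo_of_hasDerivAt (fun x hx =>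
          ((h.profile _ (ha0 n)).deriv x ⟨by linarith [hx.1], hx.2⟩).add
            ((hasDerivAt_id x).const_mul c)) ?_
        intro x hx
        have hx0 : 0 < x := by linarith [hx.1]
        have h1 := hF₁low n x ⟨hx0, hx.2⟩
        have h2 : K₁ / x ≤ c := by
          rw [hc]
          gcongr
          exact hx.1.le
        rw [mul_comm, ← le_div_iff₀ hx0] at h1
        linarith
      have hlim : Tendsto (fun x => F (n + 1) x + c * x) (𝓝[<] (S (n + 1)))
          (𝓝 (0 + c * S (n + 1))) :=
        (h.tendsto_end (ha0 n)).add ((tendsto_id.mono_left nhdsWithin_le_nhds).const_mul c)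
      have h3 := ge_of_tendsto hlim (b := F (n + 1) s + c * s) (by
        filter_upwards [Ioo_mem_nhdsLT hn] with x hx
        exact hmono ⟨hs.1, hn⟩ ⟨hs.1.trans hx.1, hx.2⟩ hx.1.le)
      have h4 : c * S (n + 1) ≤ c * T :=
        mul_le_mul_of_nonneg_left (hST _ (ha0 n)).le (by positivity)
      linarith
    have hlim : Tendsto (fun s => c * (T - s)) (𝓝[<] T) (𝓝 0) := by
      have : Continuous fun s : ℝ => c * (T - s) := by fun_prop
      have := this.tendsto T
      simp only [sub_self, mul_zero] at this
      exact this.mono_left nhdsWithin_le_nhds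
    refine squeeze_zero' ?_ ?_ hlim
    · filter_upwards [Ioo_mem_nhdsLT hT] with s hs using (hVpos s hs).le
    · filter_upwards [Ioo_mem_nhdsLT (by linarith : T / 2 < T)] with s hs using hbound s hs

end IsRegularFamily

/-! ### Uniqueness of the singular profile -/

namespace IsProfile

variable {g g₁ g₂ : ℝ → ℝ} {ν : ℝ} {V V₁ W W₁ : ℝ → ℝ} {S : ℝ}

/-- A profile whose linearized potential is small compared with the Hardy potential is bounded at
the origin. -/
lemma not_tendsto_atTop_of_potential_le (hV : IsProfile ν g V V₁ S)
    (hg : IsConvexExponent g g₁ g₂) (hν : 10 ≤ ν) (hS : 0 < S)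
    (hsmall : ∀ s ∈ Ioo 0 S, s * (g₁ (V s) * Real.exp (g (V s))) ≤ 4) :
    ¬ Tendsto V (𝓝[>] 0) atTop := by
  intro htop
  have hanti := hV.antitoneOn hν
  -- For x > s, g₁(V) ≥ g₁(V x) on (0, x), so there σ f(V(σ)) ≤ 4/g₁(V x). Then `neg_deriv_le`
  -- divides by 2ν - 4 ≥ 16, and x → s gives the claim.
  have hslope : ∀ s ∈ Ioo 0 S, s * -V₁ s * g₁ (V s) ≤ 1 / 4 := by
    intro s hs
    have hcont : ContinuousAt (fun x => s * -V₁ s * g₁ (V x)) s :=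
      continuousAt_const.mul (((hg.deriv₁ _ (hV.pos s hs)).continuousAt).comp
        (hV.deriv s hs).continuousAt)
    refine le_of_tendsto (hcont.tendsto.mono_left nhdsWithin_le_nhds : Tendsto _ (𝓝[>] s) _) ?_
    filter_upwards [Ioo_mem_nhdsGT hs.2] with x hx
    have hxS : x ∈ Ioo 0 S := ⟨hs.1.trans hx.1, hx.2⟩
    have hgx := hg.pos₁ _ (hV.pos x hxS).le
    have h1 := (hV.mono_right hx.2.le).neg_deriv_le hg hν (K := 4 / g₁ (V x)) (by
      intro σ hσ
      have hσS : σ ∈ Ioo 0 S := ⟨hσ.1, hσ.2.trans hx.2⟩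
      have h2 := hsmall σ hσS
      have h3 := hg.monotoneOn₁ (hV.pos x hxS).le (hV.pos σ hσS).le (hanti hσS hxS hσ.2.le)
      rw [le_div_iff₀ hgx]
      have h4 : 0 < σ * Real.exp (g (V σ)) := mul_pos hσ.1 (Real.exp_pos _)
      nlinarith) s ⟨hs.1, hx.1⟩
    rw [div_div, le_div_iff₀ (mul_pos hgx (by linarith))] at h1
    have h5 : 0 ≤ s * -V₁ s * g₁ (V x) :=
      mul_nonneg (mul_nonneg hs.1.le (by linarith [hV.deriv_nonpos hν s hs])) hgx.le
    nlinarith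
  -- Since g₂ ≤ g₁², the logarithmic derivative of 1/f'(V) is at most -2V'g₁(V) ≤ 1/(2s). Hence
  -- 1/f'(V) is at least a multiple of s^(1/2), and f(V) = O(s^(-1/2)).
  have hXanti : AntitoneOn (fun s => s ^ (-(1 / 2) : ℝ) * (Real.exp (-g (V s)) / g₁ (V s)))
      (Ioo 0 S) := by
    refine antitoneOn_Ioo_of_hasDerivAt (fun s hs => (hasDerivAt_rpow_div hs.1 _).mul
      (hV.hasDerivAt_inv_deriv hg hs)) ?_
    intro s hs
    have hs0 := hs.1
    have hVs := hV.pos s hs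
    have hG := hg.pos₁ _ hVs.le
    have h1 := hslope s hs
    have h2 : g₂ (V s) / g₁ (V s) ^ 2 ≤ 1 := by
      rw [div_le_one (by positivity)]
      exact hg.le₂ _ hVs
    have h3 : 0 ≤ -V₁ s := by linarith [hV.deriv_nonpos hν s hs]
    have he := Real.exp_pos (-g (V s))
    have hp : 0 < s ^ (-(1 / 2) : ℝ) := Real.rpow_pos_of_pos hs0 _
    generalize s ^ (-(1 / 2) : ℝ) = p at *
    generalize Real.exp (-g (V s)) = e at *
    generalize V₁ s = b at *
    have h4 : -b * e * (1 + g₂ (V s) / g₁ (V s) ^ 2) ≤ -b * e * 2 := by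
      gcongr
      linarith
    have h5 : p * (-b * e * (1 + g₂ (V s) / g₁ (V s) ^ 2)) ≤ p * (-b * e * 2) := by gcongr
    have h6 : -(1 / 2) * p / s * (e / g₁ (V s)) + p * (-b * e * 2)
        = p * e / (s * g₁ (V s)) * (2 * (s * -b * g₁ (V s)) - 1 / 2) := by
      field_simp
      ring
    have h7 : p * e / (s * g₁ (V s)) * (2 * (s * -b * g₁ (V s)) - 1 / 2) ≤ 0 :=
      mul_nonpos_of_nonneg_of_nonpos (by positivity) (by linarith)
    linarith
  set s₁ := S / 2 with hs₁
  have hs₁S : s₁ ∈ Ioo 0 S := ⟨by linarith, by linarith⟩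
  set c := s₁ ^ (-(1 / 2) : ℝ) * (Real.exp (-g (V s₁)) / g₁ (V s₁)) with hc
  have hc0 : 0 < c := mul_pos (Real.rpow_pos_of_pos hs₁S.1 _)
    (div_pos (Real.exp_pos _) (hg.pos₁ _ (hV.pos _ hs₁S).le))
  have hG0 := hg.pos₁ 0 le_rfl
  have hexp : ∀ s ∈ Ioo 0 s₁, Real.exp (g (V s)) ≤ s ^ (-(1 / 2) : ℝ) / (g₁ 0 * c) := by
    intro s hs
    have hsS : s ∈ Ioo 0 S := ⟨hs.1, hs.2.trans hs₁S.2⟩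
    have h1 : c ≤ s ^ (-(1 / 2) : ℝ) * (Real.exp (-g (V s)) / g₁ (V s)) :=
      hXanti hsS hs₁S hs.2.le
    have hVs := (hV.pos s hsS).le
    have h2 := hg.monotoneOn₁ (le_refl (0 : ℝ)) hVs hVs
    have hG := hg.pos₁ _ hVs
    rw [le_div_iff₀ (by positivity)]
    have he := Real.exp_pos (g (V s))
    rw [Real.exp_neg, inv_div_left, ← div_eq_mul_inv, le_div_iff₀ (by positivity)] at h1
    calc Real.exp (g (V s)) * (g₁ 0 * c) ≤ Real.exp (g (V s)) * (g₁ (V s) * c) := by gcongr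
      _ = c * (g₁ (V s) * Real.exp (g (V s))) := by ring
      _ ≤ _ := h1
  set c₃ := 1 / (g₁ 0 * c) / (ν - 1) with hc₃
  have hc₃0 : 0 < c₃ := div_pos (by positivity) (by linarith)
  -- The radial operator maps s^(1/2) to (ν-1)s^(-1/2), so c₃ makes -V - c₃ s^(1/2) superharmonic.
  -- Then -V' = O(s^(-1/2)) is integrable and V is bounded.
  have hdneg : ∀ s ∈ Ioo 0 s₁,
      -V₁ s - c₃ * (1 / 2 * s ^ (1 / 2 : ℝ) / s) ≤ 0 := by
    refine deriv_nonpos_of_radial_superharmonic hν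
      (C := (ν - 2) ^ 2 / 4 / (g₁ 0 ^ 2 * Real.exp (g 0)) + c₃ * s₁ ^ (1 / 2 : ℝ) * s₁)
      (Ψ := fun s => -V s - c₃ * s ^ (1 / 2 : ℝ))
      (fun s hs => (hV.deriv s ⟨hs.1, hs.2.trans hs₁S.2⟩).neg.sub
        ((hasDerivAt_rpow_div hs.1 (1 / 2)).const_mul c₃))
      (fun s hs => (hV.deriv₁ s ⟨hs.1, hs.2.trans hs₁S.2⟩).neg.sub
        ((((hasDerivAt_rpow_div hs.1 (1 / 2)).const_mul (1 / 2)).div (hasDerivAt_id s)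
          hs.1.ne').const_mul c₃)) ?_ ?_
    · intro s hs
      have hs0 := hs.1
      have h1 := hexp s hs
      have h2 : s ^ (-(1 / 2) : ℝ) = s ^ (1 / 2 : ℝ) / s := by
        rw [← Real.rpow_sub_one hs0.ne']
        norm_num
      rw [h2] at h1
      have hν1 : ν - 1 ≠ 0 := by linarith
      have h3 : c₃ * (ν - 1) = 1 / (g₁ 0 * c) := by
        rw [hc₃]; field_simp
      have h4 : s ^ (1 / 2 : ℝ) / s / (g₁ 0 * c) = s ^ (1 / 2 : ℝ) / s * (c₃ * (ν - 1)) := by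
        rw [h3]; ring
      rw [h4] at h1
      simp only [id]
      generalize s ^ (1 / 2 : ℝ) = r at *
      have h5 : 4 * s * (-(-(2 * ν * V₁ s + Real.exp (g (V s))) / (4 * s))
          - c₃ * ((1 / 2 * (1 / 2 * r / s) * s - 1 / 2 * r * 1) / s ^ 2))
          + 2 * ν * (-V₁ s - c₃ * (1 / 2 * r / s))
          = Real.exp (g (V s)) - r / s * (c₃ * (ν - 1)) := by
        field_simp
        ring
      rw [h5]
      linarith
    · intro s hs
      have hs0 := hs.1
      have h1 := hV.le_const_div hg hν ⟨hs.1, hs.2.trans hs₁S.2⟩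
      have h2 : s ^ (1 / 2 : ℝ) ≤ s₁ ^ (1 / 2 : ℝ) :=
        Real.rpow_le_rpow hs0.le hs.2.le (by norm_num)
      have h3 : c₃ * s ^ (1 / 2 : ℝ) ≤ c₃ * s₁ ^ (1 / 2 : ℝ) * s₁ / s := by
        rw [le_div_iff₀ hs0]
        have := Real.rpow_nonneg hs0.le (1 / 2)
        gcongr
        exact hs.2.le
      rw [neg_div, add_div]
      linarith
  have hanti2 : AntitoneOn (fun s => -V s - c₃ * s ^ (1 / 2 : ℝ)) (Ioo 0 s₁) :=
    antitoneOn_Ioo_of_hasDerivAt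
      (fun s hs => (hV.deriv s ⟨hs.1, hs.2.trans hs₁S.2⟩).neg.sub
        ((hasDerivAt_rpow_div hs.1 (1 / 2)).const_mul c₃)) hdneg
  have hs₂ : s₁ / 2 ∈ Ioo 0 s₁ := ⟨by linarith [hs₁S.1], by linarith [hs₁S.1]⟩
  obtain ⟨s, hs1, hs2⟩ := ((htop.eventually
    (eventually_gt_atTop (V (s₁ / 2) + c₃ * (s₁ / 2) ^ (1 / 2 : ℝ)))).and
    (Ioo_mem_nhdsGT hs₂.1)).exists
  have h1 := hanti2 ⟨hs2.1, hs2.2.trans hs₂.2⟩ hs₂ hs2.2.le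
  simp only at h1
  have h2 : 0 ≤ c₃ * s ^ (1 / 2 : ℝ) := mul_nonneg hc₃0.le (Real.rpow_nonneg hs2.1.le _)
  linarith

/-- Two profiles separated by a positive gap cannot both be singular at the origin. -/
lemma not_tendsto_atTop_of_gap (hW : IsProfile ν g W W₁ S) (hV : IsProfile ν g V V₁ S)
    (hg : IsConvexExponent g g₁ g₂) (hν : 10 ≤ ν) (hS : 0 < S) {δ : ℝ} (hδ : 0 < δ)
    (hgap : ∀ s ∈ Ioo 0 S, V s + δ ≤ W s) : ¬ Tendsto V (𝓝[>] 0) atTop := by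
  intro htop
  have hG0 := hg.pos₁ 0 le_rfl
  have hle : ∀ s ∈ Ioo 0 S, V s ≤ W s := fun s hs => by linarith [hgap s hs]
  set k := g₁ 0 * δ with hk
  have hk0 : 0 < k := mul_pos hG0 hδ
  -- The gap gives f(W) - f(V) ≥ f'(V)δ ≥ k f(V), so W - V - kV is superharmonic. Consequently W - V
  -- ≥ kV - const, which blows up with V.
  have hanti : AntitoneOn (fun s => W s - V s - k * V s) (Ioo 0 S) := by
    refine antitoneOn_Ioo_of_hasDerivAt (fun s hs => ((hW.deriv s hs).sub (hV.deriv s hs)).sub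
      ((hV.deriv s hs).const_mul k)) ?_
    refine deriv_nonpos_of_radial_superharmonic hν
      (C := k * ((ν - 2) ^ 2 / 4 / (g₁ 0 ^ 2 * Real.exp (g 0))))
      (Ψ := fun s => W s - V s - k * V s)
      (fun s hs => ((hW.deriv s hs).sub (hV.deriv s hs)).sub ((hV.deriv s hs).const_mul k))
      (fun s hs => ((hW.deriv₁ s hs).sub (hV.deriv₁ s hs)).sub ((hV.deriv₁ s hs).const_mul k))
      ?_ ?_
    · intro s hs
      have h1 := hW.equation hs
      have h2 := hV.equation hs
      have hVs := (hV.pos s hs).le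
      have h3 := hg.le_exp_sub hVs (hle s hs)
      have h4 := hg.monotoneOn₁ (le_refl (0 : ℝ)) hVs hVs
      have he := Real.exp_pos (g (V s))
      have h5 : k * Real.exp (g (V s)) ≤ g₁ (V s) * Real.exp (g (V s)) * (W s - V s) := by
        calc k * Real.exp (g (V s)) = g₁ 0 * Real.exp (g (V s)) * δ := by rw [hk]; ring
          _ ≤ _ := by
            have := hgap s hs
            have := hg.pos₁ _ hVs
            gcongr
            linarith
      have h6 : k * (4 * s * (-(2 * ν * V₁ s + Real.exp (g (V s))) / (4 * s)) + 2 * ν * V₁ s)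
          = k * -Real.exp (g (V s)) := by rw [h2]
      linarith
    · intro s hs
      have h1 := mul_le_mul_of_nonneg_left (hV.le_const_div hg hν hs) hk0.le
      have h2 := hle s hs
      rw [neg_div, mul_div_assoc]
      linarith
  have hDtop : Tendsto (fun s => W s - V s) (𝓝[>] 0) atTop := by
    have h1 : Tendsto (fun s => k * V s + (W (S / 2) - V (S / 2) - k * V (S / 2))) (𝓝[>] 0) atTop :=
      tendsto_atTop_add_const_right _ _ (htop.const_mul_atTop hk0)
    refine tendsto_atTop_mono' _ ?_ h1
    filter_upwards [Ioo_mem_nhdsGT (half_pos hS)] with s hs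
    have := hanti (a := s) ⟨hs.1, by linarith [hs.2]⟩ (b := S / 2) ⟨by linarith, by linarith⟩
      hs.2.le
    simp only at this
    linarith
  set H := (ν - 2) ^ 2 / 4 with hH
  -- By convexity g(W) - g(V) ≥ g₁(0)(W - V), so this expression bounds s f'(V(s)) once the Hardy
  -- bound is applied to W.
  have hsmall : ∀ᶠ s in 𝓝[>] 0, H * Real.exp (-(g₁ 0 * (W s - V s))) < 4 := by
    have h1 : Tendsto (fun s => H * Real.exp (-(g₁ 0 * (W s - V s)))) (𝓝[>] 0) (𝓝 (H * 0)) :=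
      (Real.tendsto_exp_neg_atTop_nhds_zero.comp (hDtop.const_mul_atTop hG0)).const_mul H
    rw [mul_zero] at h1
    exact h1.eventually (gt_mem_nhds (by norm_num))
  obtain ⟨r, hr0, hr⟩ := mem_nhdsGT_iff_exists_Ioo_subset.mp hsmall
  simp only [mem_Ioi] at hr0
  have hm : 0 < min r S := lt_min hr0 hS
  refine (hV.mono_right (min_le_right r S)).not_tendsto_atTop_of_potential_le hg hν hm ?_ htop
  intro s hs
  have hsS : s ∈ Ioo 0 S := ⟨hs.1, hs.2.trans_le (min_le_right _ _)⟩
  have h1 : H * Real.exp (-(g₁ 0 * (W s - V s))) < 4 := hr ⟨hs.1, hs.2.trans_le (min_le_left _ _)⟩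
  have h2 := hW.potential_le hg hν hsS
  have hVs := (hV.pos s hsS).le
  have h3 := hg.slope_zero_le hVs (hle s hsS)
  have h4 := hg.monotoneOn₁ hVs (hVs.trans (hle s hsS)) (hle s hsS)
  have h5 : Real.exp (g (V s)) ≤ Real.exp (g (W s)) * Real.exp (-(g₁ 0 * (W s - V s))) := by
    rw [← Real.exp_add]
    exact Real.exp_le_exp.mpr (by linarith)
  have hs0 := hs.1
  have hGW := hg.pos₁ _ (hVs.trans (hle s hsS))
  calc s * (g₁ (V s) * Real.exp (g (V s)))
      ≤ s * (g₁ (W s) * (Real.exp (g (W s)) * Real.exp (-(g₁ 0 * (W s - V s))))) := by gcongr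
    _ = s * (g₁ (W s) * Real.exp (g (W s))) * Real.exp (-(g₁ 0 * (W s - V s))) := by ring
    _ ≤ H * Real.exp (-(g₁ 0 * (W s - V s))) := by gcongr
    _ ≤ 4 := h1.le

end IsProfile

/-- The singular profile is unique. -/
lemma IsRegularFamily.singular_unique {g g₁ g₂ : ℝ → ℝ} {ν : ℝ} {S : ℝ → ℝ} {F F₁ : ℝ → ℝ → ℝ}
    (h : IsRegularFamily ν g S F F₁) (hg : IsConvexExponent g g₁ g₂)
    (hν : 10 ≤ ν) {T : ℝ} (hlimS : Tendsto S atTop (𝓝 T))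
    {V V₁ W W₁ : ℝ → ℝ} (hV : IsProfile ν g V V₁ T) (hT : 0 < T)
    (hVtop : Tendsto V (𝓝[>] 0) atTop) (hVT : Tendsto V (𝓝[<] T) (𝓝 0))
    (hVlim : ∀ s ∈ Ioo 0 T, Tendsto (fun n : ℕ => F (n + 1) s) atTop (𝓝 (V s)))
    {T' : ℝ} (hT' : 0 < T') (hW : IsProfile ν g W W₁ T') (hWtop : Tendsto W (𝓝[>] 0) atTop)
    (hWT : Tendsto W (𝓝[<] T') (𝓝 0)) : T' = T ∧ ∀ s ∈ Ioo 0 T, W s = V s := by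
  have hev : ∀ α, 0 < α → ∀ᶠ s in 𝓝[>] 0, F α s < W s := by
    intro α hα
    filter_upwards [(h.tendsto_zero hα).eventually (gt_mem_nhds (lt_add_one α)),
      hWtop.eventually (eventually_gt_atTop (α + 1))] with s h1 h2 using h1.trans h2
  have hS : ∀ α, 0 < α → S α < T' := fun α hα =>
    hW.end_lt (h.profile α hα) hg hν hT' (hev α hα) hWT (h.tendsto_end hα)
  have hTT' : T ≤ T' := le_of_tendsto hlimS (by
    filter_upwards [eventually_gt_atTop 0] with α hα using (hS α hα).le)
  have halim : Tendsto (fun n : ℕ => (n : ℝ) + 1) atTop atTop :=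
    tendsto_atTop_add_const_right _ _ tendsto_natCast_atTop_atTop
  have hle : ∀ s ∈ Ioo 0 T, V s ≤ W s := by
    intro s hs
    refine le_of_tendsto (hVlim s hs) ?_
    filter_upwards [(hlimS.comp halim).eventually (lt_mem_nhds hs.2)] with n hn
    have hn0 : (0 : ℝ) < n + 1 := by positivity
    exact ((hW.mono_right (hS _ hn0).le).lt_of_eventually_lt (h.profile _ hn0) hg hν
      (hev _ hn0) s ⟨hs.1, hn⟩).le
  have hW' := hW.mono_right hTT'
  have hanti := hW'.sub_antitoneOn hV hg hν hle
  -- W - V is nonincreasing, so a positive value at s is a lower bound for the gap on all of (0, s).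
  have heq : ∀ s ∈ Ioo 0 T, W s = V s := by
    intro s hs
    by_contra hne
    have hδ : 0 < W s - V s := sub_pos.mpr (lt_of_le_of_ne (hle s hs) (Ne.symm hne))
    refine (hW'.mono_right hs.2.le).not_tendsto_atTop_of_gap (hV.mono_right hs.2.le) hg hν hs.1
      hδ ?_ hVtop
    intro x hx
    have : W s - V s ≤ W x - V x := hanti ⟨hx.1, hx.2.trans hs.2⟩ hs hx.2.le
    linarith
  refine ⟨le_antisymm ?_ hTT', heq⟩
  by_contra! hlt
  have h1 : Tendsto W (𝓝[<] T) (𝓝 0) := hVT.congr' (by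
    filter_upwards [Ioo_mem_nhdsLT hT] with s hs using (heq s hs).symm)
  have h2 : Tendsto W (𝓝[<] T) (𝓝 (W T)) :=
    (hW.deriv T ⟨hT, hlt⟩).continuousAt.tendsto.mono_left nhdsWithin_le_nhds
  have h3 := tendsto_nhds_unique h1 h2
  exact absurd (hW.pos T ⟨hT, hlt⟩) (by rw [← h3]; exact lt_irrefl _)

/-! ### The Laplacian through second derivatives along lines -/

section LaplacianCalculus

open Laplacian InnerProductSpace
open scoped RealInnerProductSpace

variable {E : Type*} [NormedAddCommGroup E] [InnerProductSpace ℝ E]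

lemma hasDerivAt_line (x v : E) (t : ℝ) : HasDerivAt (fun t : ℝ => x + t • v) v t := by
  simpa using ((hasDerivAt_id t).smul_const v).const_add x

lemma ContDiffAt.deriv_line_eventuallyEq {u : E → ℝ} {x : E} (hu : ContDiffAt ℝ 2 u x) (v : E) :
    ∀ᶠ t in 𝓝 (0 : ℝ), HasDerivAt (fun t : ℝ => u (x + t • v)) (fderiv ℝ u (x + t • v) v) t := by
  have h1 : ∀ᶠ y in 𝓝 x, DifferentiableAt ℝ u y := by
    filter_upwards [hu.eventually (by simp)] with y hy using hy.differentiableAt (by simp)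
  have h2 : Tendsto (fun t : ℝ => x + t • v) (𝓝 0) (𝓝 x) := by
    have : Continuous fun t : ℝ => x + t • v := by fun_prop
    simpa using this.tendsto 0
  filter_upwards [h2.eventually h1] with t ht
  exact ht.hasFDerivAt.comp_hasDerivAt t (hasDerivAt_line x v t)

lemma ContDiffAt.deriv_deriv_line {u : E → ℝ} {x : E} (hu : ContDiffAt ℝ 2 u x) (v : E) :
    deriv (deriv fun t : ℝ => u (x + t • v)) 0 = fderiv ℝ (fderiv ℝ u) x v v := by
  have h1 : deriv (fun t : ℝ => u (x + t • v)) =ᶠ[𝓝 0] fun t => fderiv ℝ u (x + t • v) v := by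
    filter_upwards [hu.deriv_line_eventuallyEq v] with t ht using ht.deriv
  rw [h1.deriv_eq]
  have h2 : DifferentiableAt ℝ (fderiv ℝ u) x :=
    (hu.fderiv_right (m := 1) (by norm_num)).differentiableAt (by simp)
  have h3 : HasFDerivAt (fderiv ℝ u) (fderiv ℝ (fderiv ℝ u) x) (x + (0 : ℝ) • v) := by
    simpa using h2.hasFDerivAt
  have h4 : HasDerivAt (fun t : ℝ => fderiv ℝ u (x + t • v)) (fderiv ℝ (fderiv ℝ u) x v) 0 :=
    h3.comp_hasDerivAt (0 : ℝ) (hasDerivAt_line x v 0)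
  have h5 := h4.clm_apply (hasDerivAt_const (0 : ℝ) v)
  rw [h5.deriv]
  simp

variable [FiniteDimensional ℝ E]

lemma ContDiffAt.laplacian_eq_sum_line {ι : Type*} [Fintype ι] (b : OrthonormalBasis ι ℝ E)
    {u : E → ℝ} {x : E} (hu : ContDiffAt ℝ 2 u x) :
    Δ u x = ∑ i, deriv (deriv fun t : ℝ => u (x + t • b i)) 0 := by
  rw [laplacian_eq_iteratedFDeriv_orthonormalBasis u b]
  refine Finset.sum_congr rfl fun i _ => ?_
  rw [hu.deriv_deriv_line, iteratedFDeriv_two_apply]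
  simp

/-- The Laplacian is nonnegative at a local minimum. -/
lemma IsLocalMin.laplacian_nonneg {u : E → ℝ} {x : E} (hmin : IsLocalMin u x)
    (hu : ContDiffAt ℝ 2 u x) : 0 ≤ Δ u x := by
  rw [hu.laplacian_eq_sum_line (stdOrthonormalBasis ℝ E)]
  refine Finset.sum_nonneg fun i _ => ?_
  set v := stdOrthonormalBasis ℝ E i
  set φ : ℝ → ℝ := fun t => u (x + t • v) with hφ
  have hlim : Tendsto (fun t : ℝ => x + t • v) (𝓝 0) (𝓝 x) := by
    have : Continuous fun t : ℝ => x + t • v := by fun_prop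
    simpa using this.tendsto 0
  have hmin' : IsLocalMin φ 0 := by
    have := hlim.eventually hmin
    simpa [IsLocalMin, IsMinFilter, hφ] using this
  by_contra! hneg
  have hcont : ContinuousAt φ 0 := by
    have := (hu.deriv_line_eventuallyEq v).self_of_nhds
    exact this.continuousAt
  -- A point that is both a local minimum and a local maximum makes φ locally constant, so its
  -- second derivative vanishes.
  have hmax := isLocalMax_of_deriv_deriv_neg hneg hmin'.deriv_eq_zero hcont
  have hconst : φ =ᶠ[𝓝 0] fun _ => φ 0 := by
    filter_upwards [hmin', hmax] with t h1 h2 using le_antisymm h2 h1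
  have h1 : deriv φ =ᶠ[𝓝 0] fun _ => 0 := by
    filter_upwards [hconst.deriv] with t ht
    rw [ht]; simp
  rw [h1.deriv_eq] at hneg
  simp at hneg

/-- The Laplacian commutes with affine isometries. -/
lemma ContDiffAt.laplacian_comp_isometry {u : E → ℝ} (L : E ≃ₗᵢ[ℝ] E) (c x : E)
    (hu : ContDiffAt ℝ 2 u (L x + c)) : Δ (fun y => u (L y + c)) x = Δ u (L x + c) := by
  have hcomp : ContDiffAt ℝ 2 (fun y => u (L y + c)) x := by
    have h1 : ContDiff ℝ 2 fun y => L y + c := L.toContinuousLinearEquiv.contDiff.add contDiff_const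
    exact ContDiffAt.comp x (g := u) (f := fun y => L y + c) hu h1.contDiffAt
  rw [hcomp.laplacian_eq_sum_line (stdOrthonormalBasis ℝ E),
    hu.laplacian_eq_sum_line ((stdOrthonormalBasis ℝ E).map L)]
  refine Finset.sum_congr rfl fun i _ => ?_
  congr 2
  funext t
  simp only [map_add, map_smul, OrthonormalBasis.map_apply]
  congr 1
  abel

lemma ContDiffAt.deriv_of_two {F : ℝ → ℝ} {a : ℝ} (hF : ContDiffAt ℝ 2 F a) :
    ContDiffAt ℝ 1 (deriv F) a := by
  simpa using (hF.fderiv_right (m := 1) (by norm_num)).clm_apply (contDiffAt_const (c := (1 : ℝ)))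

/-- Along a line both ‖x‖² and a linear coordinate are polynomials of degree at most two, so this
covers both Laplacian formulas below. -/
lemma deriv_deriv_comp_quadratic {F : ℝ → ℝ} {a b c : ℝ} (hF : ContDiffAt ℝ 2 F a) :
    deriv (deriv fun t : ℝ => F (a + b * t + c * t ^ 2)) 0
      = deriv (deriv F) a * b ^ 2 + deriv F a * (2 * c) := by
  have hq : ∀ t : ℝ, HasDerivAt (fun t : ℝ => a + b * t + c * t ^ 2) (b + c * (2 * t)) t := by
    intro t
    have := (((hasDerivAt_id t).const_mul b).const_add a).add ((hasDerivAt_pow 2 t).const_mul c)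
    have h2 : b * 1 + c * ((2 : ℕ) * t ^ (2 - 1)) = b + c * (2 * t) := by norm_num
    exact h2 ▸ this
  have hlim : Tendsto (fun t : ℝ => a + b * t + c * t ^ 2) (𝓝 0) (𝓝 a) := by
    have : Continuous fun t : ℝ => a + b * t + c * t ^ 2 := by fun_prop
    simpa using this.tendsto 0
  have hd : ∀ᶠ y in 𝓝 a, DifferentiableAt ℝ F y := by
    filter_upwards [hF.eventually (by simp)] with y hy using hy.differentiableAt (by simp)
  have h1 : deriv (fun t : ℝ => F (a + b * t + c * t ^ 2))
      =ᶠ[𝓝 0] fun t => deriv F (a + b * t + c * t ^ 2) * (b + c * (2 * t)) := by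
    filter_upwards [hlim.eventually hd] with t ht
    exact (ht.hasDerivAt.comp t (hq t)).deriv
  rw [h1.deriv_eq]
  have h2 : DifferentiableAt ℝ (deriv F) a := hF.deriv_of_two.differentiableAt (by simp)
  have h3 : HasDerivAt (deriv F) (deriv (deriv F) a) (a + b * 0 + c * 0 ^ 2) := by
    simpa using h2.hasDerivAt
  have h4 : HasDerivAt (fun t : ℝ => b + c * (2 * t)) (c * 2) 0 := by
    have := (((hasDerivAt_id (0 : ℝ)).const_mul 2).const_mul c).const_add b
    have h2 : c * (2 * 1) = c * 2 := by ring
    exact h2 ▸ this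
  have h5 : HasDerivAt (fun t => deriv F (a + b * t + c * t ^ 2) * (b + c * (2 * t)))
      (deriv (deriv F) a * (b + c * (2 * 0)) * (b + c * (2 * 0))
        + deriv F (a + b * 0 + c * 0 ^ 2) * (c * 2)) 0 := by
    have h6 := h3.comp (0 : ℝ) (hq 0)
    exact h6.mul h4
  rw [h5.deriv]
  simp
  ring

/-- The Laplacian of a function of `‖x‖²`. -/
lemma laplacian_comp_norm_sq {F : ℝ → ℝ} {x : E} (hF : ContDiffAt ℝ 2 F (‖x‖ ^ 2)) :
    Δ (fun y : E => F (‖y‖ ^ 2)) x = 4 * ‖x‖ ^ 2 * deriv (deriv F) (‖x‖ ^ 2)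
      + 2 * Module.finrank ℝ E * deriv F (‖x‖ ^ 2) := by
  have hc : ContDiffAt ℝ 2 (fun y : E => F (‖y‖ ^ 2)) x :=
    ContDiffAt.comp x (g := F) (f := fun y : E => ‖y‖ ^ 2) hF (contDiff_norm_sq ℝ).contDiffAt
  set b := stdOrthonormalBasis ℝ E with hb
  rw [hc.laplacian_eq_sum_line b]
  have h1 : ∀ i, deriv (deriv fun t : ℝ => F (‖x + t • b i‖ ^ 2)) 0
      = deriv (deriv F) (‖x‖ ^ 2) * (2 * ⟪x, b i⟫) ^ 2 + deriv F (‖x‖ ^ 2) * (2 * 1) := by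
    intro i
    rw [← deriv_deriv_comp_quadratic hF]
    congr 2
    funext t
    congr 1
    rw [norm_add_sq_real, inner_smul_right, norm_smul, b.norm_eq_one, mul_one, Real.norm_eq_abs,
      sq_abs]
    ring
  rw [Finset.sum_congr rfl fun i _ => h1 i, Finset.sum_add_distrib, ← Finset.mul_sum]
  have h2 : ∑ i, (2 * ⟪x, b i⟫) ^ 2 = 4 * ‖x‖ ^ 2 := by
    rw [← b.sum_sq_norm_inner_left x, Finset.mul_sum]
    refine Finset.sum_congr rfl fun i _ => ?_
    rw [Real.norm_eq_abs, sq_abs]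
    ring
  rw [h2]
  simp
  ring

/-- The Laplacian of a function of one linear coordinate. -/
lemma laplacian_comp_inner {F : ℝ → ℝ} {x e : E} (he : ‖e‖ = 1)
    (hF : ContDiffAt ℝ 2 F ⟪x, e⟫) :
    Δ (fun y : E => F ⟪y, e⟫) x = deriv (deriv F) ⟪x, e⟫ := by
  have hc : ContDiffAt ℝ 2 (fun y : E => F ⟪y, e⟫) x :=
    ContDiffAt.comp x (g := F) (f := fun y : E => ⟪y, e⟫) hF
      (contDiff_id.inner ℝ contDiff_const).contDiffAt
  set b := stdOrthonormalBasis ℝ E with hb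
  rw [hc.laplacian_eq_sum_line b]
  have h1 : ∀ i, deriv (deriv fun t : ℝ => F ⟪x + t • b i, e⟫) 0
      = deriv (deriv F) ⟪x, e⟫ * ⟪b i, e⟫ ^ 2 + deriv F ⟪x, e⟫ * (2 * 0) := by
    intro i
    rw [← deriv_deriv_comp_quadratic hF]
    congr 2
    funext t
    congr 1
    rw [inner_add_left, real_inner_smul_left]
    ring
  rw [Finset.sum_congr rfl fun i _ => h1 i]
  simp only [mul_zero, add_zero]
  rw [← Finset.mul_sum]
  have h2 : ∑ i, ⟪b i, e⟫ ^ 2 = 1 := by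
    have := b.sum_sq_norm_inner_right e
    simpa [he] using this
  rw [h2, mul_one]

end LaplacianCalculus

/-! ### Strong minimum principle and hyperplane reflections -/

section MovingPlanes

open Laplacian InnerProductSpace
open scoped RealInnerProductSpace

variable {E : Type*} [NormedAddCommGroup E] [InnerProductSpace ℝ E] [FiniteDimensional ℝ E]

lemma deriv_deriv_zpow_sub_const (m : ℤ) (c s : ℝ) :
    deriv (fun s : ℝ => s ^ m - c) s = m * s ^ (m - 1) ∧
      deriv (deriv fun s : ℝ => s ^ m - c) s = m * ((m - 1 : ℤ) * s ^ (m - 2)) := by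
  have h1 : ∀ s : ℝ, deriv (fun s : ℝ => s ^ m - c) s = m * s ^ (m - 1) := by
    intro s
    rw [deriv_sub_const, deriv_zpow]
  refine ⟨h1 s, ?_⟩
  rw [funext h1, deriv_const_mul_field, deriv_zpow]
  congr 3
  ring

/-- A power of the distance to `y` is strictly subharmonic away from `y`. -/
lemma laplacian_zpow_dist_pos {x y : E} (hxy : x ≠ y) (c : ℝ) :
    ContDiffAt ℝ 2 (fun z : E => (‖z - y‖ ^ 2) ^ (-(Module.finrank ℝ E : ℤ)) - c) x ∧
    0 < Δ (fun z : E => (‖z - y‖ ^ 2) ^ (-(Module.finrank ℝ E : ℤ)) - c) x := by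
  set n := Module.finrank ℝ E with hn
  have hn0 : 0 < n := by
    rw [hn]
    have : Nontrivial E := ⟨x, y, hxy⟩
    exact Module.finrank_pos
  have hs : 0 < ‖x - y‖ ^ 2 := by
    have := norm_pos_iff.mpr (sub_ne_zero.mpr hxy)
    positivity
  set F : ℝ → ℝ := fun s => s ^ (-(n : ℤ)) - c with hF
  have hFc : ContDiffAt ℝ 2 F (‖x - y‖ ^ 2) := by
    have h1 : ContDiffAt ℝ 2 (fun s : ℝ => s ^ n) (‖x - y‖ ^ 2) := contDiffAt_id.pow n
    have h2 := (h1.inv (pow_ne_zero n hs.ne')).sub (contDiffAt_const (c := c))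
    refine h2.congr_of_eventuallyEq (Eventually.of_forall fun s => ?_)
    simp [hF, zpow_neg]
  have hcomp : ContDiffAt ℝ 2 (fun z : E => F (‖z‖ ^ 2)) (x - y) :=
    ContDiffAt.comp (x - y) (g := F) (f := fun z : E => ‖z‖ ^ 2) hFc
      (contDiff_norm_sq ℝ).contDiffAt
  refine ⟨ContDiffAt.comp x (g := fun z : E => F (‖z‖ ^ 2)) (f := fun z : E => z - y) hcomp
    (contDiff_id.sub contDiff_const).contDiffAt, ?_⟩
  have h1 := ContDiffAt.laplacian_comp_isometry (u := fun z : E => F (‖z‖ ^ 2))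
    (LinearIsometryEquiv.refl ℝ E) (-y) x (by simpa [sub_eq_add_neg] using hcomp)
  simp only [LinearIsometryEquiv.coe_refl, id, ← sub_eq_add_neg] at h1
  change 0 < Δ (fun z : E => F (‖z - y‖ ^ 2)) x
  rw [h1, laplacian_comp_norm_sq hFc, (deriv_deriv_zpow_sub_const _ c _).1,
    (deriv_deriv_zpow_sub_const _ c _).2]
  set s := ‖x - y‖ ^ 2
  have h2 : s ^ (-(n : ℤ) - 1) = s * s ^ (-(n : ℤ) - 2) := by
    rw [← zpow_one_add₀ hs.ne']
    congr 1
    ring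
  have h3 : 0 < s ^ (-(n : ℤ) - 2) := zpow_pos hs _
  rw [h2]
  push_cast
  have hn1 : (0 : ℝ) < n := by exact_mod_cast hn0
  -- The Laplacian equals this product, because 4n(n+1) - 2n² = n(2n+4).
  have : 0 < s * s ^ (-(n : ℤ) - 2) * n * (2 * n + 4) := by positivity
  rw [← hn]
  nlinarith

/-- Strong minimum principle on a ball. -/
lemma pos_of_superharmonic_of_center_pos {w : E → ℝ} {y : E} {R : ℝ}
    (hw : ∀ x ∈ Metric.ball y R, ContDiffAt ℝ 2 w x) (hnn : ∀ x ∈ Metric.ball y R, 0 ≤ w x)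
    (hsup : ∀ x ∈ Metric.ball y R, Δ w x ≤ 0) (hy : 0 < w y) :
    ∀ x ∈ Metric.ball y R, 0 < w x := by
  intro x₀ hx₀
  by_contra! hle
  have hx₀y : x₀ ≠ y := by
    rintro rfl
    linarith
  have hR : 0 < R := dist_nonneg.trans_lt (Metric.mem_ball.mp hx₀)
  set r₀ := ‖x₀ - y‖ with hr₀
  have hr₀0 : 0 < r₀ := norm_pos_iff.mpr (sub_ne_zero.mpr hx₀y)
  have hr₀R : r₀ < R := by rwa [Metric.mem_ball, dist_eq_norm] at hx₀
  obtain ⟨R', hR'1, hR'2⟩ := exists_between hr₀R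
  have hcy : ContinuousAt w y := (hw y (Metric.mem_ball_self hR)).continuousAt
  obtain ⟨ρ', hρ'0, hρ'⟩ := Metric.eventually_nhds_iff.mp
    (hcy.eventually (lt_mem_nhds (half_lt_self hy)))
  set ρ := min (ρ' / 2) (r₀ / 2) with hρ
  have hρ0 : 0 < ρ := lt_min (by linarith) (by linarith)
  have hρr : ρ < r₀ := (min_le_right _ _).trans_lt (by linarith)
  have hρρ' : ρ < ρ' := (min_le_left _ _).trans_lt (by linarith)
  set m : ℤ := -(Module.finrank ℝ E : ℤ) with hm
  have hn0 : 0 < Module.finrank ℝ E := by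
    have : Nontrivial E := ⟨x₀, y, hx₀y⟩
    exact Module.finrank_pos
  set ψ : E → ℝ := fun z => (‖z - y‖ ^ 2) ^ m - (R' ^ 2) ^ m with hψ
  have hanti : ∀ a b : ℝ, 0 < a → a < b → (b ^ 2) ^ m < (a ^ 2) ^ m := by
    intro a b ha hab
    rw [hm, zpow_neg, zpow_neg, zpow_natCast, zpow_natCast]
    have h1 : a ^ 2 < b ^ 2 := by gcongr
    have h2 : (a ^ 2) ^ Module.finrank ℝ E < (b ^ 2) ^ Module.finrank ℝ E :=
      pow_lt_pow_left₀ h1 (by positivity) hn0.ne'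
    exact inv_strictAnti₀ (by positivity) h2
  set D := (ρ ^ 2) ^ m - (R' ^ 2) ^ m with hD
  have hD0 : 0 < D := sub_pos.mpr (hanti ρ R' hρ0 (hρr.trans hR'1))
  -- On the inner sphere εψ = w(y)/2 < w, and on the outer sphere ψ = 0 ≤ w. If w(x₀) ≤ 0, then w -
  -- εψ has a negative minimum inside the annulus, where its Laplacian is negative.
  set ε := w y / 2 / D with hε
  have hε0 : 0 < ε := by positivity
  set A : Set E := {z | ρ ≤ ‖z - y‖ ∧ ‖z - y‖ ≤ R'} with hA
  have hnormc : Continuous fun z : E => ‖z - y‖ := by fun_prop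
  have hAc : IsCompact A := by
    refine Metric.isCompact_of_isClosed_isBounded ?_ ?_
    · exact (isClosed_le continuous_const hnormc).inter (isClosed_le hnormc continuous_const)
    · refine Metric.isBounded_closedBall (x := y) (r := R') |>.subset fun z hz => ?_
      rw [Metric.mem_closedBall, dist_eq_norm]
      exact hz.2
  have hAball : ∀ z ∈ A, z ∈ Metric.ball y R := fun z hz => by
    rw [Metric.mem_ball, dist_eq_norm]
    exact hz.2.trans_lt hR'2
  have hAne : ∀ z ∈ A, z ≠ y := fun z hz h => by
    have := hz.1
    rw [h, sub_self, norm_zero] at this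
    linarith
  have hψC : ∀ z ∈ A, ContDiffAt ℝ 2 ψ z := fun z hz => (laplacian_zpow_dist_pos (hAne z hz) _).1
  have hx₀A : x₀ ∈ A := ⟨hρr.le, hR'1.le⟩
  obtain ⟨z, hzA, hz⟩ := hAc.exists_isMinOn ⟨x₀, hx₀A⟩ (f := fun z => w z - ε * ψ z)
    (fun z hz => ((hw z (hAball z hz)).continuousAt.sub
      (continuousAt_const.mul (hψC z hz).continuousAt)).continuousWithinAt)
  have hψx₀ : 0 < ψ x₀ := sub_pos.mpr (hanti r₀ R' hr₀0 hR'1)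
  have hzneg : w z - ε * ψ z < 0 := by
    have h1 : w z - ε * ψ z ≤ w x₀ - ε * ψ x₀ := hz hx₀A
    have h2 := mul_pos hε0 hψx₀
    linarith
  have hz1 : ρ < ‖z - y‖ := by
    refine lt_of_le_of_ne hzA.1 fun h => ?_
    have h1 : w y / 2 < w z := hρ' (by rw [dist_eq_norm, ← h]; exact hρρ')
    have h2 : ε * ψ z = w y / 2 := by
      simp only [hψ]
      rw [← h, ← hD, hε, div_mul_cancel₀ _ hD0.ne']
    linarith
  have hz2 : ‖z - y‖ < R' := by
    refine lt_of_le_of_ne hzA.2 fun h => ?_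
    have h1 := hnn z (hAball z hzA)
    have h2 : ψ z = 0 := by
      simp only [hψ]
      rw [h, sub_self]
    rw [h2] at hzneg
    linarith
  have hloc : IsLocalMin (fun z => w z - ε * ψ z) z := by
    have : A ∈ 𝓝 z := by
      filter_upwards [(isOpen_lt continuous_const hnormc).mem_nhds hz1,
        (isOpen_lt hnormc continuous_const).mem_nhds hz2] with x h1 h2
      exact ⟨le_of_lt h1, le_of_lt h2⟩
    exact hz.isLocalMin this
  have hwz := hw z (hAball z hzA)
  have hεψ : ContDiffAt ℝ 2 (ε • ψ) z := contDiffAt_const.smul (hψC z hzA)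
  have hlap := hloc.laplacian_nonneg (hwz.sub hεψ)
  have hlap2 : Δ (fun z => w z - ε * ψ z) z = Δ w z - ε * Δ ψ z := by
    have h1 := hwz.laplacian_sub hεψ
    rw [laplacian_smul ε (hψC z hzA)] at h1
    exact h1
  rw [hlap2] at hlap
  have h1 := hsup z (hAball z hzA)
  have h2 := mul_pos hε0 (laplacian_zpow_dist_pos (hAne z hzA) ((R' ^ 2) ^ m)).2
  linarith

/-- Strong minimum principle on a convex open set. -/
lemma pos_of_superharmonic_of_convex {w : E → ℝ} {Ω : Set E} (hΩ : IsOpen Ω) (hconv : Convex ℝ Ω)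
    (hw : ∀ x ∈ Ω, ContDiffAt ℝ 2 w x) (hnn : ∀ x ∈ Ω, 0 ≤ w x)
    (hsup : ∀ x ∈ Ω, Δ w x ≤ 0) {y : E} (hyΩ : y ∈ Ω) (hy : 0 < w y) : ∀ x ∈ Ω, 0 < w x := by
  set P := {x ∈ Ω | 0 < w x} with hP
  have hPo : IsOpen P := by
    rw [isOpen_iff_mem_nhds]
    intro x hx
    filter_upwards [hΩ.mem_nhds hx.1, (hw x hx.1).continuousAt.eventually (lt_mem_nhds hx.2)]
      with z h1 h2 using ⟨h1, h2⟩
  have hsub : Ω ⊆ P := by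
    refine hconv.isPreconnected.subset_of_closure_inter_subset hPo ⟨y, hyΩ, hyΩ, hy⟩ ?_
    rintro x ⟨hxcl, hxΩ⟩
    obtain ⟨R, hR0, hR⟩ := Metric.isOpen_iff.mp hΩ x hxΩ
    obtain ⟨z, hzP, hz⟩ := Metric.mem_closure_iff.mp hxcl (R / 2) (by linarith)
    have hball : Metric.ball z (R / 2) ⊆ Ω := by
      intro v hv
      apply hR
      rw [Metric.mem_ball] at hv ⊢
      have := dist_triangle v z x
      rw [dist_comm z x] at this
      linarith
    exact ⟨hxΩ, pos_of_superharmonic_of_center_pos (fun v hv => hw v (hball hv))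
      (fun v hv => hnn v (hball hv)) (fun v hv => hsup v (hball hv)) hzP.2 x hz⟩
  exact fun x hx => (hsub hx).2

/-- Reflection in the hyperplane `⟪x, e⟫ = μ`, for a unit vector `e`. -/
noncomputable def planeReflection (e : E) (μ : ℝ) (x : E) : E := x - (2 * (⟪x, e⟫ - μ)) • e

omit [FiniteDimensional ℝ E] in
lemma planeReflection_eq {e : E} (he : ‖e‖ = 1) (μ : ℝ) (x : E) :
    planeReflection e μ x = (ℝ ∙ e)ᗮ.reflection x + (2 * μ) • e := by
  rw [Submodule.reflection_orthogonal_apply, Submodule.reflection_singleton_apply, planeReflection,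
    he, real_inner_comm]
  simp only [RCLike.ofReal_real_eq_id, id, one_pow, div_one, two_smul, mul_sub, sub_smul, two_mul,
    add_smul]
  abel

omit [FiniteDimensional ℝ E] in
lemma norm_planeReflection_sq {e : E} (he : ‖e‖ = 1) (μ : ℝ) (x : E) :
    ‖planeReflection e μ x‖ ^ 2 = ‖x‖ ^ 2 - 4 * μ * (⟪x, e⟫ - μ) := by
  rw [planeReflection, norm_sub_sq_real, inner_smul_right, norm_smul, he, mul_one,
    Real.norm_eq_abs, sq_abs]
  ring

omit [FiniteDimensional ℝ E] in
lemma norm_planeReflection_le {e : E} (he : ‖e‖ = 1) {μ : ℝ} (hμ : 0 ≤ μ) {x : E}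
    (hx : μ ≤ ⟪x, e⟫) : ‖planeReflection e μ x‖ ≤ ‖x‖ := by
  have h1 := norm_planeReflection_sq he μ x
  have h2 : 0 ≤ 4 * μ * (⟪x, e⟫ - μ) := mul_nonneg (by linarith) (by linarith)
  exact le_of_sq_le_sq (by linarith) (norm_nonneg _)

end MovingPlanes

/-! ### A barrier for narrow regions of a cap -/

section MovingPlanes

open Laplacian InnerProductSpace
open scoped RealInnerProductSpace

variable {E : Type*} [NormedAddCommGroup E] [InnerProductSpace ℝ E]

lemma abs_inner_unit_le {e : E} (he : ‖e‖ = 1) (x : E) : |⟪x, e⟫| ≤ ‖x‖ := by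
  simpa [he] using abs_real_inner_le_norm x e

lemma continuous_planeReflection (e : E) (μ : ℝ) : Continuous (planeReflection e μ) := by
  unfold planeReflection
  fun_prop

lemma planeReflection_of_inner_eq {e : E} {μ : ℝ} {x : E} (h : ⟪x, e⟫ = μ) :
    planeReflection e μ x = x := by
  simp [planeReflection, h]

lemma dist_planeReflection {e : E} (he : ‖e‖ = 1) (μ μ' : ℝ) (x : E) :
    dist (planeReflection e μ x) (planeReflection e μ' x) = 2 * |μ - μ'| := by
  have h1 : planeReflection e μ x - planeReflection e μ' x = (2 * (μ - μ')) • e := by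
    simp only [planeReflection]
    rw [sub_sub_sub_cancel_left, ← sub_smul]
    congr 1
    ring
  rw [dist_eq_norm, h1, norm_smul, he, mul_one, Real.norm_eq_abs, abs_mul, abs_two]

/-- The barrier used near the boundary of the cap `⟪x, e⟫ > μ` of the unit ball. -/
noncomputable def capBarrier (e : E) (μ : ℝ) (q : ℕ) (x : E) : ℝ :=
  3 - (‖x‖ ^ 2) ^ q - (1 + μ - ⟪x, e⟫) ^ (2 * q)

variable [FiniteDimensional ℝ E]

/-- The barrier stays between 1 and 3 on the cap, while one of the two powers is close to 1 near the
sphere or near the plane. There -Δ of the barrier is of order q and beats any given Lipschitz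
constant. -/
lemma laplacian_capBarrier [Nontrivial E] {e : E} (he : ‖e‖ = 1) {μ : ℝ} {q : ℕ} (hq : 2 ≤ q)
    (x : E) (hx : ⟪x, e⟫ ≤ 1 + μ) :
    ContDiffAt ℝ 2 (capBarrier e μ q) x ∧
    Δ (capBarrier e μ q) x
      ≤ -(2 * q * (‖x‖ ^ 2) ^ (q - 1) + 2 * q * (1 + μ - ⟪x, e⟫) ^ (2 * q - 2)) := by
  set F : ℝ → ℝ := fun s => s ^ q with hF
  set G : ℝ → ℝ := fun s => (1 + μ - s) ^ (2 * q) with hG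
  have hFc : ContDiff ℝ 2 F := contDiff_id.pow q
  have hGc : ContDiff ℝ 2 G := (contDiff_const.sub contDiff_id).pow (2 * q)
  have hF1 : deriv F = fun s : ℝ => (q : ℝ) * s ^ (q - 1) := by
    funext s; simp [hF]
  have hF2 : ∀ s, deriv (deriv F) s = q * ((q - 1 : ℕ) * s ^ (q - 2)) := by
    intro s
    rw [hF1, deriv_const_mul_field]
    simp [Nat.sub_sub]
  have hG1 : deriv G = fun s : ℝ => -((2 * q : ℕ) * (1 + μ - s) ^ (2 * q - 1)) := by
    funext s
    have h1 : HasDerivAt (fun s : ℝ => 1 + μ - s) (-1) s := (hasDerivAt_id s).const_sub (1 + μ)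
    have h2 := (h1.pow (2 * q)).deriv
    simp only [hG]
    refine h2.trans ?_
    ring
  have hG2 : ∀ s, deriv (deriv G) s
      = (2 * q : ℕ) * ((2 * q - 1 : ℕ) * (1 + μ - s) ^ (2 * q - 2)) := by
    intro s
    have h1 : HasDerivAt (fun s : ℝ => 1 + μ - s) (-1) s := (hasDerivAt_id s).const_sub (1 + μ)
    have h2 := (((h1.pow (2 * q - 1)).const_mul ((2 * q : ℕ) : ℝ)).neg).deriv
    rw [hG1]
    refine h2.trans ?_
    rw [Nat.sub_sub]
    ring
  have hFx : ContDiffAt ℝ 2 (fun y : E => F (‖y‖ ^ 2)) x :=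
    (hFc.comp (contDiff_norm_sq ℝ)).contDiffAt
  have hGx : ContDiffAt ℝ 2 (fun y : E => G ⟪y, e⟫) x :=
    (hGc.comp (contDiff_id.inner ℝ contDiff_const)).contDiffAt
  have h3F : ContDiffAt ℝ 2 ((fun _ : E => (3 : ℝ)) - fun y : E => F (‖y‖ ^ 2)) x :=
    contDiffAt_const.sub hFx
  refine ⟨h3F.sub hGx, ?_⟩
  have hlap : Δ (capBarrier e μ q) x
      = 0 - Δ (fun y : E => F (‖y‖ ^ 2)) x - Δ (fun y : E => G ⟪y, e⟫) x := by
    have h1 := h3F.laplacian_sub hGx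
    rw [contDiffAt_const.laplacian_sub hFx, laplacian_const] at h1
    exact h1
  rw [hlap, laplacian_comp_norm_sq hFc.contDiffAt, laplacian_comp_inner he hGc.contDiffAt, hF2,
    hG2, hF1]
  obtain ⟨p, rfl⟩ : ∃ p, q = p + 2 := ⟨q - 2, by omega⟩
  have hn : (0 : ℝ) < Module.finrank ℝ E := by exact_mod_cast Module.finrank_pos
  have e1 : p + 2 - 1 = p + 1 := by omega
  have e2 : p + 2 - 2 = p := by omega
  have e3 : 2 * (p + 2) - 1 = 2 * p + 3 := by omega
  have e4 : 2 * (p + 2) - 2 = 2 * p + 2 := by omega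
  rw [e1, e2, e3, e4]
  set s := ‖x‖ ^ 2 with hs
  have hs0 : 0 ≤ s := by positivity
  set τ := 1 + μ - ⟪x, e⟫ with hτ
  have hτ0 : 0 ≤ τ := by linarith
  have hsp : 0 ≤ s ^ (p + 1) := by positivity
  have hτp : 0 ≤ τ ^ (2 * p + 2) := by positivity
  have hp : (0 : ℝ) ≤ p := p.cast_nonneg
  push_cast
  have h1 : 4 * s * ((p + 2 : ℝ) * ((p + 1) * s ^ p)) = 4 * (p + 2) * (p + 1) * s ^ (p + 1) := by
    ring
  rw [h1]
  have h2 : 2 * (p + 2 : ℝ) * s ^ (p + 1) ≤ 4 * (p + 2) * (p + 1) * s ^ (p + 1) := by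
    refine mul_le_mul_of_nonneg_right ?_ hsp
    nlinarith
  have h3 : 2 * (p + 2 : ℝ) * τ ^ (2 * p + 2)
      ≤ 2 * (p + 2) * ((2 * p + 3) * τ ^ (2 * p + 2)) := by
    have : τ ^ (2 * p + 2) ≤ (2 * p + 3) * τ ^ (2 * p + 2) := by nlinarith
    gcongr
  have h4 : 0 ≤ 2 * (Module.finrank ℝ E : ℝ) * ((p + 2) * s ^ (p + 1)) := by positivity
  linarith

/-- Data of a positive solution of `Δu + f(u) = 0` in the unit ball vanishing on its boundary. -/
structure IsDirichletSolution (f : ℝ → ℝ) (u : E → ℝ) : Prop where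
  contDiffAt : ∀ x : E, ‖x‖ < 1 → ContDiffAt ℝ 2 u x
  continuousOn : ContinuousOn u (Metric.closedBall 0 1)
  equation : ∀ x : E, ‖x‖ < 1 → Δ u x + f (u x) = 0
  boundary : ∀ x : E, ‖x‖ = 1 → u x = 0
  pos : ∀ x : E, ‖x‖ < 1 → 0 < u x

namespace IsDirichletSolution

variable {f : ℝ → ℝ} {u : E → ℝ}

lemma nonneg (hu : IsDirichletSolution f u) {x : E} (hx : ‖x‖ ≤ 1) : 0 ≤ u x := by
  rcases hx.eq_or_lt with h | h
  · exact (hu.boundary x h).ge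
  · exact (hu.pos x h).le

lemma contDiffAt_sub_reflection (hu : IsDirichletSolution f u) {e : E} (he : ‖e‖ = 1) {μ : ℝ}
    (hμ : 0 ≤ μ) {x : E} (hx : ‖x‖ < 1) (hxe : μ ≤ ⟪x, e⟫) :
    ContDiffAt ℝ 2 (fun y => u (planeReflection e μ y) - u y) x ∧
      Δ (fun y => u (planeReflection e μ y) - u y) x
        = f (u x) - f (u (planeReflection e μ x)) := by
  have hρ : ‖planeReflection e μ x‖ < 1 := (norm_planeReflection_le he hμ hxe).trans_lt hx
  have h1 := hu.contDiffAt _ hρ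
  have h2 := hu.contDiffAt x hx
  rw [planeReflection_eq he] at h1
  have h3 := ContDiffAt.laplacian_comp_isometry (ℝ ∙ e)ᗮ.reflection ((2 * μ) • e) x h1
  have h4 : ContDiffAt ℝ 2 (fun y => u ((ℝ ∙ e)ᗮ.reflection y + (2 * μ) • e)) x := by
    have h5 : ContDiff ℝ 2 fun y => (ℝ ∙ e)ᗮ.reflection y + (2 * μ) • e :=
      (ℝ ∙ e)ᗮ.reflection.toContinuousLinearEquiv.contDiff.add contDiff_const
    exact ContDiffAt.comp x (g := u)
      (f := fun y => (ℝ ∙ e)ᗮ.reflection y + (2 * μ) • e) h1 h5.contDiffAt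
  simp only [← planeReflection_eq he] at h3 h4
  refine ⟨h4.sub h2, ?_⟩
  have h6 := h4.laplacian_sub h2
  have h7 := hu.equation x hx
  have h8 := hu.equation _ hρ
  rw [h3] at h6
  refine h6.trans ?_
  linarith

/-- If the reflected difference can be negative only near the boundary of the cap, it is
nonnegative on the whole cap. -/
lemma le_reflection_of_narrow [Nontrivial E] (hu : IsDirichletSolution f u) {C : ℝ} (hC : 0 ≤ C)
    (hLip : ∀ x y : E, ‖x‖ ≤ 1 → ‖y‖ ≤ 1 → u y ≤ u x → f (u x) - f (u y) ≤ C * (u x - u y))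
    {e : E} (he : ‖e‖ = 1) {μ : ℝ} (hμ : 0 ≤ μ) {q : ℕ} (hq : 2 ≤ q) (hqC : 3 * C < q)
    (hnarrow : ∀ x : E, ‖x‖ ≤ 1 → μ ≤ ⟪x, e⟫ → u (planeReflection e μ x) < u x →
      1 - 1 / (4 * q) < ‖x‖ ∨ ⟪x, e⟫ < μ + 1 / (4 * q)) :
    ∀ x : E, ‖x‖ ≤ 1 → μ ≤ ⟪x, e⟫ → u x ≤ u (planeReflection e μ x) := by
  intro x₁ hx₁ hx₁e
  by_contra! hneg
  set w : E → ℝ := fun y => u (planeReflection e μ y) - u y with hw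
  set h : E → ℝ := capBarrier e μ q with hh
  set Sμ : Set E := {x | ‖x‖ ≤ 1 ∧ μ ≤ ⟪x, e⟫} with hSμ
  have hinner : ∀ x : E, ‖x‖ ≤ 1 → ⟪x, e⟫ ≤ 1 := fun x hx =>
    (le_abs_self _).trans ((abs_inner_unit_le he x).trans hx)
  have hSc : IsCompact Sμ := by
    have : Sμ = Metric.closedBall 0 1 ∩ {x | μ ≤ ⟪x, e⟫} := by
      ext x; simp [hSμ]
    rw [this]
    exact (isCompact_closedBall 0 1).inter_right (isClosed_le continuous_const (by fun_prop))
  have hh1 : ∀ x ∈ Sμ, 1 ≤ h x ∧ h x ≤ 3 := by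
    intro x hx
    have h0 : 0 ≤ 1 + μ - ⟪x, e⟫ := by linarith [hinner x hx.1]
    have h1 : (‖x‖ ^ 2) ^ q ≤ 1 := pow_le_one₀ (by positivity)
      (pow_le_one₀ (norm_nonneg _) hx.1)
    have h2 : (1 + μ - ⟪x, e⟫) ^ (2 * q) ≤ 1 := pow_le_one₀ h0 (by linarith [hx.2])
    have h3 : 0 ≤ (‖x‖ ^ 2) ^ q := by positivity
    have h4 : 0 ≤ (1 + μ - ⟪x, e⟫) ^ (2 * q) := by positivity
    simp only [hh, capBarrier]
    constructor <;> linarith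
  have hcl : ∀ x, x ∈ Metric.closedBall (0 : E) 1 ↔ ‖x‖ ≤ 1 := fun x => by simp
  have hwc : ContinuousOn w Sμ := by
    refine ContinuousOn.sub (hu.continuousOn.comp
      (continuous_planeReflection e μ).continuousOn fun x hx => ?_)
      (hu.continuousOn.mono fun x hx => (hcl x).mpr hx.1)
    exact (hcl _).mpr ((norm_planeReflection_le he hμ hx.2).trans hx.1)
  have hhc : ContinuousOn h Sμ := by
    apply Continuous.continuousOn
    simp only [hh]
    unfold capBarrier
    fun_prop
  -- Minimizing w/h, with minimum -m < 0, makes w + mh nonnegative with an interior zero at x₀, so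
  -- its Laplacian there is nonnegative.
  obtain ⟨x₀, hx₀S, hx₀⟩ := hSc.exists_isMinOn ⟨x₁, hx₁, hx₁e⟩
    (hwc.div hhc fun x hx => (by linarith [(hh1 x hx).1] : h x ≠ 0))
  have hpos : ∀ x ∈ Sμ, 0 < h x := fun x hx => by linarith [(hh1 x hx).1]
  set m := -(w x₀ / h x₀) with hm
  have hm0 : 0 < m := by
    have h1 : w x₀ / h x₀ ≤ w x₁ / h x₁ := hx₀ (⟨hx₁, hx₁e⟩ : x₁ ∈ Sμ)
    have h2 : w x₁ / h x₁ < 0 := div_neg_of_neg_of_pos (by simp only [hw]; linarith)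
      (hpos x₁ ⟨hx₁, hx₁e⟩)
    linarith
  have hwx₀ : w x₀ = -(m * h x₀) := by
    rw [hm, neg_mul, neg_neg, div_mul_cancel₀ _ (hpos x₀ hx₀S).ne']
  have hwneg : w x₀ < 0 := by
    rw [hwx₀]
    linarith [mul_pos hm0 (hpos x₀ hx₀S)]
  have hge : ∀ x ∈ Sμ, 0 ≤ w x + m * h x := by
    intro x hx
    have h1 : w x₀ / h x₀ ≤ w x / h x := hx₀ hx
    have h2 : -m ≤ w x / h x := by rw [hm, neg_neg]; exact h1
    rw [le_div_iff₀ (hpos x hx)] at h2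
    linarith
  have hx₀1 : ‖x₀‖ < 1 := by
    refine lt_of_le_of_ne hx₀S.1 fun heq => ?_
    have h1 := hu.boundary x₀ heq
    have h2 := hu.nonneg ((norm_planeReflection_le he hμ hx₀S.2).trans hx₀S.1)
    simp only [hw] at hwneg
    linarith
  have hx₀e : μ < ⟪x₀, e⟫ := by
    refine lt_of_le_of_ne hx₀S.2 fun heq => ?_
    simp only [hw] at hwneg
    rw [planeReflection_of_inner_eq heq.symm] at hwneg
    linarith
  have hloc : IsLocalMin (fun x => w x + m * h x) x₀ := by
    have h1 : Sμ ∈ 𝓝 x₀ := by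
      filter_upwards [(isOpen_lt continuous_norm continuous_const).mem_nhds hx₀1,
        (isOpen_lt continuous_const (by fun_prop : Continuous fun x : E => ⟪x, e⟫)).mem_nhds hx₀e]
        with x h1 h2
      exact ⟨le_of_lt h1, le_of_lt h2⟩
    filter_upwards [h1] with x hx
    have := hge x hx
    rw [hwx₀]
    linarith
  obtain ⟨hwC, hwΔ⟩ := hu.contDiffAt_sub_reflection he hμ hx₀1 hx₀e.le
  obtain ⟨hhC, hhΔ⟩ := laplacian_capBarrier he (μ := μ) hq x₀ (by linarith [hinner x₀ hx₀S.1])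
  have hmh : ContDiffAt ℝ 2 (m • h) x₀ := contDiffAt_const.smul hhC
  have hlap := hloc.laplacian_nonneg (hwC.add hmh)
  have hlap2 : Δ (fun x => w x + m * h x) x₀ = Δ w x₀ + m * Δ h x₀ := by
    have h1 := hwC.laplacian_add hmh
    rw [laplacian_smul m hhC] at h1
    exact h1
  rw [hlap2, hwΔ] at hlap
  have hle : u (planeReflection e μ x₀) ≤ u x₀ := by
    simp only [hw] at hwneg
    linarith
  have h1 := hLip x₀ (planeReflection e μ x₀) hx₀S.1
    ((norm_planeReflection_le he hμ hx₀S.2).trans hx₀S.1) hle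
  have h2 : u x₀ - u (planeReflection e μ x₀) = m * h x₀ := by
    have : w x₀ = u (planeReflection e μ x₀) - u x₀ := rfl
    linarith
  rw [h2] at h1
  have hq0 : (0 : ℝ) < q := by
    have : (2 : ℝ) ≤ q := by exact_mod_cast hq
    linarith
  -- By Bernoulli's inequality the width 1/(4q) keeps one of the powers above 1/2, hence Δh ≤ -q at
  -- x₀. Then 0 ≤ m(3C - q) contradicts the choice of q.
  have hbern : (1 : ℝ) / 2 ≤ (1 - 1 / (4 * q)) ^ (2 * q - 2) := by
    have h3 : -2 ≤ -(1 / (4 * q) : ℝ) := by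
      have : (1 : ℝ) / (4 * q) ≤ 1 := by
        rw [div_le_one (by positivity)]
        have : (2 : ℝ) ≤ q := by exact_mod_cast hq
        linarith
      linarith
    have h4 := one_add_mul_le_pow h3 (2 * q - 2)
    have h5 : ((2 * q - 2 : ℕ) : ℝ) = 2 * q - 2 := by
      rw [Nat.cast_sub (by omega)]
      push_cast
      ring
    rw [h5] at h4
    rw [← sub_eq_add_neg] at h4
    refine le_trans ?_ h4
    have : (1 : ℝ) / (4 * q) * (2 * q) = 1 / 2 := by field_simp; norm_num
    have h6 : (0 : ℝ) ≤ 1 / (4 * q) := by positivity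
    nlinarith
  have hbase : (0 : ℝ) ≤ 1 - 1 / (4 * q) := by
    have : (1 : ℝ) / (4 * q) ≤ 1 := by
      rw [div_le_one (by positivity)]
      have : (2 : ℝ) ≤ q := by exact_mod_cast hq
      linarith
    linarith
  have h0 : 0 ≤ 1 + μ - ⟪x₀, e⟫ := by linarith [hinner x₀ hx₀S.1]
  have hstrip : (q : ℝ) ≤ 2 * q * (‖x₀‖ ^ 2) ^ (q - 1)
      + 2 * q * (1 + μ - ⟪x₀, e⟫) ^ (2 * q - 2) := by
    have h7 : 0 ≤ (‖x₀‖ ^ 2) ^ (q - 1) := by positivity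
    have h8 : 0 ≤ (1 + μ - ⟪x₀, e⟫) ^ (2 * q - 2) := by positivity
    rcases hnarrow x₀ hx₀S.1 hx₀S.2 (by simp only [hw] at hwneg; linarith) with hc | hc
    · have h9 : (1 - 1 / (4 * q) : ℝ) ^ (2 * q - 2) ≤ (‖x₀‖ ^ 2) ^ (q - 1) := by
        rw [← pow_mul, show 2 * (q - 1) = 2 * q - 2 by omega]
        gcongr
      nlinarith
    · have h9 : (1 - 1 / (4 * q) : ℝ) ^ (2 * q - 2) ≤ (1 + μ - ⟪x₀, e⟫) ^ (2 * q - 2) :=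
        pow_le_pow_left₀ hbase (by linarith) _
      nlinarith
  have h10 : Δ h x₀ ≤ -q := hhΔ.trans (by linarith)
  have h11 : C * (m * h x₀) ≤ C * (m * 3) := by
    gcongr
    exact (hh1 x₀ hx₀S).2
  have h12 : m * Δ h x₀ ≤ m * -q := by gcongr
  nlinarith

end IsDirichletSolution

end MovingPlanes

/-! ### The moving plane argument -/

section MovingPlanes

open Laplacian InnerProductSpace
open scoped RealInnerProductSpace

namespace IsDirichletSolution

variable {E : Type*} [NormedAddCommGroup E] [InnerProductSpace ℝ E] [FiniteDimensional ℝ E]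
  {f : ℝ → ℝ} {u : E → ℝ}

/-- Strict reflection inequality in the interior of a cap. -/
lemma lt_reflection (hu : IsDirichletSolution f u) (hf : MonotoneOn f (Ici 0))
    {e : E} (he : ‖e‖ = 1) {μ : ℝ} (hμ : 0 < μ)
    (hle : ∀ x : E, ‖x‖ ≤ 1 → μ ≤ ⟪x, e⟫ → u x ≤ u (planeReflection e μ x)) :
    ∀ x : E, ‖x‖ < 1 → μ < ⟪x, e⟫ → u x < u (planeReflection e μ x) := by
  intro x hx hxe
  have hμ1 : μ < 1 := hxe.trans ((le_abs_self _).trans_lt ((abs_inner_unit_le he x).trans_lt hx))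
  set w : E → ℝ := fun y => u (planeReflection e μ y) - u y with hw
  set Ω : Set E := {x | ‖x‖ < 1} ∩ {x | μ < ⟪x, e⟫} with hΩ
  have hΩo : IsOpen Ω := (isOpen_lt continuous_norm continuous_const).inter
    (isOpen_lt continuous_const (by fun_prop))
  have hΩconv : Convex ℝ Ω := by
    refine Convex.inter ?_ ?_
    · have : {x : E | ‖x‖ < 1} = Metric.ball 0 1 := by ext; simp
      rw [this]
      exact convex_ball 0 1
    · have : {x : E | μ < ⟪x, e⟫} = (innerₗ E e) ⁻¹' (Ioi μ) := by
        ext y; simp [real_inner_comm]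
      rw [this]
      exact (convex_Ioi μ).linear_preimage _
  have hnormρ : ∀ y : E, μ ≤ ⟪y, e⟫ → ‖planeReflection e μ y‖ ≤ ‖y‖ := fun y hy =>
    norm_planeReflection_le he hμ.le hy
  have hee : ⟪e, e⟫ = 1 := by rw [real_inner_self_eq_norm_sq, he]; norm_num
  -- At the pole e of the cap u vanishes while the reflected point is interior, so w(e) > 0;
  -- continuity along t e with t < 1 moves the point inside.
  obtain ⟨y, hyΩ, hy⟩ : ∃ y ∈ Ω, 0 < w y := by
    have hpath : Tendsto (fun t : ℝ => t • e) (𝓝[<] 1) (𝓝[Metric.closedBall 0 1 ∩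
        {x : E | μ ≤ ⟪x, e⟫}] e) := by
      refine tendsto_nhdsWithin_iff.mpr ⟨?_, ?_⟩
      · have : Continuous fun t : ℝ => t • e := by fun_prop
        have := this.tendsto 1
        rw [one_smul] at this
        exact this.mono_left nhdsWithin_le_nhds
      · filter_upwards [Ioo_mem_nhdsLT hμ1] with t ht
        refine ⟨?_, ?_⟩
        · rw [mem_closedBall_zero_iff, norm_smul, he, mul_one,
            Real.norm_of_nonneg (hμ.trans ht.1).le]
          exact ht.2.le
        · simp only [mem_ofPred_eq]
          rw [real_inner_smul_left, hee, mul_one]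
          exact ht.1.le
    have hwc : ContinuousWithinAt w (Metric.closedBall 0 1 ∩ {x : E | μ ≤ ⟪x, e⟫}) e := by
      have hc : ContinuousOn w (Metric.closedBall 0 1 ∩ {x : E | μ ≤ ⟪x, e⟫}) := by
        refine ContinuousOn.sub (hu.continuousOn.comp
          (continuous_planeReflection e μ).continuousOn fun z hz => ?_)
          (hu.continuousOn.mono inter_subset_left)
        rw [mem_closedBall_zero_iff]
        exact (hnormρ z hz.2).trans (mem_closedBall_zero_iff.mp hz.1)
      refine hc e ⟨by simp [he], ?_⟩
      simp only [mem_ofPred_eq, hee]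
      exact hμ1.le
    have hwe : 0 < w e := by
      have h1 := norm_planeReflection_sq he μ e
      rw [hee, he] at h1
      have h2 : ‖planeReflection e μ e‖ < 1 := by
        have h3 : 0 < 4 * μ * (1 - μ) := mul_pos (by linarith) (by linarith)
        nlinarith [norm_nonneg (planeReflection e μ e)]
      simp only [hw]
      rw [hu.boundary e he]
      linarith [hu.pos _ h2]
    obtain ⟨t, ht1, ht2⟩ := (((hwc.tendsto.comp hpath).eventually (lt_mem_nhds hwe)).and
      (Ioo_mem_nhdsLT hμ1)).exists
    refine ⟨t • e, ⟨?_, ?_⟩, ht1⟩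
    · simp only [mem_ofPred_eq]
      rw [norm_smul, he, mul_one, Real.norm_of_nonneg (hμ.trans ht2.1).le]
      exact ht2.2
    · simp only [mem_ofPred_eq]
      rw [real_inner_smul_left, hee, mul_one]
      exact ht2.1
  have key := pos_of_superharmonic_of_convex (w := w) hΩo hΩconv
    (fun z hz => (hu.contDiffAt_sub_reflection he hμ.le hz.1 (le_of_lt hz.2)).1)
    (fun z hz => sub_nonneg.mpr (hle z (le_of_lt hz.1) (le_of_lt hz.2)))
    (fun z hz => by
      rw [(hu.contDiffAt_sub_reflection he hμ.le hz.1 (le_of_lt hz.2)).2]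
      have hz1 : ‖z‖ ≤ 1 := le_of_lt hz.1
      exact sub_nonpos.mpr (hf (hu.nonneg hz1) (hu.nonneg ((hnormρ z (le_of_lt hz.2)).trans hz1))
        (hle z hz1 (le_of_lt hz.2)))) hyΩ hy x ⟨hx, hxe⟩
  simp only [hw] at key
  linarith

/-- The moving plane inequality. -/
lemma le_reflection [Nontrivial E] (hu : IsDirichletSolution f u) (hf : MonotoneOn f (Ici 0))
    {C : ℝ} (hC : 0 ≤ C)
    (hLip : ∀ x y : E, ‖x‖ ≤ 1 → ‖y‖ ≤ 1 → u y ≤ u x → f (u x) - f (u y) ≤ C * (u x - u y))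
    {e : E} (he : ‖e‖ = 1) : ∀ μ ∈ Icc (0 : ℝ) 1,
    ∀ x : E, ‖x‖ ≤ 1 → μ ≤ ⟪x, e⟫ → u x ≤ u (planeReflection e μ x) := by
  obtain ⟨q, hq2, hqC⟩ : ∃ q : ℕ, 2 ≤ q ∧ 3 * C < q := by
    obtain ⟨q, hq⟩ := exists_nat_gt (3 * C)
    refine ⟨q + 2, by omega, ?_⟩
    push_cast
    linarith
  have hq0 : (0 : ℝ) < q := by
    have : (2 : ℝ) ≤ q := by exact_mod_cast hq2
    linarith
  set ε : ℝ := 1 / (4 * q) with hε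
  have hε0 : 0 < ε := by positivity
  set A : Set ℝ := {μ | ∀ x : E, ‖x‖ ≤ 1 → μ ≤ ⟪x, e⟫ → u x ≤ u (planeReflection e μ x)} with hA
  have hinner : ∀ x : E, ⟪x, e⟫ ≤ ‖x‖ := fun x =>
    (le_abs_self _).trans (abs_inner_unit_le he x)
  have hclosed : IsClosed (A ∩ Icc 0 1) := by
    refine isClosed_of_closure_subset fun μ hμ => ?_
    have hμI : μ ∈ Icc (0 : ℝ) 1 := isClosed_Icc.closure_subset_iff.mpr inter_subset_right hμ
    refine ⟨fun x hx hxe => ?_, hμI⟩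
    rcases hxe.eq_or_lt with heq | hlt
    · rw [planeReflection_of_inner_eq heq.symm]
    obtain ⟨s, hsA, hs⟩ := mem_closure_iff_seq_limit.mp hμ
    have hρlim : Tendsto (fun n => planeReflection e (s n) x) atTop
        (𝓝[Metric.closedBall 0 1] (planeReflection e μ x)) := by
      refine tendsto_nhdsWithin_iff.mpr ⟨?_, ?_⟩
      · have : Continuous fun μ : ℝ => planeReflection e μ x := by
          unfold planeReflection
          fun_prop
        exact (this.tendsto μ).comp hs
      · filter_upwards [hs.eventually (gt_mem_nhds hlt)] with n hn
        rw [mem_closedBall_zero_iff]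
        exact (norm_planeReflection_le he (hsA n).2.1 (le_of_lt hn)).trans hx
    have hmem : planeReflection e μ x ∈ Metric.closedBall (0 : E) 1 := by
      rw [mem_closedBall_zero_iff]
      exact (norm_planeReflection_le he hμI.1 hxe).trans hx
    refine ge_of_tendsto ((hu.continuousOn _ hmem).tendsto.comp hρlim) ?_
    filter_upwards [hs.eventually (gt_mem_nhds hlt)] with n hn
    exact (hsA n).1 x hx (le_of_lt hn)
  have hone : (1 : ℝ) ∈ A := by
    intro x hx hxe
    rw [planeReflection_of_inner_eq (le_antisymm ((hinner x).trans hx) hxe)]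
  refine hclosed.Icc_subset_of_forall_exists_lt hone ?_
  rintro μ₀ ⟨hμ₀A, hμ₀⟩ y hy
  -- On this compact core the strict inequality has a margin δ and survives a small move of the
  -- plane; the rest of the cap is narrow, and `le_reflection_of_narrow` handles it.
  set K : Set E := {x | ‖x‖ ≤ 1 - ε ∧ μ₀ + ε / 2 ≤ ⟪x, e⟫} with hK
  have hin : Continuous fun x : E => ⟪x, e⟫ := by fun_prop
  have hKc : IsCompact K := by
    refine Metric.isCompact_of_isClosed_isBounded ?_ ?_
    · exact (isClosed_le continuous_norm continuous_const).inter
        (isClosed_le continuous_const hin)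
    · refine Metric.isBounded_closedBall (x := (0 : E)) (r := 1 - ε) |>.subset fun z hz => ?_
      rw [mem_closedBall_zero_iff]
      exact hz.1
  have hKpos : ∀ x ∈ K, u x < u (planeReflection e μ₀ x) := fun x hx =>
    hu.lt_reflection hf he hμ₀.1 hμ₀A x (by linarith [hx.1]) (by linarith [hx.2])
  obtain ⟨δ, hδ0, hδ⟩ : ∃ δ > 0, ∀ x ∈ K, δ ≤ u (planeReflection e μ₀ x) - u x := by
    rcases K.eq_empty_or_nonempty with hemp | hne
    · exact ⟨1, one_pos, by simp [hemp]⟩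
    have hc : ContinuousOn (fun x => u (planeReflection e μ₀ x) - u x) K := by
      refine ContinuousOn.sub (hu.continuousOn.comp
        (continuous_planeReflection e μ₀).continuousOn fun z hz => ?_)
        (hu.continuousOn.mono fun z hz => ?_)
      · rw [mem_closedBall_zero_iff]
        exact (norm_planeReflection_le he hμ₀.1.le (by linarith [hz.2])).trans (by linarith [hz.1])
      · rw [mem_closedBall_zero_iff]
        linarith [hz.1]
    obtain ⟨x, hxK, hx⟩ := hKc.exists_isMinOn hne hc
    exact ⟨_, sub_pos.mpr (hKpos x hxK), fun z hz => hx hz⟩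
  obtain ⟨η, hη0, hη⟩ := Metric.uniformContinuousOn_iff.mp
    ((isCompact_closedBall (0 : E) 1).uniformContinuousOn_of_continuous hu.continuousOn) δ hδ0
  -- A shift by at most c moves reflected points by at most η/2, and it keeps points at height at
  -- least ε above the new plane in K.
  set c := min (ε / 2) (η / 4) with hc
  have hc0 : 0 < c := lt_min (by linarith) (by linarith)
  set μ := max (max y 0) (μ₀ - c) with hμ
  have hμ0 : 0 ≤ μ := (le_max_right y 0).trans (le_max_left _ _)
  have hμlt : μ < μ₀ := max_lt (max_lt hy hμ₀.1) (by linarith)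
  have hμc : μ₀ - c ≤ μ := le_max_right _ _
  refine ⟨μ, ?_, (le_max_left y 0).trans (le_max_left _ _), hμlt⟩
  refine hu.le_reflection_of_narrow hC hLip he hμ0 hq2 hqC fun x hx hxe hlt => ?_
  by_contra! hcon
  have hxK : x ∈ K := ⟨hcon.1, by linarith [hcon.2, min_le_left (ε / 2) (η / 4)]⟩
  have h1 := hδ x hxK
  have h2 := hη (planeReflection e μ x)
    (mem_closedBall_zero_iff.mpr ((norm_planeReflection_le he hμ0 hxe).trans hx))
    (planeReflection e μ₀ x)
    (mem_closedBall_zero_iff.mpr ((norm_planeReflection_le he hμ₀.1.le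
      (by linarith [hxK.2])).trans hx)) (by
      rw [dist_planeReflection he, abs_of_neg (by linarith)]
      linarith [min_le_right (ε / 2) (η / 4)])
  rw [Real.dist_eq, abs_lt] at h2
  linarith [h2.1]

/-- Positive solutions of the Dirichlet problem in the ball are radial. -/
theorem radial (hu : IsDirichletSolution f u) (hf : MonotoneOn f (Ici 0))
    {C : ℝ} (hC : 0 ≤ C)
    (hLip : ∀ x y : E, ‖x‖ ≤ 1 → ‖y‖ ≤ 1 → u y ≤ u x → f (u x) - f (u y) ≤ C * (u x - u y)) :
    ∀ x y : E, ‖x‖ ≤ 1 → ‖x‖ = ‖y‖ → u x = u y := by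
  have key : ∀ x y : E, ‖x‖ ≤ 1 → ‖x‖ = ‖y‖ → u x ≤ u y := by
    intro x y hx hxy
    rcases eq_or_ne x y with rfl | hne
    · exact le_rfl
    have : Nontrivial E := ⟨x, y, hne⟩
    have hn : 0 < ‖x - y‖ := norm_pos_iff.mpr (sub_ne_zero.mpr hne)
    -- Points of equal norm are exchanged by the reflection in the plane through 0 orthogonal to x -
    -- y.
    set e : E := ‖x - y‖⁻¹ • (x - y) with he_def
    have he : ‖e‖ = 1 := by
      rw [he_def, norm_smul, norm_inv, norm_norm, inv_mul_cancel₀ hn.ne']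
    have h1 : ‖x - y‖ ^ 2 = 2 * ⟪x, x - y⟫ := by
      rw [norm_sub_sq_real, inner_sub_right, real_inner_self_eq_norm_sq, ← hxy]
      ring
    have h2 : ⟪x, e⟫ = ‖x - y‖ / 2 := by
      rw [he_def, inner_smul_right]
      field_simp
      linarith
    have h3 : planeReflection e 0 x = y := by
      rw [planeReflection, h2, sub_zero, mul_div_cancel₀ _ two_ne_zero, he_def, smul_smul,
        mul_inv_cancel₀ hn.ne', one_smul, sub_sub_cancel]
    have h4 := hu.le_reflection hf hC hLip he 0 ⟨le_rfl, zero_le_one⟩ x hx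
      (by rw [h2]; positivity)
    rwa [h3] at h4
  exact fun x y hx hxy => le_antisymm (key x y hx hxy) (key y x (hxy ▸ hx) hxy.symm)

end IsDirichletSolution

end MovingPlanes

/-! ### Hardy's inequality -/

section Hardy

open MeasureTheory InnerProductSpace
open scoped RealInnerProductSpace

variable {E : Type*} [NormedAddCommGroup E] [InnerProductSpace ℝ E] [FiniteDimensional ℝ E]
  [MeasurableSpace E] [BorelSpace E]

omit [MeasurableSpace E] [BorelSpace E] in
lemma norm_gradient_sq_eq_sum {ι : Type*} [Fintype ι] (b : OrthonormalBasis ι ℝ E) (φ : E → ℝ)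
    (x : E) : ‖gradient φ x‖ ^ 2 = ∑ i, (fderiv ℝ φ x (b i)) ^ 2 := by
  rw [← b.sum_sq_norm_inner_left (gradient φ x)]
  refine Finset.sum_congr rfl fun i _ => ?_
  rw [Real.norm_eq_abs, sq_abs, gradient, toDual_symm_apply]

/-- Regularized Hardy inequality. -/
lemma hardy_regularized {φ : E → ℝ} (hφ : ContDiff ℝ 1 φ) (hsupp : HasCompactSupport φ) {k : ℝ}
    (hk : 0 ≤ k) (hdim : (Module.finrank ℝ E : ℝ) = 2 * k + 2) {ε : ℝ} (hε : 0 < ε) :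
    k ^ 2 * ∫ x, φ x ^ 2 / (‖x‖ ^ 2 + ε) ≤ ∫ x, ‖gradient φ x‖ ^ 2 := by
  set b := stdOrthonormalBasis ℝ E with hb
  have hφc : Continuous φ := hφ.continuous
  have hden : ∀ x : E, 0 < ‖x‖ ^ 2 + ε := fun x => by positivity
  have hdenc : Continuous fun x : E => ‖x‖ ^ 2 + ε := by fun_prop
  have hdφ : ∀ i, Continuous fun x => fderiv ℝ φ x (b i) := fun i =>
    (hφ.continuous_fderiv (by simp)).clm_apply continuous_const
  have hint : ∀ p : E → ℝ, Continuous p → (∀ x, φ x = 0 → p x = 0) → Integrable p := by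
    intro p hp h0
    exact hp.integrable_of_hasCompactSupport (hsupp.mono fun x hx => by
      rw [Function.mem_support] at hx ⊢
      exact fun h => hx (h0 x h))
  have hdsupp : ∀ i, HasCompactSupport fun x => fderiv ℝ φ x (b i) := fun i =>
    hsupp.fderiv_apply ℝ (b i)
  set X : Fin (Module.finrank ℝ E) → E → ℝ := fun i x => ⟪x, b i⟫ / (‖x‖ ^ 2 + ε) with hX
  have hXc : ∀ i, Continuous (X i) := fun i =>
    Continuous.div (by fun_prop) hdenc fun x => (hden x).ne'
  set X' : Fin (Module.finrank ℝ E) → E → ℝ := fun i x =>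
    1 / (‖x‖ ^ 2 + ε) - 2 * ⟪x, b i⟫ ^ 2 / (‖x‖ ^ 2 + ε) ^ 2 with hX'
  have hX'c : ∀ i, Continuous (X' i) := fun i =>
    (Continuous.div (by fun_prop) hdenc fun x => (hden x).ne').sub
      (Continuous.div (by fun_prop) (hdenc.pow 2) fun x => (pow_pos (hden x) 2).ne')
  have hparts : ∀ i, ∫ x, φ x ^ 2 * X' i x
      = -∫ x, 2 * φ x * fderiv ℝ φ x (b i) * X i x := by
    intro i
    refine integral_bilinear_hasLineDerivAt_right_eq_neg_left_of_integrable
      (B := ContinuousLinearMap.mul ℝ ℝ) (v := b i) (f := fun x => φ x ^ 2) (g := X i)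
      (f' := fun x => 2 * φ x * fderiv ℝ φ x (b i)) (g' := X' i) ?_ ?_ ?_ ?_ ?_
    · refine hint _ ?_ fun x hx => by simp [hx]
      have := hdφ i
      have := hXc i
      simp only [ContinuousLinearMap.mul_apply']
      fun_prop
    · refine hint _ ?_ fun x hx => by simp [hx]
      have := hX'c i
      simp only [ContinuousLinearMap.mul_apply']
      fun_prop
    · refine hint _ ?_ fun x hx => by simp [hx]
      have := hXc i
      simp only [ContinuousLinearMap.mul_apply']
      fun_prop
    · intro x _
      have h1 : HasLineDerivAt ℝ φ (fderiv ℝ φ x (b i)) x (b i) :=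
        ((hφ.differentiable (by simp)) x).hasFDerivAt.hasLineDerivAt (b i)
      have h2 := HasDerivAt.pow h1 2
      simp only [zero_smul, add_zero] at h2
      have h3 : ((2 : ℕ) : ℝ) * φ x ^ (2 - 1) * fderiv ℝ φ x (b i)
          = 2 * φ x * fderiv ℝ φ x (b i) := by norm_num
      exact h3 ▸ h2
    · intro x _
      have hline : ∀ t : ℝ, X i (x + t • b i)
          = (⟪x, b i⟫ + t) / (‖x‖ ^ 2 + 2 * ⟪x, b i⟫ * t + t ^ 2 + ε) := by
        intro t
        simp only [hX]
        rw [inner_add_left, real_inner_smul_left, real_inner_self_eq_norm_sq, b.norm_eq_one,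
          norm_add_sq_real, inner_smul_right, norm_smul, b.norm_eq_one, Real.norm_eq_abs, mul_one,
          sq_abs]
        congr 1 <;> ring
      have hnum : HasDerivAt (fun t : ℝ => ⟪x, b i⟫ + t) 1 0 := (hasDerivAt_id 0).const_add _
      have hdn : HasDerivAt (fun t : ℝ => ‖x‖ ^ 2 + 2 * ⟪x, b i⟫ * t + t ^ 2 + ε)
          (2 * ⟪x, b i⟫) 0 := by
        have h1 := ((((hasDerivAt_id (0 : ℝ)).const_mul (2 * ⟪x, b i⟫)).const_add
          (‖x‖ ^ 2)).add (hasDerivAt_pow 2 (0 : ℝ))).add_const ε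
        have h2 : 2 * ⟪x, b i⟫ * 1 + ((2 : ℕ) : ℝ) * 0 ^ (2 - 1) = 2 * ⟪x, b i⟫ := by norm_num
        exact h1.congr_deriv h2
      have hq := hnum.div hdn (by simpa using (hden x).ne')
      have heq : (1 * (‖x‖ ^ 2 + 2 * ⟪x, b i⟫ * 0 + 0 ^ 2 + ε)
          - (⟪x, b i⟫ + 0) * (2 * ⟪x, b i⟫)) / (‖x‖ ^ 2 + 2 * ⟪x, b i⟫ * 0 + 0 ^ 2 + ε) ^ 2
          = X' i x := by
        have := (hden x).ne'
        simp only [hX', mul_zero, add_zero, one_mul, ne_eq, OfNat.ofNat_ne_zero,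
          not_false_eq_true, zero_pow]
        field_simp
      rw [HasLineDerivAt, funext hline]
      exact heq ▸ hq
  -- Expand |∇φ + kφX|² ≥ 0 with X = x/(|x|²+ε), adding and subtracting kφ² div X. The sum on the
  -- right is the divergence of φ²X and integrates to zero; the remainder, of order ε, has a
  -- favourable sign.
  have hpt : ∀ x, k ^ 2 * (φ x ^ 2 / (‖x‖ ^ 2 + ε)) ≤ ‖gradient φ x‖ ^ 2
      + k * ∑ i, (φ x ^ 2 * X' i x + 2 * φ x * fderiv ℝ φ x (b i) * X i x) := by
    intro x
    have hs : ∑ i, ⟪x, b i⟫ ^ 2 = ‖x‖ ^ 2 := by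
      rw [← b.sum_sq_norm_inner_left x]
      refine Finset.sum_congr rfl fun i _ => ?_
      rw [Real.norm_eq_abs, sq_abs]
    have hsq : 0 ≤ ∑ i, (fderiv ℝ φ x (b i) + k * X i x * φ x) ^ 2 :=
      Finset.sum_nonneg fun i _ => sq_nonneg _
    have hexp : ∑ i, (fderiv ℝ φ x (b i) + k * X i x * φ x) ^ 2
        = ‖gradient φ x‖ ^ 2 + k * ∑ i, 2 * φ x * fderiv ℝ φ x (b i) * X i x
          + k ^ 2 * φ x ^ 2 * (‖x‖ ^ 2 / (‖x‖ ^ 2 + ε) ^ 2) := by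
      have hs' : ‖x‖ ^ 2 / (‖x‖ ^ 2 + ε) ^ 2 = ∑ i, ⟪x, b i⟫ ^ 2 / (‖x‖ ^ 2 + ε) ^ 2 := by
        rw [← Finset.sum_div, hs]
      rw [norm_gradient_sq_eq_sum b, hs', Finset.mul_sum, Finset.mul_sum,
        ← Finset.sum_add_distrib, ← Finset.sum_add_distrib]
      refine Finset.sum_congr rfl fun i _ => ?_
      simp only [hX]
      generalize ‖x‖ ^ 2 + ε = D
      ring
    have hdiv : ∑ i, φ x ^ 2 * X' i x = φ x ^ 2 * ((2 * k + 2) / (‖x‖ ^ 2 + ε)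
        - 2 * ‖x‖ ^ 2 / (‖x‖ ^ 2 + ε) ^ 2) := by
      rw [← Finset.mul_sum]
      simp only [hX', Finset.sum_sub_distrib, ← Finset.sum_div, ← Finset.mul_sum, hs]
      simp [hdim]
    rw [Finset.sum_add_distrib, mul_add, hdiv]
    have hfin : k * (φ x ^ 2 * ((2 * k + 2) / (‖x‖ ^ 2 + ε)
        - 2 * ‖x‖ ^ 2 / (‖x‖ ^ 2 + ε) ^ 2)) - k ^ 2 * φ x ^ 2 * (‖x‖ ^ 2 / (‖x‖ ^ 2 + ε) ^ 2)
        - k ^ 2 * (φ x ^ 2 / (‖x‖ ^ 2 + ε))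
        = φ x ^ 2 * (k ^ 2 + 2 * k) * ε / (‖x‖ ^ 2 + ε) ^ 2 := by
      have := (hden x).ne'
      field_simp
      ring
    have hfin0 : 0 ≤ φ x ^ 2 * (k ^ 2 + 2 * k) * ε / (‖x‖ ^ 2 + ε) ^ 2 := by positivity
    linarith
  have hi1 : ∀ i, Integrable fun x => φ x ^ 2 * X' i x := fun i =>
    hint _ ((hφc.pow 2).mul (hX'c i)) fun x hx => by simp [hx]
  have hi2 : ∀ i, Integrable fun x => 2 * φ x * fderiv ℝ φ x (b i) * X i x := fun i =>
    hint _ (((continuous_const.mul hφc).mul (hdφ i)).mul (hXc i)) fun x hx => by simp [hx]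
  have hi12 : ∀ i, Integrable fun x =>
      φ x ^ 2 * X' i x + 2 * φ x * fderiv ℝ φ x (b i) * X i x := fun i => (hi1 i).add (hi2 i)
  have hi3 : Integrable fun x => ∑ i, (φ x ^ 2 * X' i x + 2 * φ x * fderiv ℝ φ x (b i) * X i x) :=
    integrable_finsetSum _ fun i _ => hi12 i
  have hzero : ∫ x, ∑ i, (φ x ^ 2 * X' i x + 2 * φ x * fderiv ℝ φ x (b i) * X i x) = 0 := by
    rw [integral_finsetSum _ fun i _ => hi12 i]
    refine Finset.sum_eq_zero fun i _ => ?_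
    rw [integral_add (hi1 i) (hi2 i), hparts i, neg_add_cancel]
  have hgrad : Integrable fun x => ‖gradient φ x‖ ^ 2 := by
    simp only [norm_gradient_sq_eq_sum b]
    refine integrable_finsetSum _ fun i _ => ?_
    refine ((hdφ i).pow 2).integrable_of_hasCompactSupport ((hdsupp i).mono fun x hx => ?_)
    rw [Function.mem_support] at hx ⊢
    exact fun h => hx (by simp [h])
  have hleft : Integrable fun x => k ^ 2 * (φ x ^ 2 / (‖x‖ ^ 2 + ε)) :=
    hint _ (continuous_const.mul ((hφc.pow 2).div hdenc fun x => (hden x).ne'))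
      fun x hx => by simp [hx]
  calc k ^ 2 * ∫ x, φ x ^ 2 / (‖x‖ ^ 2 + ε) = ∫ x, k ^ 2 * (φ x ^ 2 / (‖x‖ ^ 2 + ε)) :=
        (integral_const_mul _ _).symm
    _ ≤ ∫ x, (‖gradient φ x‖ ^ 2
      + k * ∑ i, (φ x ^ 2 * X' i x + 2 * φ x * fderiv ℝ φ x (b i) * X i x)) :=
        integral_mono hleft (hgrad.add (hi3.const_mul k)) hpt
    _ = ∫ x, ‖gradient φ x‖ ^ 2 := by
        rw [integral_add hgrad (hi3.const_mul k), integral_const_mul, hzero, mul_zero, add_zero]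

omit [MeasurableSpace E] [BorelSpace E] [FiniteDimensional ℝ E] in
lemma continuous_gradient_of_contDiff [CompleteSpace E] {φ : E → ℝ} (hφ : ContDiff ℝ 1 φ) :
    Continuous (gradient φ) := by
  have := (toDual ℝ E).symm.continuous.comp (hφ.continuous_fderiv (by simp))
  exact this

/-- Hardy inequality, with the integrability of the left-hand side. -/
theorem hardy_inequality {φ : E → ℝ} (hφ : ContDiff ℝ 1 φ) (hsupp : HasCompactSupport φ) {k : ℝ}
    (hk : 0 < k) (hdim : (Module.finrank ℝ E : ℝ) = 2 * k + 2) :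
    Integrable (fun x => φ x ^ 2 / ‖x‖ ^ 2) ∧
      k ^ 2 * ∫ x, φ x ^ 2 / ‖x‖ ^ 2 ≤ ∫ x, ‖gradient φ x‖ ^ 2 := by
  set I := ∫ x, ‖gradient φ x‖ ^ 2 with hI
  have hI0 : 0 ≤ I := integral_nonneg fun x => by positivity
  have hφc := hφ.continuous
  have hmeas : Measurable fun x : E => φ x ^ 2 / ‖x‖ ^ 2 :=
    (hφc.pow 2).measurable.div (continuous_norm.pow 2).measurable
  have hreg : ∀ n : ℕ, ∫⁻ x, ENNReal.ofReal (φ x ^ 2 / (‖x‖ ^ 2 + 1 / (n + 1)))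
      ≤ ENNReal.ofReal (I / k ^ 2) := by
    intro n
    have hn : (0 : ℝ) < 1 / (n + 1) := by positivity
    have h1 := hardy_regularized hφ hsupp hk.le hdim hn
    have hint : Integrable fun x => φ x ^ 2 / (‖x‖ ^ 2 + 1 / ((n : ℝ) + 1)) := by
      refine Continuous.integrable_of_hasCompactSupport
        ((hφc.pow 2).div (by fun_prop) fun x => by positivity) (hsupp.mono fun x hx => ?_)
      rw [Function.mem_support] at hx ⊢
      exact fun h => hx (by simp [h])
    rw [← ofReal_integral_eq_lintegral_ofReal hint (Eventually.of_forall fun x => by positivity)]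
    refine ENNReal.ofReal_le_ofReal ?_
    rw [le_div_iff₀ (by positivity)]
    linarith
  have hfatou : ∫⁻ x, ENNReal.ofReal (φ x ^ 2 / ‖x‖ ^ 2) ≤ ENNReal.ofReal (I / k ^ 2) := by
    have hlim : Tendsto (fun n : ℕ => (1 : ℝ) / (n + 1)) atTop (𝓝 0) :=
      tendsto_one_div_add_atTop_nhds_zero_nat
    calc ∫⁻ x, ENNReal.ofReal (φ x ^ 2 / ‖x‖ ^ 2)
        ≤ ∫⁻ x, liminf (fun n : ℕ => ENNReal.ofReal (φ x ^ 2 / (‖x‖ ^ 2 + 1 / (n + 1)))) atTop := by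
          refine lintegral_mono fun x => ?_
          -- At the origin the quotient is 0 by the convention for division by zero, so the
          -- inequality is trivial there.
          rcases eq_or_ne x 0 with rfl | hx
          · simp
          have hx0 : 0 < ‖x‖ := norm_pos_iff.mpr hx
          have h1 : Tendsto (fun n : ℕ => φ x ^ 2 / (‖x‖ ^ 2 + 1 / ((n : ℝ) + 1))) atTop
              (𝓝 (φ x ^ 2 / ‖x‖ ^ 2)) := by
            have h2 : Tendsto (fun n : ℕ => ‖x‖ ^ 2 + 1 / ((n : ℝ) + 1)) atTop (𝓝 (‖x‖ ^ 2 + 0)) :=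
              hlim.const_add _
            rw [add_zero] at h2
            exact tendsto_const_nhds.div h2 (by positivity)
          exact (ENNReal.tendsto_ofReal h1).liminf_eq.ge
      _ ≤ liminf (fun n : ℕ => ∫⁻ x, ENNReal.ofReal (φ x ^ 2 / (‖x‖ ^ 2 + 1 / (n + 1)))) atTop := by
          refine lintegral_liminf_le fun n => ?_
          exact ((hφc.pow 2).measurable.div
            (by fun_prop : Measurable fun x : E => ‖x‖ ^ 2 + 1 / ((n : ℝ) + 1))).ennreal_ofReal
      _ ≤ liminf (fun _ : ℕ => ENNReal.ofReal (I / k ^ 2)) atTop :=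
          liminf_le_liminf (Eventually.of_forall hreg)
      _ = ENNReal.ofReal (I / k ^ 2) := liminf_const _
  have hint : Integrable fun x => φ x ^ 2 / ‖x‖ ^ 2 := by
    refine ⟨hmeas.aestronglyMeasurable, ?_⟩
    rw [hasFiniteIntegral_iff_ofReal (Eventually.of_forall fun x => by positivity)]
    exact hfatou.trans_lt ENNReal.ofReal_lt_top
  refine ⟨hint, ?_⟩
  rw [← ofReal_integral_eq_lintegral_ofReal hint (Eventually.of_forall fun x => by positivity),
    ENNReal.ofReal_le_ofReal_iff (by positivity), le_div_iff₀ (by positivity)] at hfatou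
  linarith

end Hardy

/-! ### The radial Laplacian in the variable s = λ|x|² -/

section RadialEquation

open Laplacian InnerProductSpace

lemma contDiffOn_two_of_hasDerivAt {F F₁ F₂ : ℝ → ℝ} {s : Set ℝ} (hs : IsOpen s)
    (h₁ : ∀ x ∈ s, HasDerivAt F (F₁ x) x) (h₂ : ∀ x ∈ s, HasDerivAt F₁ (F₂ x) x)
    (hc : ContinuousOn F₂ s) : ContDiffOn ℝ 2 F s := by
  have hF₁ : ContDiffOn ℝ 1 F₁ s := by
    rw [show (1 : WithTop ℕ∞) = 0 + 1 from (zero_add 1).symm, contDiffOn_succ_iff_deriv_of_isOpen hs]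
    refine ⟨fun x hx => (h₂ x hx).differentiableAt.differentiableWithinAt, by simp, ?_⟩
    exact contDiffOn_zero.mpr (hc.congr fun x hx => (h₂ x hx).deriv)
  rw [show (2 : WithTop ℕ∞) = 1 + 1 from one_add_one_eq_two.symm,
    contDiffOn_succ_iff_deriv_of_isOpen hs]
  exact ⟨fun x hx => (h₁ x hx).differentiableAt.differentiableWithinAt, by simp,
    hF₁.congr fun x hx => (h₁ x hx).deriv⟩

variable {E : Type*} [NormedAddCommGroup E] [InnerProductSpace ℝ E] [FiniteDimensional ℝ E]

omit [FiniteDimensional ℝ E] in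
lemma ContDiffAt.comp_mul_norm_sq {F : ℝ → ℝ} {c : ℝ} {x : E}
    (hF : ContDiffAt ℝ 2 F (c * ‖x‖ ^ 2)) : ContDiffAt ℝ 2 (fun y : E => F (c * ‖y‖ ^ 2)) x :=
  ContDiffAt.comp x (g := F) (f := fun y : E => c * ‖y‖ ^ 2) hF
    (contDiff_const.mul (contDiff_norm_sq ℝ)).contDiffAt

lemma laplacian_comp_mul_norm_sq {F : ℝ → ℝ} {c : ℝ} {x : E}
    (hF : ContDiffAt ℝ 2 F (c * ‖x‖ ^ 2)) :
    Δ (fun y : E => F (c * ‖y‖ ^ 2)) x = c * (4 * (c * ‖x‖ ^ 2) * deriv (deriv F) (c * ‖x‖ ^ 2)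
      + 2 * Module.finrank ℝ E * deriv F (c * ‖x‖ ^ 2)) := by
  have h1 : ContDiffAt ℝ 2 (fun t => F (c * t)) (‖x‖ ^ 2) :=
    ContDiffAt.comp (‖x‖ ^ 2) (g := F) (f := fun t => c * t) hF
      (contDiff_const.mul contDiff_id).contDiffAt
  have h2 : deriv (fun t => F (c * t)) = fun t => c * deriv F (c * t) :=
    funext fun t => by simpa using deriv_comp_mul_left c F t
  have h3 : deriv (fun t => c * deriv F (c * t)) (‖x‖ ^ 2)
      = c * (c * deriv (deriv F) (c * ‖x‖ ^ 2)) := by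
    rw [deriv_const_mul_field]
    have := deriv_comp_mul_left c (deriv F) (‖x‖ ^ 2)
    rw [this, smul_eq_mul]
  rw [laplacian_comp_norm_sq (F := fun t => F (c * t)) h1, h2, h3]
  ring

end RadialEquation

/-! ### Passage between radial solutions and profiles -/

section ProfileOfSolution

open Laplacian InnerProductSpace

variable {ν : ℝ} {g g₁ g₂ F F₁ : ℝ → ℝ} {S : ℝ}

namespace IsProfile

lemma contDiffAt (h : IsProfile ν g F F₁ S) (hg : IsConvexExponent g g₁ g₂) {s : ℝ}
    (hs : s ∈ Ioo 0 S) : ContDiffAt ℝ 2 F s := by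
  refine (contDiffOn_two_of_hasDerivAt isOpen_Ioo h.deriv h.deriv₁ fun t ht => ?_).contDiffAt
    (Ioo_mem_nhds hs.1 hs.2)
  have hF := (h.deriv t ht).continuousAt
  have hF₁ := (h.deriv₁ t ht).continuousAt
  have hgF : ContinuousAt (fun s => g (F s)) t :=
    ContinuousAt.comp (g := g) (hg.deriv _ (h.pos t ht)).continuousAt hF
  refine ContinuousAt.continuousWithinAt ?_
  exact ContinuousAt.div ((((continuousAt_const).mul hF₁).add hgF.rexp).neg) (by fun_prop)
    (by have := ht.1; positivity)

lemma deriv_deriv_eq (h : IsProfile ν g F F₁ S) {s : ℝ} (hs : s ∈ Ioo 0 S) :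
    4 * s * _root_.deriv (_root_.deriv F) s + 2 * ν * _root_.deriv F s + Real.exp (g (F s)) = 0 := by
  have h1 : _root_.deriv F =ᶠ[𝓝 s] F₁ := by
    filter_upwards [Ioo_mem_nhds hs.1 hs.2] with t ht using (h.deriv t ht).deriv
  rw [h1.deriv_eq, h1.eq_of_nhds, (h.deriv₁ s hs).deriv]
  have := hs.1.ne'
  field_simp
  ring

end IsProfile

variable {N : ℕ}

lemma mul_norm_sq_mem_Ioo {E : Type*} [NormedAddCommGroup E] {T : ℝ} (hT : 0 < T) {x : E}
    (hx0 : x ≠ 0) (hx1 : ‖x‖ < 1) : T * ‖x‖ ^ 2 ∈ Ioo 0 T := by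
  have h0 : 0 < ‖x‖ := norm_pos_iff.mpr hx0
  have h2 : ‖x‖ ^ 2 < 1 := by nlinarith
  exact ⟨by positivity, by nlinarith⟩

lemma mul_norm_sq_mem_Ico {E : Type*} [NormedAddCommGroup E] {T : ℝ} (hT : 0 < T) {x : E}
    (hx1 : ‖x‖ < 1) : T * ‖x‖ ^ 2 ∈ Ico 0 T := by
  have h0 : 0 ≤ ‖x‖ := norm_nonneg x
  have h2 : ‖x‖ ^ 2 < 1 := by nlinarith
  exact ⟨by positivity, by nlinarith⟩

lemma IsProfile.laplacian_eq (h : IsProfile N g F F₁ S) (hg : IsConvexExponent g g₁ g₂)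
    {x : EuclideanSpace ℝ (Fin N)} (hS : 0 < S) (hx0 : x ≠ 0) (hx1 : ‖x‖ < 1) :
    Δ (fun y : EuclideanSpace ℝ (Fin N) => F (S * ‖y‖ ^ 2)) x
      + S * Real.exp (g (F (S * ‖x‖ ^ 2))) = 0 := by
  have hs := mul_norm_sq_mem_Ioo hS hx0 hx1
  rw [laplacian_comp_mul_norm_sq (h.contDiffAt hg hs), finrank_euclideanSpace_fin, ← mul_add,
    h.deriv_deriv_eq hs, mul_zero]

/-- The profile, in the variable `s = lam * ‖x‖ ^ 2`, of a radial solution. -/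
noncomputable def radialProfile (lam : ℝ) (e : EuclideanSpace ℝ (Fin N))
    (u : EuclideanSpace ℝ (Fin N) → ℝ) (s : ℝ) : ℝ := u (√(s / lam) • e)

lemma norm_sqrt_smul {lam s : ℝ} {e : EuclideanSpace ℝ (Fin N)} (he : ‖e‖ = 1) :
    ‖√(s / lam) • e‖ = √(s / lam) := by
  rw [norm_smul, he, mul_one, Real.norm_eq_abs, abs_of_nonneg (Real.sqrt_nonneg _)]

lemma sqrt_div_mem_Ioo {lam s : ℝ} (hs : s ∈ Ioo 0 lam) : √(s / lam) ∈ Ioo (0 : ℝ) 1 := by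
  have hlam : 0 < lam := hs.1.trans hs.2
  refine ⟨Real.sqrt_pos.mpr (div_pos hs.1 hlam), ?_⟩
  rw [Real.sqrt_lt' one_pos, one_pow, div_lt_one hlam]
  exact hs.2

lemma radialProfile_eq {lam : ℝ} (hlam : 0 < lam) {e : EuclideanSpace ℝ (Fin N)} (he : ‖e‖ = 1)
    {u : EuclideanSpace ℝ (Fin N) → ℝ}
    (hrad : ∀ x y : EuclideanSpace ℝ (Fin N), x ≠ 0 → ‖x‖ ≤ 1 → ‖x‖ = ‖y‖ → u x = u y)
    {x : EuclideanSpace ℝ (Fin N)} (hx0 : x ≠ 0) (hx1 : ‖x‖ ≤ 1) :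
    u x = radialProfile lam e u (lam * ‖x‖ ^ 2) := by
  refine hrad x _ hx0 hx1 ?_
  rw [norm_sqrt_smul he, mul_div_cancel_left₀ _ hlam.ne', Real.sqrt_sq (norm_nonneg x)]

lemma isProfile_radialProfile {lam : ℝ} {e : EuclideanSpace ℝ (Fin N)} (he : ‖e‖ = 1)
    {u : EuclideanSpace ℝ (Fin N) → ℝ}
    (hrad : ∀ x y : EuclideanSpace ℝ (Fin N), x ≠ 0 → ‖x‖ ≤ 1 → ‖x‖ = ‖y‖ → u x = u y)
    (hcd : ∀ x : EuclideanSpace ℝ (Fin N), x ≠ 0 → ‖x‖ < 1 → ContDiffAt ℝ 2 u x)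
    (heq : ∀ x : EuclideanSpace ℝ (Fin N), x ≠ 0 → ‖x‖ < 1 → Δ u x + lam * Real.exp (g (u x)) = 0)
    (hpos : ∀ x : EuclideanSpace ℝ (Fin N), x ≠ 0 → ‖x‖ < 1 → 0 < u x) :
    IsProfile N g (radialProfile lam e u) (deriv (radialProfile lam e u)) lam := by
  have hpt : ∀ s ∈ Ioo 0 lam, √(s / lam) • e ≠ 0 ∧ ‖√(s / lam) • e‖ < 1 := by
    intro s hs
    have h1 := sqrt_div_mem_Ioo hs
    have h2 := norm_sqrt_smul (lam := lam) (s := s) he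
    exact ⟨norm_pos_iff.mp (h1.1.trans_eq h2.symm), h2.trans_lt h1.2⟩
  have hC : ∀ s ∈ Ioo 0 lam, ContDiffAt ℝ 2 (radialProfile lam e u) s := by
    intro s hs
    have hlam : 0 < lam := hs.1.trans hs.2
    have h1 : ContDiffAt ℝ 2 (fun s => √(s / lam)) s :=
      (contDiff_id.div_const lam).contDiffAt.sqrt (div_pos hs.1 hlam).ne'
    exact ContDiffAt.comp s (g := u) (f := fun s => √(s / lam) • e)
      (hcd _ (hpt s hs).1 (hpt s hs).2) (h1.smul contDiffAt_const)
  refine ⟨fun s hs => hpos _ (hpt s hs).1 (hpt s hs).2,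
    fun s hs => ((hC s hs).differentiableAt (by simp)).hasDerivAt, fun s hs => ?_⟩
  have hlam : 0 < lam := hs.1.trans hs.2
  have hd : DifferentiableAt ℝ (deriv (radialProfile lam e u)) s :=
    (hC s hs).deriv_of_two.differentiableAt (by simp)
  obtain ⟨hx0, hx1⟩ := hpt s hs
  set x := √(s / lam) • e with hx
  have hxs : lam * ‖x‖ ^ 2 = s := by
    rw [norm_sqrt_smul he, Real.sq_sqrt (div_pos hs.1 hlam).le, mul_div_cancel₀ _ hlam.ne']
  have hux : u x = radialProfile lam e u s := rfl
  -- Radial symmetry identifies u with its profile near x, so the Laplacian formula can be read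
  -- backwards as the profile equation.
  have hev : u =ᶠ[𝓝 x] fun y => radialProfile lam e u (lam * ‖y‖ ^ 2) := by
    filter_upwards [isOpen_ne.mem_nhds hx0, Metric.isOpen_ball.mem_nhds
      (mem_ball_zero_iff.mpr hx1)] with y hy0 hy1
    exact radialProfile_eq hlam he hrad hy0 (mem_ball_zero_iff.mp hy1).le
  have h1 := heq x hx0 hx1
  rw [(laplacian_congr_nhds hev).eq_of_nhds, laplacian_comp_mul_norm_sq (by rw [hxs]; exact hC s hs),
    finrank_euclideanSpace_fin, hxs, hux, ← mul_add] at h1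
  have h2 := (mul_eq_zero.mp h1).resolve_left hlam.ne'
  refine hd.hasDerivAt.congr_deriv ?_
  have := hs.1.ne'
  field_simp
  linarith

lemma tendsto_radialProfile_end {lam : ℝ} (hlam : 0 < lam) {e : EuclideanSpace ℝ (Fin N)}
    (he : ‖e‖ = 1) {u : EuclideanSpace ℝ (Fin N) → ℝ}
    (hu : ContinuousWithinAt u (Metric.closedBall 0 1 \ {0}) e) (hue : u e = 0) :
    Tendsto (radialProfile lam e u) (𝓝[<] lam) (𝓝 0) := by
  have hcurve : Continuous fun s : ℝ => √(s / lam) • e := by fun_prop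
  have h2 : Tendsto (fun s : ℝ => √(s / lam) • e) (𝓝[<] lam)
      (𝓝[Metric.closedBall 0 1 \ {0}] e) := by
    refine tendsto_nhdsWithin_iff.mpr ⟨?_, ?_⟩
    · have := hcurve.tendsto lam
      simp only [div_self hlam.ne', Real.sqrt_one, one_smul] at this
      exact this.mono_left nhdsWithin_le_nhds
    · filter_upwards [Ioo_mem_nhdsLT hlam] with s hs
      have h1 := sqrt_div_mem_Ioo hs
      have h2 := norm_sqrt_smul (lam := lam) (s := s) he
      exact ⟨mem_closedBall_zero_iff.mpr (h2.trans_le h1.2.le),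
        norm_pos_iff.mp (h1.1.trans_eq h2.symm)⟩
  rw [ContinuousWithinAt, hue] at hu
  exact hu.comp h2

end ProfileOfSolution

/-! ### Classical solutions and the bifurcation curve -/

section RegularSolutions

open Laplacian InnerProductSpace

variable {N : ℕ} {g g₁ g₂ : ℝ → ℝ} {S : ℝ → ℝ} {F F₁ : ℝ → ℝ → ℝ}

namespace IsRegularFamily

/-- A profile satisfies the equation only for s > 0; C² regularity extends it to s = 0, as needed at
the centre of the ball. -/
lemma deriv_deriv_eq (h : IsRegularFamily N g S F F₁) (hg : IsConvexExponent g g₁ g₂) {α : ℝ}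
    (hα : 0 < α) {s : ℝ} (hs : s ∈ Ico 0 (S α)) :
    4 * s * deriv (deriv (F α)) s + 2 * N * deriv (F α) s + Real.exp (g (F α s)) = 0 := by
  rcases hs.1.eq_or_lt with rfl | h0
  swap
  · exact (h.profile α hα).deriv_deriv_eq ⟨h0, hs.2⟩
  have hc₁ : ContDiff ℝ 1 (deriv (F α)) :=
    contDiff_iff_contDiffAt.mpr fun s => ((h.contDiff α hα).contDiffAt).deriv_of_two
  have hc₂ : Continuous (deriv (deriv (F α))) := hc₁.continuous_deriv (by simp)
  have hcg : ContinuousAt (fun s => g (F α s)) 0 := by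
    refine ContinuousAt.comp (g := g) ?_ (h.contDiff α hα).continuous.continuousAt
    rw [h.apply_zero α hα]
    exact (hg.deriv α hα).continuousAt
  have hlim : Tendsto (fun s => 4 * s * deriv (deriv (F α)) s + 2 * N * deriv (F α) s
      + Real.exp (g (F α s))) (𝓝[>] 0) (𝓝 (4 * 0 * deriv (deriv (F α)) 0
      + 2 * N * deriv (F α) 0 + Real.exp (g (F α 0)))) := by
    refine Tendsto.mono_left ?_ nhdsWithin_le_nhds
    exact (((continuousAt_const.mul continuousAt_id).mul hc₂.continuousAt).add
      (continuousAt_const.mul hc₁.continuous.continuousAt)).add hcg.rexp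
  refine tendsto_nhds_unique hlim (tendsto_const_nhds.congr' ?_)
  filter_upwards [Ioo_mem_nhdsGT hs.2] with s hs
  exact ((h.profile α hα).deriv_deriv_eq hs).symm

lemma le_apply_zero (h : IsRegularFamily N g S F F₁) (hN : 10 ≤ N) {α : ℝ} (hα : 0 < α) {s : ℝ}
    (hs : s ∈ Ico 0 (S α)) : F α s ≤ α := by
  rcases hs.1.eq_or_lt with rfl | h0
  · exact (h.apply_zero α hα).le
  refine ge_of_tendsto (h.tendsto_zero hα) ?_
  filter_upwards [Ioo_mem_nhdsGT h0] with t ht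
  exact (h.profile α hα).antitoneOn (by exact_mod_cast hN) ⟨ht.1, ht.2.trans hs.2⟩ ⟨h0, hs.2⟩ ht.2.le

lemma pos (h : IsRegularFamily N g S F F₁) {α : ℝ} (hα : 0 < α) {s : ℝ}
    (hs : s ∈ Ico 0 (S α)) : 0 < F α s := by
  rcases hs.1.eq_or_lt with rfl | h0
  · rwa [h.apply_zero α hα]
  · exact (h.profile α hα).pos s ⟨h0, hs.2⟩

/-- The regular profiles yield classical solutions. -/
lemma isClassicalSolution (h : IsRegularFamily N g S F F₁) (hg : IsConvexExponent g g₁ g₂) {α : ℝ}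
    (hα : 0 < α) :
    IsClassicalSolution N (fun t => Real.exp (g t)) (S α) (fun x => F α (S α * ‖x‖ ^ 2)) := by
  have hS := h.end_pos α hα
  have hC : ContDiff ℝ 2 fun x : EuclideanSpace ℝ (Fin N) => F α (S α * ‖x‖ ^ 2) :=
    contDiff_iff_contDiffAt.mpr fun x => (h.contDiff α hα).contDiffAt.comp_mul_norm_sq
  refine ⟨hS, hC.contDiffOn, hC.continuous.continuousOn, fun x hx => ?_, fun x hx => ?_,
    fun x hx => ?_⟩
  · have hs := mul_norm_sq_mem_Ico hS (mem_ball_zero_iff.mp hx)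
    rw [laplacian_comp_mul_norm_sq (h.contDiff α hα).contDiffAt, finrank_euclideanSpace_fin,
      ← mul_add, h.deriv_deriv_eq hg hα hs, mul_zero]
  · rw [mem_sphere_zero_iff_norm.mp hx, one_pow, mul_one, h.apply_end α hα]
  · exact h.pos hα (mul_norm_sq_mem_Ico hS (mem_ball_zero_iff.mp hx))

lemma hasSupNorm (h : IsRegularFamily N g S F F₁) (hN : 10 ≤ N) {α : ℝ} (hα : 0 < α) :
    HasSupNorm (fun x : EuclideanSpace ℝ (Fin N) => F α (S α * ‖x‖ ^ 2)) α := by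
  have hS := h.end_pos α hα
  refine IsGreatest.isLUB ⟨⟨0, by simp, ?_⟩, ?_⟩
  · simp [h.apply_zero α hα, abs_of_pos hα]
  · rintro _ ⟨x, hx, rfl⟩
    have hs := mul_norm_sq_mem_Ico hS (mem_ball_zero_iff.mp hx)
    simp only [abs_of_pos (h.pos hα hs)]
    exact h.le_apply_zero hN hα hs

end IsRegularFamily

namespace IsClassicalSolution

variable {lam : ℝ} {u : EuclideanSpace ℝ (Fin N) → ℝ}

lemma contDiffAt {f : ℝ → ℝ} (hu : IsClassicalSolution N f lam u) {x : EuclideanSpace ℝ (Fin N)}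
    (hx : ‖x‖ < 1) : ContDiffAt ℝ 2 u x :=
  hu.contDiffOn.contDiffAt (Metric.isOpen_ball.mem_nhds (mem_ball_zero_iff.mpr hx))

/-- Classical solutions are radial. -/
lemma radial (hu : IsClassicalSolution N (fun t => Real.exp (g t)) lam u)
    (hg : IsConvexExponent g g₁ g₂) :
    ∀ x y : EuclideanSpace ℝ (Fin N), ‖x‖ ≤ 1 → ‖x‖ = ‖y‖ → u x = u y := by
  have hlam := hu.lam_pos
  have hD : IsDirichletSolution (fun t => lam * Real.exp (g t)) u :=
    ⟨fun x hx => hu.contDiffAt hx, hu.continuousOn,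
      fun x hx => hu.equation x (mem_ball_zero_iff.mpr hx),
      fun x hx => hu.boundary x (mem_sphere_zero_iff_norm.mpr hx),
      fun x hx => hu.pos x (mem_ball_zero_iff.mpr hx)⟩
  obtain ⟨M, hM⟩ := ((isCompact_closedBall (0 : EuclideanSpace ℝ (Fin N)) 1).bddAbove_image
    hu.continuousOn)
  have hM' : ∀ x : EuclideanSpace ℝ (Fin N), ‖x‖ ≤ 1 → u x ≤ M := fun x hx =>
    hM ⟨x, mem_closedBall_zero_iff.mpr hx, rfl⟩
  have hM0 : 0 ≤ M := (hD.nonneg (x := 0) (by simp)).trans (hM' 0 (by simp))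
  have hmono : MonotoneOn (fun t => lam * Real.exp (g t)) (Ici 0) := fun a ha b hb hab =>
    mul_le_mul_of_nonneg_left (Real.exp_le_exp.mpr (hg.monotoneOn ha hb hab)) hlam.le
  refine hD.radial hmono (C := lam * (g₁ M * Real.exp (g M)))
    (by have := hg.pos₁ M hM0; positivity) fun x y hx hy hxy => ?_
  have hy0 := hD.nonneg hy
  have h1 := hg.exp_sub_le hy0 hxy
  have h2 := hg.monotoneOn_exp_deriv (hD.nonneg hx) hM0 (hM' x hx)
  have h3 := mul_le_mul_of_nonneg_right h2 (sub_nonneg.mpr hxy)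
  have h4 := mul_le_mul_of_nonneg_left (h1.trans h3) hlam.le
  linarith

/-- A classical solution belongs to the family of regular profiles. -/
lemma eq_regular (hu : IsClassicalSolution N (fun t => Real.exp (g t)) lam u)
    (h : IsRegularFamily N g S F F₁) (hg : IsConvexExponent g g₁ g₂) (hN : 10 ≤ N) :
    0 < u 0 ∧ lam = S (u 0) ∧
      EqOn u (fun x => F (u 0) (S (u 0) * ‖x‖ ^ 2)) (Metric.closedBall 0 1) := by
  have hlam := hu.lam_pos
  have h0 : 0 < u 0 := hu.pos 0 (by simp)
  set e : EuclideanSpace ℝ (Fin N) := EuclideanSpace.single ⟨0, by omega⟩ 1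
  have he : ‖e‖ = 1 := by simp [e]
  have hrad := hu.radial hg
  have hrad' : ∀ x y : EuclideanSpace ℝ (Fin N), x ≠ 0 → ‖x‖ ≤ 1 → ‖x‖ = ‖y‖ → u x = u y :=
    fun x y _ => hrad x y
  have hP : IsProfile N g (radialProfile lam e u) (deriv (radialProfile lam e u)) lam :=
    isProfile_radialProfile he hrad' (fun x _ hx => hu.contDiffAt hx)
      (fun x _ hx => hu.equation x (mem_ball_zero_iff.mpr hx))
      (fun x _ hx => hu.pos x (mem_ball_zero_iff.mpr hx))
  have hcurve : Continuous fun s : ℝ => √(s / lam) • e := by fun_prop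
  have hB0 : Tendsto (radialProfile lam e u) (𝓝[>] 0) (𝓝 (u 0)) := by
    have h1 := (hu.contDiffAt (x := 0) (by simp)).continuousAt.tendsto
    have h2 : Tendsto (fun s : ℝ => √(s / lam) • e) (𝓝 0) (𝓝 0) := by
      simpa using hcurve.tendsto 0
    exact (h1.comp h2).mono_left nhdsWithin_le_nhds
  have hBT : Tendsto (radialProfile lam e u) (𝓝[<] lam) (𝓝 0) := by
    refine tendsto_radialProfile_end hlam he ?_ (hu.boundary e (mem_sphere_zero_iff_norm.mpr he))
    exact (hu.continuousOn e (mem_closedBall_zero_iff.mpr he.le)).mono sdiff_subset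
  obtain ⟨hT, hF⟩ := h.eq_of_tendsto hg (by exact_mod_cast hN) h0 hlam hP hB0 hBT
  refine ⟨h0, hT, fun x hx => ?_⟩
  have hx1 := mem_closedBall_zero_iff.mp hx
  rcases eq_or_ne x 0 with rfl | hx0
  · simp [h.apply_zero _ h0]
  rcases hx1.eq_or_lt with hx1 | hx1
  · simp only [hx1, one_pow, mul_one, h.apply_end _ h0]
    exact hu.boundary x (mem_sphere_zero_iff_norm.mpr hx1)
  · simp only [← hT]
    rw [← hF _ (mul_norm_sq_mem_Ioo hlam hx0 hx1)]
    exact radialProfile_eq hlam he hrad' hx0 hx1.le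

end IsClassicalSolution

lemma HasSupNorm.congr {u v : EuclideanSpace ℝ (Fin N) → ℝ} {a : ℝ} (h : HasSupNorm u a)
    (huv : EqOn v u (Metric.closedBall 0 1)) : HasSupNorm v a := by
  have : (fun x => |v x|) '' Metric.ball 0 1 = (fun x => |u x|) '' Metric.ball 0 1 :=
    image_congr fun x hx => by rw [huv (Metric.ball_subset_closedBall hx)]
  rwa [HasSupNorm, this]

lemma IsClassicalSolution.eq_of_hasSupNorm {lam a : ℝ} {u : EuclideanSpace ℝ (Fin N) → ℝ}
    (hu : IsClassicalSolution N (fun t => Real.exp (g t)) lam u) (ha : HasSupNorm u a)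
    (h : IsRegularFamily N g S F F₁) (hg : IsConvexExponent g g₁ g₂) (hN : 10 ≤ N) :
    lam = S a ∧ EqOn u (fun x => F a (S a * ‖x‖ ^ 2)) (Metric.closedBall 0 1) := by
  obtain ⟨h0, hlam, heq⟩ := hu.eq_regular h hg hN
  have : a = u 0 := ha.unique ((h.hasSupNorm hN h0).congr heq)
  subst this
  exact ⟨hlam, heq⟩

lemma IsRegularFamily.isBifurcationCurve (h : IsRegularFamily N g S F F₁)
    (hg : IsConvexExponent g g₁ g₂) (hN : 10 ≤ N) :
    IsBifurcationCurve N (fun t => Real.exp (g t)) S where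
  exists_solution a ha := ⟨_, h.isClassicalSolution hg ha, h.hasSupNorm hN ha⟩
  eq_param _ _ _ hu ha := (hu.eq_of_hasSupNorm ha h hg hN).1
  unique_solution _ _ _ _ _ hu ha hu' ha' := (hu.eq_of_hasSupNorm ha h hg hN).2.trans
    (hu'.eq_of_hasSupNorm ha' h hg hN).2.symm
  continuousOn := h.end_continuousOn hg (by exact_mod_cast hN)
  tendsto_zero := h.end_tendsto_zero hg (by exact_mod_cast hN)

/-- S is a continuous, strictly increasing map of (0, ∞) onto (0, T), and every classical solution
belongs to the regular family. -/
lemma IsRegularFamily.existsUnique_solution (h : IsRegularFamily N g S F F₁)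
    (hg : IsConvexExponent g g₁ g₂) (hN : 10 ≤ N) {T lam : ℝ} (hlim : Tendsto S atTop (𝓝 T))
    (hlam : lam ∈ Ioo 0 T) : ∃ u, IsClassicalSolution N (fun t => Real.exp (g t)) lam u ∧
      ∀ w, IsClassicalSolution N (fun t => Real.exp (g t)) lam w →
        EqOn w u (Metric.closedBall 0 1) := by
  have hν : (10 : ℝ) ≤ N := by exact_mod_cast hN
  obtain ⟨a, ha0, ha⟩ : ∃ a, 0 < a ∧ S a < lam :=
    ((eventually_mem_nhdsWithin (a := (0 : ℝ)) (s := Ioi 0)).and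
      ((h.end_tendsto_zero hg hν).eventually_lt_const hlam.1)).exists
  obtain ⟨b, hb0, hb⟩ : ∃ b, 0 < b ∧ lam < S b :=
    ((eventually_gt_atTop 0).and (hlim.eventually_const_lt hlam.2)).exists
  obtain ⟨α, hα, rfl⟩ := (isPreconnected_Ioi (a := (0 : ℝ))).intermediate_value ha0 hb0
    (h.end_continuousOn hg hν) ⟨ha.le, hb.le⟩
  refine ⟨_, h.isClassicalSolution hg hα, fun w hw => ?_⟩
  obtain ⟨h0, h1, h2⟩ := hw.eq_regular h hg hN
  rwa [← (h.end_strictMonoOn hg hν).injOn hα h0 h1] at h2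

end RegularSolutions

/-! ### The singular solution, its stability, and the main theorem -/

section SingularSolution

open Laplacian InnerProductSpace MeasureTheory

variable {N : ℕ} {g g₁ g₂ W W₁ : ℝ → ℝ} {T : ℝ}

lemma IsProfile.congr {ν : ℝ} {F F₁ : ℝ → ℝ} (h : IsProfile ν g F F₁ T)
    (hW : EqOn W F (Ioo 0 T)) : IsProfile ν g W F₁ T := by
  refine ⟨fun s hs => hW hs ▸ h.pos s hs, fun s hs => ?_, fun s hs => hW hs ▸ h.deriv₁ s hs⟩
  exact (h.deriv s hs).congr_of_eventuallyEq (hW.eventuallyEq_of_mem (Ioo_mem_nhds hs.1 hs.2))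

/-- An unbounded profile yields a radial singular solution. -/
lemma IsProfile.isRadialSingularSolution (h : IsProfile N g W W₁ T)
    (hg : IsConvexExponent g g₁ g₂) (hT : 0 < T) (htop : Tendsto W (𝓝[>] 0) atTop)
    (hend : ContinuousAt W T) (hWT : W T = 0) :
    IsRadialSingularSolution N (fun t => Real.exp (g t)) T (fun x => W (T * ‖x‖ ^ 2)) := by
  have hmem : ∀ x ∈ Metric.ball (0 : EuclideanSpace ℝ (Fin N)) 1 \ {0}, T * ‖x‖ ^ 2 ∈ Ioo 0 T :=
    fun x hx => mul_norm_sq_mem_Ioo hT hx.2 (mem_ball_zero_iff.mp hx.1)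
  have hC : ∀ x ∈ Metric.ball (0 : EuclideanSpace ℝ (Fin N)) 1 \ {0},
      ContDiffAt ℝ 2 (fun x : EuclideanSpace ℝ (Fin N) => W (T * ‖x‖ ^ 2)) x :=
    fun x hx => (h.contDiffAt hg (hmem x hx)).comp_mul_norm_sq
  refine ⟨hT, fun x _ y _ hxy => by simp only [hxy], fun x hx => (hC x hx).contDiffWithinAt,
    fun x hx => ContinuousAt.continuousWithinAt ?_,
    fun x hx => h.laplacian_eq hg hT hx.2 (mem_ball_zero_iff.mp hx.1), fun x hx => ?_,
    fun x hx => h.pos _ (hmem x hx), ?_⟩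
  · rcases (mem_closedBall_zero_iff.mp hx.1).eq_or_lt with hx1 | hx1
    · refine ContinuousAt.comp (g := W) (f := fun x : EuclideanSpace ℝ (Fin N) => T * ‖x‖ ^ 2) ?_
        (by fun_prop)
      simpa only [hx1, one_pow, mul_one] using hend
    · exact (hC x ⟨mem_ball_zero_iff.mpr hx1, hx.2⟩).continuousAt
  · simp only [mem_sphere_zero_iff_norm.mp hx, one_pow, mul_one, hWT]
  · refine htop.comp (tendsto_nhdsWithin_iff.mpr ⟨?_, ?_⟩)
    · have : Continuous fun x : EuclideanSpace ℝ (Fin N) => T * ‖x‖ ^ 2 := by fun_prop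
      have h0 := this.tendsto 0
      simp only [norm_zero, ne_eq, OfNat.ofNat_ne_zero, not_false_eq_true, zero_pow, mul_zero] at h0
      exact h0.mono_left nhdsWithin_le_nhds
    · filter_upwards [self_mem_nhdsWithin] with x hx
      have : 0 < ‖x‖ := norm_pos_iff.mpr hx
      exact mul_pos hT (by positivity)

lemma IsRadialSingularSolution.exists_isProfile {lam : ℝ} {u : EuclideanSpace ℝ (Fin N) → ℝ}
    (hu : IsRadialSingularSolution N (fun t => Real.exp (g t)) lam u) (hN : 0 < N) :
    ∃ B B₁, IsProfile N g B B₁ lam ∧ Tendsto B (𝓝[>] 0) atTop ∧ Tendsto B (𝓝[<] lam) (𝓝 0) ∧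
      ∀ x : EuclideanSpace ℝ (Fin N), x ≠ 0 → ‖x‖ ≤ 1 → u x = B (lam * ‖x‖ ^ 2) := by
  have hlam := hu.lam_pos
  set e : EuclideanSpace ℝ (Fin N) := EuclideanSpace.single ⟨0, hN⟩ 1
  have he : ‖e‖ = 1 := by simp [e]
  have he0 : e ≠ 0 := norm_pos_iff.mp (he ▸ one_pos)
  have hopen : IsOpen (Metric.ball (0 : EuclideanSpace ℝ (Fin N)) 1 \ {0}) :=
    Metric.isOpen_ball.sdiff isClosed_singleton
  have hrad : ∀ x y : EuclideanSpace ℝ (Fin N), x ≠ 0 → ‖x‖ ≤ 1 → ‖x‖ = ‖y‖ → u x = u y := by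
    intro x y hx0 hx1 hxy
    have hy0 : y ≠ 0 := norm_pos_iff.mp (hxy ▸ norm_pos_iff.mpr hx0)
    exact hu.radial x ⟨mem_closedBall_zero_iff.mpr hx1, hx0⟩ y
      ⟨mem_closedBall_zero_iff.mpr (hxy ▸ hx1), hy0⟩ hxy
  refine ⟨radialProfile lam e u, deriv (radialProfile lam e u),
    isProfile_radialProfile he hrad
      (fun x hx0 hx1 => hu.contDiffOn.contDiffAt
        (hopen.mem_nhds ⟨mem_ball_zero_iff.mpr hx1, hx0⟩))
      (fun x hx0 hx1 => hu.equation x ⟨mem_ball_zero_iff.mpr hx1, hx0⟩)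
      (fun x hx0 hx1 => hu.pos x ⟨mem_ball_zero_iff.mpr hx1, hx0⟩), ?_,
    tendsto_radialProfile_end hlam he
      (hu.continuousOn e ⟨mem_closedBall_zero_iff.mpr he.le, he0⟩)
      (hu.boundary e (mem_sphere_zero_iff_norm.mpr he)),
    fun x hx0 hx1 => radialProfile_eq hlam he hrad hx0 hx1⟩
  refine hu.singular.comp (tendsto_nhdsWithin_iff.mpr ⟨?_, ?_⟩)
  · have hcurve : Continuous fun s : ℝ => √(s / lam) • e := by fun_prop
    have h0 := hcurve.tendsto 0
    simp only [zero_div, Real.sqrt_zero, zero_smul] at h0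
    exact h0.mono_left nhdsWithin_le_nhds
  · filter_upwards [self_mem_nhdsWithin] with s hs
    exact smul_ne_zero (Real.sqrt_pos.mpr (div_pos hs hlam)).ne' he0

lemma IsConvexExponent.derivWithin_exp (hg : IsConvexExponent g g₁ g₂) {t : ℝ} (ht : 0 < t) :
    derivWithin (fun t => Real.exp (g t)) (Ici 0) t = g₁ t * Real.exp (g t) := by
  rw [derivWithin_of_mem_nhds (Ici_mem_nhds ht), (hg.deriv t ht).exp.deriv, mul_comm]

/-- Any solution given by a profile is stable, by Hardy's inequality. -/
lemma IsProfile.isStableSolution (h : IsProfile N g W W₁ T) (hg : IsConvexExponent g g₁ g₂)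
    (hN : 10 ≤ N) (hT : 0 < T) :
    IsStableSolution N (fun t => Real.exp (g t)) T (fun x => W (T * ‖x‖ ^ 2)) := by
  intro φ hφ hsupp hball
  have hν : (10 : ℝ) ≤ N := by exact_mod_cast hN
  have : Nontrivial (EuclideanSpace ℝ (Fin N)) :=
    ⟨EuclideanSpace.single ⟨0, by omega⟩ 1, 0, by simp⟩
  -- The origin, where the profile carries no information, is removed as a null set.
  set B : Set (EuclideanSpace ℝ (Fin N)) := Metric.ball 0 1 \ {0} with hB
  have hBm : MeasurableSet B := measurableSet_ball.diff (measurableSet_singleton 0)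
  have hBae : B =ᵐ[volume] Metric.ball 0 1 := sdiff_null_ae_eq_self (measure_singleton 0)
  have hmem : ∀ x ∈ B, T * ‖x‖ ^ 2 ∈ Ioo 0 T :=
    fun x hx => mul_norm_sq_mem_Ioo hT hx.2 (mem_ball_zero_iff.mp hx.1)
  set k : ℝ := ((N : ℝ) - 2) / 2 with hk
  have hk0 : 0 < k := by rw [hk]; linarith
  obtain ⟨hint, hle⟩ := hardy_inequality hφ hsupp hk0 (by rw [finrank_euclideanSpace_fin, hk]; ring)
  set q : EuclideanSpace ℝ (Fin N) → ℝ := fun x =>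
    T * derivWithin (fun t => Real.exp (g t)) (Ici 0) (W (T * ‖x‖ ^ 2)) * φ x ^ 2 with hq
  have hqB : ∀ x ∈ B, q x
      = T * (g₁ (W (T * ‖x‖ ^ 2)) * Real.exp (g (W (T * ‖x‖ ^ 2)))) * φ x ^ 2 := fun x hx => by
    simp only [hq, hg.derivWithin_exp (h.pos _ (hmem x hx))]
  have hq0 : ∀ x ∈ B, 0 ≤ q x := fun x hx => by
    have := hg.pos₁ _ (h.pos _ (hmem x hx)).le
    rw [hqB x hx]
    positivity
  -- With s = T|x|² and k = (N-2)/2, the bound of `potential_le` is exactly the Hardy weight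
  -- k²/|x|²; it gives both integrability and the sign.
  have hqle : ∀ x ∈ B, q x ≤ k ^ 2 * (φ x ^ 2 / ‖x‖ ^ 2) := fun x hx => by
    have h1 := h.potential_le hg hν (hmem x hx)
    have hx0 : 0 < ‖x‖ := norm_pos_iff.mpr hx.2
    have h2 : T * (g₁ (W (T * ‖x‖ ^ 2)) * Real.exp (g (W (T * ‖x‖ ^ 2)))) ≤ k ^ 2 / ‖x‖ ^ 2 := by
      rw [le_div_iff₀ (by positivity), hk]
      linarith
    rw [hqB x hx]
    calc _ ≤ k ^ 2 / ‖x‖ ^ 2 * φ x ^ 2 := mul_le_mul_of_nonneg_right h2 (sq_nonneg _)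
      _ = _ := by ring
  have hqc : ContinuousOn q B := by
    refine ContinuousOn.congr (fun x hx => ContinuousAt.continuousWithinAt ?_) hqB
    have hp := h.pos _ (hmem x hx)
    have hW : ContinuousAt (fun x : EuclideanSpace ℝ (Fin N) => W (T * ‖x‖ ^ 2)) x :=
      (h.contDiffAt hg (hmem x hx)).comp_mul_norm_sq.continuousAt
    have c1 := ContinuousAt.comp (g := g₁) (f := fun x : EuclideanSpace ℝ (Fin N) => W (T * ‖x‖ ^ 2))
      (hg.deriv₁ _ hp).continuousAt hW
    have c2 := ContinuousAt.comp (g := g) (f := fun x : EuclideanSpace ℝ (Fin N) => W (T * ‖x‖ ^ 2))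
      (hg.deriv _ hp).continuousAt hW
    exact (continuousAt_const.mul (c1.mul c2.rexp)).mul (hφ.continuous.pow 2).continuousAt
  have hqint : IntegrableOn q B := by
    refine Integrable.mono' (hint.const_mul (k ^ 2)).integrableOn
      (hqc.aestronglyMeasurable hBm) ?_
    filter_upwards [ae_restrict_mem hBm] with x hx
    rw [Real.norm_eq_abs, abs_of_nonneg (hq0 x hx)]
    exact hqle x hx
  have hgrad0 : ∀ x, x ∉ Metric.ball (0 : EuclideanSpace ℝ (Fin N)) 1 → ‖gradient φ x‖ ^ 2 = 0 := by
    intro x hx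
    rw [gradient, fderiv_of_notMem_tsupport ℝ fun hx' => hx (hball hx')]
    simp
  have hgint : Integrable fun x => ‖gradient φ x‖ ^ 2 := by
    refine ((continuous_gradient_of_contDiff hφ).norm.pow 2).integrable_of_hasCompactSupport ?_
    refine hsupp.of_isClosed_subset (isClosed_tsupport _)
      (closure_minimal (fun x hx => ?_) (isClosed_tsupport φ))
    by_contra hx'
    exact hx (by simp [gradient, fderiv_of_notMem_tsupport ℝ hx'])
  refine ⟨(hgint.integrableOn.sub hqint).congr_set_ae hBae.symm, ?_⟩
  rw [← setIntegral_congr_set hBae, integral_sub hgint.integrableOn hqint,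
    setIntegral_congr_set hBae (f := fun x => ‖gradient φ x‖ ^ 2),
    setIntegral_eq_integral_of_forall_compl_eq_zero hgrad0, sub_nonneg]
  calc ∫ x in B, q x ≤ ∫ x in B, k ^ 2 * (φ x ^ 2 / ‖x‖ ^ 2) :=
        setIntegral_mono_on hqint (hint.const_mul (k ^ 2)).integrableOn hBm hqle
    _ ≤ ∫ x, k ^ 2 * (φ x ^ 2 / ‖x‖ ^ 2) :=
        setIntegral_le_integral (hint.const_mul (k ^ 2))
          (Eventually.of_forall fun x => by positivity)
    _ = k ^ 2 * ∫ x, φ x ^ 2 / ‖x‖ ^ 2 := integral_const_mul _ _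
    _ ≤ _ := hle

lemma isConvexExponent_of_contDiffOn (hg : ContDiffOn ℝ 2 g (Ici 0))
    (hg₁ : ∀ t, 0 ≤ t → 0 < iteratedDerivWithin 1 g (Ici 0) t)
    (hg₂ : ∀ t, 0 ≤ t → 0 < iteratedDerivWithin 2 g (Ici 0) t)
    (hg₃ : ∀ t, 0 ≤ t → 0 ≤ iteratedDerivWithin 1 g (Ici 0) t ^ 2
      - iteratedDerivWithin 2 g (Ici 0) t) :
    IsConvexExponent g (iteratedDerivWithin 1 g (Ici 0)) (iteratedDerivWithin 2 g (Ici 0)) := by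
  have hu : UniqueDiffOn ℝ (Ici (0 : ℝ)) := uniqueDiffOn_Ici 0
  refine ⟨hg.continuousOn, hg.continuousOn_iteratedDerivWithin (by norm_num) hu, fun t ht => ?_,
    fun t ht => ?_, hg₁, fun t ht => (hg₂ t ht.le).le, fun t ht => sub_nonneg.mp (hg₃ t ht.le)⟩
  · rw [iteratedDerivWithin_one]
    exact ((hg.differentiableOn (by norm_num) t ht.le).hasDerivWithinAt).hasDerivAt
      (Ici_mem_nhds ht)
  · rw [iteratedDerivWithin_succ (n := 1)]
    exact ((hg.differentiableOn_iteratedDerivWithin (m := 1) (by norm_num) hu t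
      ht.le).hasDerivWithinAt).hasDerivAt (Ici_mem_nhds ht)

end SingularSolution

theorem mainTheorem2 (N : ℕ) (hN : 10 ≤ N) (g : ℝ → ℝ)
    (hg : ContDiffOn ℝ 3 g (Set.Ici 0))
    (hg₁ : ∀ t, 0 ≤ t → 0 < iteratedDerivWithin 1 g (Set.Ici 0) t)
    (hg₂ : ∀ t, 0 ≤ t → 0 < iteratedDerivWithin 2 g (Set.Ici 0) t)
    (hg₃ : ∀ t, 0 ≤ t → 0 ≤ iteratedDerivWithin 1 g (Set.Ici 0) t ^ 2
      - iteratedDerivWithin 2 g (Set.Ici 0) t)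
    (hg₄ : ∀ t, 0 ≤ t → 0 < 2 * iteratedDerivWithin 2 g (Set.Ici 0) t ^ 2
      - iteratedDerivWithin 1 g (Set.Ici 0) t * iteratedDerivWithin 3 g (Set.Ici 0) t) :
    ∃ (lamStar : ℝ) (uStar : EuclideanSpace ℝ (Fin N) → ℝ),
      IsTypeII N (fun t => Real.exp (g t)) lamStar ∧
      IsRadialSingularSolution N (fun t => Real.exp (g t)) lamStar uStar ∧
      (∀ (lam : ℝ) (u : EuclideanSpace ℝ (Fin N) → ℝ),
        IsRadialSingularSolution N (fun t => Real.exp (g t)) lam u →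
          lam = lamStar ∧ Set.EqOn u uStar (Metric.closedBall 0 1 \ {0})) ∧
      IsStableSolution N (fun t => Real.exp (g t)) lamStar uStar := by
  have hν : (10 : ℝ) ≤ N := by exact_mod_cast hN
  have hG := isConvexExponent_of_contDiffOn (hg.of_le (by norm_num)) hg₁ hg₂ hg₃
  obtain ⟨S, F, F₁, h⟩ := hG.exists_regularFamily hN
  obtain ⟨T, hT, hST, hlim⟩ := h.exists_limit_end hG hν
  obtain ⟨V, V₁, hV, hVtop, hVT, hVlim⟩ := h.exists_singular_profile hG hν hT hST hlim
  -- V is controlled only on (0, T). Replacing it by 0 from T on makes the profile continuous at T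
  -- and gives the boundary value.
  set W : ℝ → ℝ := (Iio T).indicator V with hWdef
  have hWV : EqOn W V (Ioo 0 T) := fun s hs => indicator_of_mem (mem_Iio.mpr hs.2) V
  have hW : IsProfile N g W V₁ T := hV.congr hWV
  have hWtop : Tendsto W (𝓝[>] 0) atTop := by
    refine hVtop.congr' ?_
    filter_upwards [Ioo_mem_nhdsGT hT] with s hs using (hWV hs).symm
  have hW0 : ∀ s, T ≤ s → W s = 0 := fun s hs => indicator_of_notMem (notMem_Iio.mpr hs) V
  have hWT : ContinuousAt W T := by
    rw [continuousAt_iff_continuous_left'_right', ContinuousWithinAt, ContinuousWithinAt,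
      hW0 T le_rfl]
    refine ⟨hVT.congr' ?_, tendsto_const_nhds.congr' ?_⟩
    · filter_upwards [Ioo_mem_nhdsLT hT] with s hs using (hWV hs).symm
    · filter_upwards [self_mem_nhdsWithin] with s hs using (hW0 s (mem_Ioi.mp hs).le).symm
  have hsing := hW.isRadialSingularSolution hG hT hWtop hWT (hW0 T le_rfl)
  refine ⟨T, fun x => W (T * ‖x‖ ^ 2), ⟨⟨S, h.isBifurcationCurve hG hN, h.end_strictMonoOn hG hν,
    hlim⟩, fun lam hlam => h.existsUnique_solution hG hN hlim hlam, _, hsing⟩, hsing,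
    fun lam u hu => ?_, hW.isStableSolution hG hN hT⟩
  obtain ⟨B, B₁, hB, hBtop, hBT, huB⟩ := hu.exists_isProfile (by omega)
  obtain ⟨rfl, hBV⟩ :=
    h.singular_unique hG hν hlim hV hT hVtop hVT hVlim hu.lam_pos hB hBtop hBT
  refine ⟨rfl, fun x hx => ?_⟩
  rcases (mem_closedBall_zero_iff.mp hx.1).eq_or_lt with hx1 | hx1
  · rw [hu.boundary x (mem_sphere_zero_iff_norm.mpr hx1)]
    exact (hW0 _ (by simp [hx1])).symm
  · have hs := mul_norm_sq_mem_Ioo hT hx.2 hx1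
    rw [huB x hx.2 hx1.le, hBV _ hs]
    exact (hWV hs).symm
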